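/- A clique of a finite simple graph $G=(V,E)$ is a set of pairwise adjacent vertices (the empty set and singletons are cliques). Let $C, D$ be cliques of $G$. - Under $\mathsf{TAR}(k)$ (token addition and removal with threshold $k\ge 0$), $C\leftrightarrow D$ if $|C|\ge k$, $|D|\ge k$ and $|C\mathbin{\triangle} D|=1$. - Under $\mathsf{TJ}$ (token jumping), $C\leftrightarrow D$ if $|C|=|D|$ and $|C\setminus D|=|D\setminus C|=1$. - Under $\mathsf{TS}$ (token sliding), $C\leftrightarrow D$ if $|C|=|D|$, $C\setminus D=\{v\}$, $D\setminus C=\{w\}$ and $vw\in E$. A reconfiguration sequence between two cliques under a rule is a finite sequence of cliques that starts with the one and ends with the other, in which any two consecutive cliques $C, D$ satisfy $C\leftrightarrow D$ under the rule; under $\mathsf{TAR}(k)$ all its cliques, also if there is only one, have size at least $k$. Clique reconfiguration under $\mathsf{TAR}$ is the problem of deciding, given $G$, two cliques $C_0, C_r$ of $G$ and an integer $k\ge 0$, whether there is a reconfiguration sequence between $C_0$ and $C_r$ under $\mathsf{TAR}(k)$. Clique reconfiguration under $\mathsf{TS}$ and under $\mathsf{TJ}$ is the analogous problem, without $k$.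 A cograph is a graph that can be obtained from graphs with at most one vertex by repeatedly taking disjoint unions and complements. **Proposition.** For each of the three rules $\mathsf{TAR}$, $\mathsf{TS}$ and $\mathsf{TJ}$, clique reconfiguration restricted to instances whose graph is a cograph can be solved in linear time: there is a random access machine (unit cost per instruction; constants, copying, addition, truncated subtraction, comparison, indirect load and store; words whose number of bits is logarithmic in the largest of the input length and the numbers in the input) that, given a cograph $G=(V,E)$ by its adjacency lists in arbitrary order, two cliques $C_0,C_r$ of $G$ as lists of vertices and, for $\mathsf{TAR}$, the threshold $k$, decides the problem correctly in $O(|V|+|E|+1)$ steps. -/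

import Mathlib

/-! ## Cographs -/

/-- Cographs: the smallest class of graphs, closed under isomorphism, that contains the graphs
with at most one vertex and is closed under disjoint unions and under complements. -/
inductive IsCograph : {V : Type} → SimpleGraph V → Prop
  | single {V : Type} [Subsingleton V] (G : SimpleGraph V) : IsCograph G
  | disjointUnion {V W : Type} {G : SimpleGraph V} {H : SimpleGraph W} :
      IsCograph G → IsCograph H → IsCograph (G ⊕g H)
  | complement {V : Type} {G : SimpleGraph V} : IsCograph G → IsCograph Gᶜ
  | ofIso {V W : Type} {G : SimpleGraph V} {H : SimpleGraph W} :
      (G ≃g H) → IsCograph G → IsCograph H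

/-! ## Clique reconfiguration -/

namespace CliqueReconf

variable {V : Type} [DecidableEq V]

/-- `C ↔ D` under token addition and removal with threshold `k`. -/
def TARStep (G : SimpleGraph V) (k : ℕ) (C D : Finset V) : Prop :=
  G.IsClique (C : Set V) ∧ G.IsClique (D : Set V) ∧
    k ≤ C.card ∧ k ≤ D.card ∧ ((C \ D) ∪ (D \ C)).card = 1

/-- `C ↔ D` under token jumping. -/
def TJStep (G : SimpleGraph V) (C D : Finset V) : Prop :=
  G.IsClique (C : Set V) ∧ G.IsClique (D : Set V) ∧
    C.card = D.card ∧ (C \ D).card = 1 ∧ (D \ C).card = 1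

/-- `C ↔ D` under token sliding. -/
def TSStep (G : SimpleGraph V) (C D : Finset V) : Prop :=
  G.IsClique (C : Set V) ∧ G.IsClique (D : Set V) ∧
    C.card = D.card ∧ ∃ v w : V, C \ D = {v} ∧ D \ C = {w} ∧ G.Adj v w

/-- There is a reconfiguration sequence from `C` to `D` under token addition and removal with
threshold `k`; every clique in such a sequence, also in one of length zero, has size at
least `k`. -/
def TARReachable (G : SimpleGraph V) (k : ℕ) (C D : Finset V) : Prop :=
  k ≤ C.card ∧ k ≤ D.card ∧ Relation.ReflTransGen (TARStep G k) C D

/-- There is a reconfiguration sequence from `C` to `D` under token jumping. -/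
def TJReachable (G : SimpleGraph V) (C D : Finset V) : Prop :=
  Relation.ReflTransGen (TJStep G) C D

/-- There is a reconfiguration sequence from `C` to `D` under token sliding. -/
def TSReachable (G : SimpleGraph V) (C D : Finset V) : Prop :=
  Relation.ReflTransGen (TSStep G) C D

end CliqueReconf

/-! ## Random access machines

Programs are written in goto-free form over registers `0, 1, 2, …` (a program mentions only
finitely many) and a random access memory; every executed instruction and every evaluated test
costs one step. All words are natural numbers below a bound `W`, and a computation that would
exceed the bound is stuck. -/

namespace RAM

/-- Contents of the registers and of the memory. -/
structure State where
  reg : ℕ → ℕ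
  mem : ℕ → ℕ

/-- The instructions; `sub` is truncated subtraction. -/
inductive Instr
  /-- `reg d := a` -/
  | const (d a : ℕ)
  /-- `reg d := reg x` -/
  | move (d x : ℕ)
  /-- `reg d := reg x + reg y` -/
  | add (d x y : ℕ)
  /-- `reg d := reg x - reg y` -/
  | sub (d x y : ℕ)
  /-- `reg d := mem (reg x)` -/
  | load (d x : ℕ)
  /-- `mem (reg x) := reg y` -/
  | store (x y : ℕ)

/-- Effect of an instruction. -/
def Instr.eval : Instr → State → State
  | .const d a, s => { s with reg := Function.update s.reg d a }
  | .move d x, s => { s with reg := Function.update s.reg d (s.reg x) }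
  | .add d x y, s => { s with reg := Function.update s.reg d (s.reg x + s.reg y) }
  | .sub d x y, s => { s with reg := Function.update s.reg d (s.reg x - s.reg y) }
  | .load d x, s => { s with reg := Function.update s.reg d (s.mem (s.reg x)) }
  | .store x y, s => { s with mem := Function.update s.mem (s.reg x) (s.reg y) }

/-- Tests, comparing two registers. -/
inductive Test
  /-- `reg x = reg y` -/
  | eq (x y : ℕ)
  /-- `reg x < reg y` -/
  | lt (x y : ℕ)

/-- Truth of a test. -/
def Test.Holds : Test → State → Prop
  | .eq x y, s => s.reg x = s.reg y
  | .lt x y, s => s.reg x < s.reg y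

/-- Programs. -/
inductive Program
  | skip
  | instr (i : Instr)
  | seq (p q : Program)
  | ite (b : Test) (p q : Program)
  | loop (b : Test) (p : Program)

/-- All words of a state are below `W`. -/
def State.Fits (W : ℕ) (s : State) : Prop :=
  (∀ i, s.reg i < W) ∧ ∀ i, s.mem i < W

/-- `Exec W p s t s'`: with words below `W`, the program `p` started in the state `s` halts in
the state `s'` after `t` steps; `loop b p` repeats `p` while `b` holds. -/
inductive Exec (W : ℕ) : Program → State → ℕ → State → Prop
  | skip {s : State} : s.Fits W → Exec W .skip s 1 s
  | instr {i : Instr} {s : State} : s.Fits W → (i.eval s).Fits W →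
      Exec W (.instr i) s 1 (i.eval s)
  | seq {p q : Program} {s s' s'' : State} {t t' : ℕ} :
      Exec W p s t s' → Exec W q s' t' s'' → Exec W (.seq p q) s (t + t') s''
  | iteTrue {b : Test} {p q : Program} {s s' : State} {t : ℕ} :
      b.Holds s → Exec W p s t s' → Exec W (.ite b p q) s (t + 1) s'
  | iteFalse {b : Test} {p q : Program} {s s' : State} {t : ℕ} :
      ¬ b.Holds s → Exec W q s t s' → Exec W (.ite b p q) s (t + 1) s'
  | loopTrue {b : Test} {p : Program} {s s' s'' : State} {t t' : ℕ} :
      b.Holds s → Exec W p s t s' → Exec W (.loop b p) s' t' s'' →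
      Exec W (.loop b p) s (t + 1 + t') s''
  | loopFalse {b : Test} {p : Program} {s : State} :
      s.Fits W → ¬ b.Holds s → Exec W (.loop b p) s 1 s

/-- Initial state: the input occupies the memory cells `0, 1, 2, …`, everything else is `0`. -/
def start (x : List ℕ) : State where
  reg _ := 0
  mem i := x.getD i 0

/-- The larger of the length and of the largest word of an input. -/
def magnitude (x : List ℕ) : ℕ := x.foldr max x.length

/-- The decision problem with instances `ι`, encoded by `input`, whose yes-instances are those
with `answer`, is solved by a single program in time `O(size + 1)`, on words with a number of
bits that is logarithmic in the magnitude of the input. The output is the final content of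
register `0`: `1` for yes, `0` for no. -/
def SolvableInLinearTime {ι : Type} (input : ι → List ℕ) (size : ι → ℕ) (answer : ι → Prop) :
    Prop :=
  ∃ (p : Program) (c : ℕ), ∀ a : ι, ∃ (t : ℕ) (s : State),
    Exec ((magnitude (input a) + 2) ^ c) p (start (input a)) t s ∧
    t ≤ c * (size a + 1) ∧
    (answer a → s.reg 0 = 1) ∧ (¬ answer a → s.reg 0 = 0)

end RAM

/-! ## Instances -/

/-- A cograph with vertex set `{0, …, n - 1}`, given by adjacency lists in arbitrary order,
together with two of its cliques, each given as a list of its vertices in arbitrary order. -/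
structure CographInstance where
  n : ℕ
  graph : SimpleGraph (Fin n)
  isCograph : IsCograph graph
  adj : Fin n → List (Fin n)
  adj_nodup : ∀ v, (adj v).Nodup
  mem_adj : ∀ v w, w ∈ adj v ↔ graph.Adj v w
  source : List (Fin n)
  source_nodup : source.Nodup
  source_isClique : graph.IsClique (source.toFinset : Set (Fin n))
  target : List (Fin n)
  target_nodup : target.Nodup
  target_isClique : graph.IsClique (target.toFinset : Set (Fin n))

namespace CographInstance

/-- A list of vertices, written as its length followed by its entries. -/
def block {n : ℕ} (l : List (Fin n)) : List ℕ := l.length :: l.map Fin.val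

/-- The number of vertices, the adjacency lists of `0, …, n - 1`, and the two cliques. -/
def input (I : CographInstance) : List ℕ :=
  I.n :: (List.finRange I.n).flatMap (fun v => block (I.adj v)) ++
    block I.source ++ block I.target

/-- The number of vertices plus the number of edges. -/
noncomputable def size (I : CographInstance) : ℕ := I.n + I.graph.edgeSet.ncard

end CographInstance

/-! ## Graphs without an induced path on four vertices -/

namespace CliqueReconf

/-! Of cographs only one fact is used: they have no induced path on four vertices. In such a graph
every greedy colouring, in whatever order, needs exactly as many colours as a largest clique has
vertices (`exists_clique_of_grundy`), so clique numbers can be computed in linear time.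

Additions lead from the start clique to a maximal clique `C`, so start from `C`. The sets `missing G
C v` of vertices of `C` not adjacent to `v` are laminar; outside `C`, disjoint missing sets force
adjacency and strictly nested ones forbid it. The level of `v` is the size of its missing set. Let
`x w` be the clique number of `below G C w`, the vertices of lower level not adjacent to `w`, and
let `S` be the set of `v` with `x v + k ≤ M`, where `M` is the clique number of `S` itself. No
sequence leaves `S`: if a vertex outside `S` could be added to a clique `A` in `S`, then `A`, of
size at least `k`, would be complete to a maximum clique below some `z` outside `S`, and the union
would be a clique of `S` of size at least `k + x z > M` (`subset_of_reach`). If moreover `S` can be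
built up in order of `x`, then every clique of size `M` in `S` is connected to `C`: its vertices of
largest `x` are exchanged, class by class, for maximum cliques below them (`reach_aux`). Hence
reachability means that the two values of `M` agree and that the target lies in the set `S` of the
source (`tarReachable_iff`). For cliques of equal size `c`, sliding amounts to threshold `c`, and
jumping to threshold `c - 1`.

For the algorithm, a greedy colouring in order of level yields `x`: it is the number of colours on
lower levels minus the number of those seen at lower neighbours (`isCliqueNumOn_below`). A second
greedy colouring, in order of `x`, starts with `M` equal to the size of `C` and accepts `v` when `x
v + k ≤ M`; it yields `S` and `M` (`PassTwo.isClosure`). A vertex costs time proportional to its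
degree plus one, and both orders come from counting sort. The program is written in a small language
whose clock bounds the number of machine steps (`Cmd.exec_compile`). -/

/-- There is no induced path on four vertices. -/
def P4Free {V : Type} (G : SimpleGraph V) : Prop :=
  ∀ a b c d, G.Adj a b → G.Adj b c → G.Adj c d → G.Adj a c ∨ G.Adj b d ∨ G.Adj a d

/-- A path on four vertices is connected, so it lies on one side of a disjoint union, and its
complement is again such a path. Distinctness of the four vertices need not be demanded in `P4Free`:
any coincidence produces one of the three chords. -/
theorem P4Free.of_isCograph {V : Type} {G : SimpleGraph V} (h : IsCograph G) : P4Free G := by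
  induction h with
  | single G =>
    intro a b c d hab
    exact absurd (Subsingleton.elim a b) hab.ne
  | disjointUnion _ _ ih₁ ih₂ =>
    rintro (a | a) (b | b) (c | c) (d | d) <;> simp
    · exact ih₁ a b c d
    · exact ih₂ a b c d
  | complement _ ih =>
    rename_i V G _
    intro a b c d hab hbc hcd
    by_contra hcon
    simp only [SimpleGraph.compl_adj, not_or, not_and, not_not] at hab hbc hcd hcon
    obtain ⟨h1, h2, h3⟩ := hcon
    have hac : a ≠ c := by
      rintro rfl
      exact hcd.2 (h3 hcd.1)
    have hbd : b ≠ d := by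
      rintro rfl
      exact hab.2 (h3 hab.1)
    have had : a ≠ d := by
      rintro rfl
      exact hab.2 (h2 hab.1.symm).symm
    -- In the complement the path `a b c d` becomes the path `b d a c`.
    rcases ih b d a c (h2 hbd) (h3 had).symm (h1 hac) with h | h | h
    · exact hab.2 h.symm
    · exact hcd.2 h.symm
    · exact hbc.2 h
  | ofIso e _ ih =>
    intro a b c d hab hbc hcd
    have := ih (e.symm a) (e.symm b) (e.symm c) (e.symm d)
      (e.symm.map_adj_iff.2 hab) (e.symm.map_adj_iff.2 hbc) (e.symm.map_adj_iff.2 hcd)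
    simpa only [e.symm.map_adj_iff] using this

/-! ### Greedy colourings and clique numbers -/

variable {V : Type} [DecidableEq V]

set_option linter.unusedSectionVars false

/-- `m` is the largest size of a clique inside `S`. -/
def IsCliqueNumOn (G : SimpleGraph V) (S : Finset V) (m : ℕ) : Prop :=
  (∃ K ⊆ S, G.IsClique (K : Set V) ∧ K.card = m) ∧
    ∀ K ⊆ S, G.IsClique (K : Set V) → K.card ≤ m

/-- `col` is a colouring of `S` with positive colours, as produced by a greedy algorithm;
outside of `S` it is `0`. The bound `M` is attained unless it is the default `m₀`. -/
structure IsGreedyColoring (G : SimpleGraph V) (S : Finset V) (col : V → ℕ) (m₀ M : ℕ) :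
    Prop where
  ne_zero_iff : ∀ v, col v ≠ 0 ↔ v ∈ S
  proper : ∀ u ∈ S, ∀ v ∈ S, G.Adj u v → col u ≠ col v
  grundy : ∀ v ∈ S, ∀ c, 0 < c → c < col v → ∃ u ∈ S, G.Adj v u ∧ col u = c
  le : ∀ v, col v ≤ M
  default_le : m₀ ≤ M
  attained : M = m₀ ∨ ∃ v ∈ S, col v = M

theorem isClique_insert {G : SimpleGraph V} {K : Finset V} {u : V}
    (hK : G.IsClique (K : Set V)) (h : ∀ v ∈ K, u ≠ v → G.Adj u v) :
    G.IsClique ((insert u K : Finset V) : Set V) := by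
  rw [Finset.coe_insert]
  exact hK.insert h

theorem isClique_union {G : SimpleGraph V} {K L : Finset V}
    (hK : G.IsClique (K : Set V)) (hL : G.IsClique (L : Set V))
    (h : ∀ u ∈ K, ∀ v ∈ L, G.Adj u v) :
    G.IsClique ((K ∪ L : Finset V) : Set V) := by
  intro a ha b hb hab
  simp only [Finset.coe_union, Set.mem_union, Finset.mem_coe] at ha hb
  rcases ha with ha | ha <;> rcases hb with hb | hb
  · exact hK ha hb hab
  · exact h _ ha _ hb
  · exact (h _ hb _ ha).symm
  · exact hL ha hb hab

theorem isClique_mono {G : SimpleGraph V} {K L : Finset V} (h : K ⊆ L)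
    (hL : G.IsClique (L : Set V)) : G.IsClique (K : Set V) :=
  hL.subset (Finset.coe_subset.2 h)

/-- The clique grows by one vertex per colour, downwards from the colour of `v`. Every vertex of the
clique has a neighbour of the next colour; absence of induced paths makes one vertex of that colour
adjacent to all of them. -/
theorem exists_clique_of_grundy {G : SimpleGraph V} (hG : P4Free G) {S : Finset V}
    {col : V → ℕ} (proper : ∀ u ∈ S, ∀ v ∈ S, G.Adj u v → col u ≠ col v)
    (grundy : ∀ v ∈ S, ∀ c, 0 < c → c < col v → ∃ u ∈ S, G.Adj v u ∧ col u = c)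
    {v : V} (hv : v ∈ S) (d : ℕ) (hd : d < col v) :
    ∃ K ⊆ S, G.IsClique (K : Set V) ∧ K.card = d + 1 ∧ ∀ x ∈ K, col v ≤ col x + d := by
  classical
  induction d with
  | zero => exact ⟨{v}, by simpa, by simp, by simp, by simp⟩
  | succ d ih =>
    obtain ⟨K, hKS, hK, hcard, hcol⟩ := ih (by omega)
    set j := col v - (d + 1) with hj
    have hne : K.Nonempty := Finset.card_pos.1 (by omega)
    have hnb : ∀ x ∈ K, ∃ u ∈ S, G.Adj x u ∧ col u = j := fun x hx =>
      grundy x (hKS hx) j (by omega) (by have := hcol x hx; omega)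
    obtain ⟨x₀, hx₀⟩ := hne
    obtain ⟨u₀, hu₀S, -, hu₀⟩ := hnb x₀ hx₀
    -- Among the vertices of colour `j`, `u` has the most neighbours in `K`. If it missed `y`, a
    -- neighbour `w` of `y` of colour `j` would, by maximality, miss some neighbour `x` of `u` in
    -- `K`, and `u x y w` would be an induced path; `u` and `w` are not adjacent since they share a
    -- colour.
    obtain ⟨u, hu, hmax⟩ := Finset.exists_max_image (S.filter (col · = j))
      (fun u => (K.filter (G.Adj u)).card) ⟨u₀, by simp [hu₀S, hu₀]⟩
    simp only [Finset.mem_filter] at hu hmax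
    have hall : ∀ y ∈ K, G.Adj u y := by
      by_contra hcon
      push Not at hcon
      obtain ⟨y, hyK, hyu⟩ := hcon
      obtain ⟨w, hwS, hyw, hwj⟩ := hnb y hyK
      have hlt : ∃ x ∈ K, G.Adj u x ∧ ¬ G.Adj w x := by
        by_contra hcon
        push Not at hcon
        have hlt := Finset.card_lt_card (s := K.filter (G.Adj u)) (t := K.filter (G.Adj w)) (by
          rw [Finset.ssubset_iff_of_subset (by
            intro x; simp only [Finset.mem_filter]; exact fun h => ⟨h.1, hcon x h.1 h.2⟩)]
          exact ⟨y, by simp [hyK, hyw.symm], by simp [hyu]⟩)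
        exact absurd (hmax w ⟨hwS, hwj⟩) (by omega)
      obtain ⟨x, hxK, hux, hwx⟩ := hlt
      have hxy : x ≠ y := by rintro rfl; exact hyu hux
      rcases hG u x y w hux (hK hxK hyK hxy) hyw with h | h | h
      · exact hyu h
      · exact hwx h.symm
      · exact proper u hu.1 w hwS h (by omega)
    have huK : u ∉ K := fun h => by have := hcol u h; omega
    refine ⟨insert u K, ?_, isClique_insert hK fun y hy _ => hall y hy, ?_, ?_⟩
    · exact Finset.insert_subset hu.1 hKS
    · rw [Finset.card_insert_of_notMem huK]; omega
    · intro x hx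
      rcases Finset.mem_insert.1 hx with rfl | hx
      · omega
      · have := hcol x hx; omega

/-- A clique has at most as many vertices as there are colours for them. -/
theorem card_le_of_proper {G : SimpleGraph V} {K : Finset V} {col : V → ℕ} {T : Finset ℕ}
    (proper : ∀ u ∈ K, ∀ v ∈ K, G.Adj u v → col u ≠ col v) (hT : ∀ v ∈ K, col v ∈ T)
    (hK : G.IsClique (K : Set V)) : K.card ≤ T.card := by
  refine Finset.card_le_card_of_injOn col hT ?_
  intro a ha b hb hab
  by_contra hne
  exact proper a ha b hb (hK ha hb hne) hab

theorem IsGreedyColoring.card_le {G : SimpleGraph V} {S : Finset V} {col : V → ℕ} {m₀ M : ℕ}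
    (h : IsGreedyColoring G S col m₀ M) {K : Finset V} (hKS : K ⊆ S)
    (hK : G.IsClique (K : Set V)) : K.card ≤ M := by
  have := card_le_of_proper (T := Finset.Icc 1 M)
    (fun u hu v hv => h.proper u (hKS hu) v (hKS hv))
    (fun v hv => Finset.mem_Icc.2
      ⟨Nat.one_le_iff_ne_zero.2 ((h.ne_zero_iff v).2 (hKS hv)), h.le v⟩) hK
  simpa using this

/-- A vertex of colour `M` heads a clique that uses all colours from `M` down to `1`. -/
theorem IsGreedyColoring.exists_clique {G : SimpleGraph V} (hG : P4Free G) {S : Finset V}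
    {col : V → ℕ} {m₀ M : ℕ} (h : IsGreedyColoring G S col m₀ M) :
    M = m₀ ∨ ∃ K ⊆ S, G.IsClique (K : Set V) ∧ K.card = M := by
  rcases h.attained with h0 | ⟨v, hv, hvM⟩
  · exact Or.inl h0
  · have := (h.ne_zero_iff v).2 hv
    obtain ⟨K, hKS, hK, hcard, -⟩ :=
      exists_clique_of_grundy hG h.proper h.grundy hv (M - 1) (by omega)
    exact Or.inr ⟨K, hKS, hK, by omega⟩

theorem IsGreedyColoring.isCliqueNumOn {G : SimpleGraph V} (hG : P4Free G) {S : Finset V}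
    {col : V → ℕ} {M : ℕ} (h : IsGreedyColoring G S col 0 M) : IsCliqueNumOn G S M := by
  refine ⟨?_, fun K hKS hK => h.card_le hKS hK⟩
  rcases h.exists_clique hG with rfl | h
  · exact ⟨∅, by simp, by simp, by simp⟩
  · exact h

theorem IsGreedyColoring.empty (G : SimpleGraph V) (m₀ : ℕ) :
    IsGreedyColoring G ∅ (fun _ => 0) m₀ m₀ :=
  ⟨by simp, by simp, by simp, by simp, le_rfl, Or.inl rfl⟩

/-- Colours once given never change, so neighbours that justify the colours of older vertices remain
in place. -/
theorem IsGreedyColoring.insert {G : SimpleGraph V} {S : Finset V}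
    {col col' : V → ℕ} {m₀ M c : ℕ} (h : IsGreedyColoring G S col m₀ M) {v : V} (hv : v ∉ S)
    (hc : 0 < c) (hfree : ∀ u ∈ S, G.Adj v u → col u ≠ c)
    (hlt : ∀ c', 0 < c' → c' < c → ∃ u ∈ S, G.Adj v u ∧ col u = c')
    (hcol' : ∀ u, col' u = if u = v then c else col u) :
    IsGreedyColoring G (insert v S) col' m₀ (max M c) := by
  have hS : ∀ u ∈ S, u ≠ v := fun u hu huv => hv (huv ▸ hu)
  refine ⟨fun u => ?_, ?_, ?_, ?_, h.default_le.trans (le_max_left _ _), ?_⟩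
  · rw [hcol' u]
    by_cases hu : u = v
    · simp [hu]; omega
    · simp [hu, h.ne_zero_iff]
  · intro a ha b hb hab
    rw [hcol', hcol']
    rcases Finset.mem_insert.1 ha with rfl | ha' <;>
      rcases Finset.mem_insert.1 hb with rfl | hb'
    · exact absurd hab (G.irrefl)
    · simp only [if_true, if_neg (hS b hb')]
      exact (hfree b hb' hab).symm
    · simp only [if_true, if_neg (hS a ha')]
      exact hfree a ha' hab.symm
    · simp only [if_neg (hS a ha'), if_neg (hS b hb')]
      exact h.proper a ha' b hb' hab
  · intro a ha c' hc' hlt'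
    rw [hcol'] at hlt'
    have : ∃ u ∈ S, G.Adj a u ∧ col u = c' := by
      rcases Finset.mem_insert.1 ha with rfl | ha
      · simp only [if_true] at hlt'
        exact hlt c' hc' hlt'
      · simp only [if_neg (hS a ha)] at hlt'
        exact h.grundy a ha c' hc' hlt'
    obtain ⟨u, hu, hau, huc⟩ := this
    exact ⟨u, Finset.mem_insert_of_mem hu, hau, by rw [hcol', if_neg (hS u hu), huc]⟩
  · intro u
    rw [hcol']
    split_ifs
    · exact le_max_right _ _
    · exact (h.le u).trans (le_max_left _ _)
  · rcases le_total M c with hMc | hMc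
    · exact Or.inr ⟨v, by simp, by rw [hcol']; simp [hMc]⟩
    · rw [max_eq_left hMc]
      rcases h.attained with h0 | ⟨u, hu, huM⟩
      · exact Or.inl h0
      · exact Or.inr ⟨u, Finset.mem_insert_of_mem hu, by rw [hcol', if_neg (hS u hu), huM]⟩

end CliqueReconf

/-! ## Cliques reachable from a maximal clique -/

namespace CliqueReconf

open Classical in
/-- The vertices of `C` that are not adjacent to `v`; none if `v` belongs to `C`. -/
noncomputable def missing {V : Type} (G : SimpleGraph V) (C : Finset V) (v : V) : Finset V :=
  if v ∈ C then ∅ else C.filter fun c => ¬ G.Adj v c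

/-- `C` is a clique to which no vertex can be added. -/
def IsMaximalClique {V : Type} (G : SimpleGraph V) (C : Finset V) : Prop :=
  G.IsClique (C : Set V) ∧ ∀ v ∉ C, ∃ c ∈ C, ¬ G.Adj v c

set_option linter.unusedSectionVars false

/-! ### The laminar family of missing sets -/

section Levels

variable {V : Type} {G : SimpleGraph V} {C : Finset V} {u v w : V}

theorem missing_of_mem (hv : v ∈ C) : missing G C v = ∅ := by simp [missing, hv]

theorem mem_missing {c : V} : c ∈ missing G C v ↔ v ∉ C ∧ c ∈ C ∧ ¬ G.Adj v c := by
  by_cases hv : v ∈ C <;> simp [missing, hv]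

theorem missing_eq_empty_iff (hC : IsMaximalClique G C) : missing G C v = ∅ ↔ v ∈ C := by
  refine ⟨fun h => ?_, missing_of_mem⟩
  by_contra hv
  obtain ⟨c, hc, hvc⟩ := hC.2 v hv
  have : c ∈ missing G C v := mem_missing.2 ⟨hv, hc, hvc⟩
  simp [h] at this

/-- With `a` missed by `u` and `b` missed by `w`, disjointness gives the path `u b a w`, whose only
possible chord is `uw`. -/
theorem adj_of_disjoint_missing (hG : P4Free G) (hC : IsMaximalClique G C) (hu : u ∉ C)
    (hw : w ∉ C) (h : Disjoint (missing G C u) (missing G C w)) : G.Adj u w := by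
  obtain ⟨a, ha, hua⟩ := hC.2 u hu
  obtain ⟨b, hb, hwb⟩ := hC.2 w hw
  rw [Finset.disjoint_left] at h
  have haw : G.Adj w a := by
    by_contra hwa
    exact h (mem_missing.2 ⟨hu, ha, hua⟩) (mem_missing.2 ⟨hw, ha, hwa⟩)
  have hbu : G.Adj u b := by
    by_contra hub
    exact h (mem_missing.2 ⟨hu, hb, hub⟩) (mem_missing.2 ⟨hw, hb, hwb⟩)
  have hab : b ≠ a := by rintro rfl; exact hua hbu
  rcases hG u b a w hbu (hC.1 hb ha hab) haw.symm with h | h | h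
  · exact absurd h hua
  · exact absurd h.symm hwb
  · exact h

/-- With `a` missed by both and `b` missed by `w` only, an edge `uw` would make `w u b a` an induced
path. -/
theorem not_adj_of_missing_ssubset (hG : P4Free G) (hC : IsMaximalClique G C) (hu : u ∉ C)
    (h : missing G C u ⊂ missing G C w) : ¬ G.Adj u w := by
  intro huw
  obtain ⟨a, ha, hua⟩ := hC.2 u hu
  obtain ⟨b, hbw, hbu⟩ := Finset.exists_of_ssubset h
  have haw := h.subset (mem_missing.2 ⟨hu, ha, hua⟩)
  rw [mem_missing] at hbw haw hbu
  have hub : G.Adj u b := by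
    by_contra hub
    exact hbu ⟨hu, hbw.2.1, hub⟩
  have hab : b ≠ a := by rintro rfl; exact hua hub
  rcases hG w u b a huw.symm hub (hC.1 hbw.2.1 ha hab) with h | h | h
  · exact hbw.2.2 h
  · exact hua h
  · exact haw.2.2 h

/-- If the sets crossed, take `a` in both, `b` only in that of `u`, `c` only in that of `w`. The
induced path is `a c u w` if `u` and `w` are adjacent, and `u c b w` otherwise. -/
theorem missing_laminar (hG : P4Free G) (hC : IsMaximalClique G C) (u w : V) :
    Disjoint (missing G C u) (missing G C w) ∨ missing G C u ⊆ missing G C w ∨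
      missing G C w ⊆ missing G C u := by
  by_contra hcon
  push Not at hcon
  obtain ⟨h1, h2, h3⟩ := hcon
  obtain ⟨a, hau, haw⟩ := Finset.not_disjoint_iff.1 h1
  obtain ⟨b, hbu, hbw⟩ := Finset.not_subset.1 h2
  obtain ⟨c, hcw, hcu⟩ := Finset.not_subset.1 h3
  rw [mem_missing] at *
  have hwb : G.Adj w b := by
    by_contra h; exact hbw ⟨hcw.1, hbu.2.1, h⟩
  have huc : G.Adj u c := by
    by_contra h; exact hcu ⟨hbu.1, hcw.2.1, h⟩
  by_cases huw : G.Adj u w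
  · have hac : a ≠ c := by rintro rfl; exact hau.2.2 huc
    rcases hG a c u w (hC.1 hau.2.1 hcw.2.1 hac) huc.symm huw with h | h | h
    · exact hau.2.2 h.symm
    · exact hcw.2.2 h.symm
    · exact haw.2.2 h.symm
  · have hbc : c ≠ b := by rintro rfl; exact hbu.2.2 huc
    rcases hG u c b w huc (hC.1 hcw.2.1 hbu.2.1 hbc) hwb.symm with h | h | h
    · exact hbu.2.2 h
    · exact hcw.2.2 h.symm
    · exact huw h

variable [Fintype V]

open Classical in
/-- The vertices that are of lower level than `w` and not adjacent to `w`. -/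
noncomputable def below (G : SimpleGraph V) (C : Finset V) (w : V) : Finset V :=
  Finset.univ.filter fun u => (missing G C u).card < (missing G C w).card ∧ ¬ G.Adj u w

theorem mem_below_def :
    u ∈ below G C w ↔ (missing G C u).card < (missing G C w).card ∧ ¬ G.Adj u w := by
  simp [below]

/-- Expresses `below` through missing sets alone, so that it depends only on the class of `w`, the
vertices with the same missing set. -/
theorem mem_below (hG : P4Free G) (hC : IsMaximalClique G C) (hw : w ∉ C) :
    u ∈ below G C w ↔ (u ∈ C ∧ u ∈ missing G C w) ∨
      (u ∉ C ∧ missing G C u ⊂ missing G C w) := by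
  have hne : 0 < (missing G C w).card := by
    rw [Finset.card_pos, Finset.nonempty_iff_ne_empty, Ne, missing_eq_empty_iff hC]
    exact hw
  rw [mem_below_def]
  by_cases hu : u ∈ C
  · simp [hu, missing_of_mem hu, mem_missing, hw, G.adj_comm w u, hne]
  · simp only [hu, false_and, not_false_eq_true, true_and, false_or]
    constructor
    · rintro ⟨hlt, hadj⟩
      rcases missing_laminar hG hC u w with h | h | h
      · exact absurd (adj_of_disjoint_missing hG hC hu hw h) hadj
      · exact Finset.ssubset_iff_subset_ne.2 ⟨h, fun h' => by rw [h'] at hlt; omega⟩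
      · exact absurd (Finset.card_le_card h) (by omega)
    · exact fun h => ⟨Finset.card_lt_card h, not_adj_of_missing_ssubset hG hC hu h⟩

/-- A neighbour of `w` not of its class is adjacent to everything below `w`. -/
theorem adj_of_mem_below (hG : P4Free G) (hC : IsMaximalClique G C)
    (huw : G.Adj u w) (hne : missing G C u ≠ missing G C w) (hv : v ∈ below G C w) :
    G.Adj u v := by
  classical
  by_cases hw : w ∈ C
  · rw [mem_below_def, missing_of_mem hw] at hv
    simp at hv
  -- The edge `uw` rules out strict inclusion either way, and `hne` rules out equality; laminarity
  -- leaves disjointness.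
  have hdisj : ∀ x ∈ missing G C w, x ∉ missing G C u := by
    by_cases hu : u ∈ C
    · simp [missing_of_mem hu]
    · rcases missing_laminar hG hC u w with h | h | h
      · exact fun x hx hx' => Finset.disjoint_left.1 h hx' hx
      · exact absurd huw (not_adj_of_missing_ssubset hG hC hu
          (Finset.ssubset_iff_subset_ne.2 ⟨h, hne⟩))
      · exact absurd huw.symm (not_adj_of_missing_ssubset hG hC hw
          (Finset.ssubset_iff_subset_ne.2 ⟨h, hne.symm⟩))
  have hnot : u ∈ C → u ∉ missing G C w := fun _ h => (mem_missing.1 h).2.2 huw.symm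
  rcases (mem_below hG hC hw).1 hv with ⟨hvC, hvw⟩ | ⟨hvC, hvw⟩
  · by_cases hu : u ∈ C
    · exact hC.1 hu hvC (by rintro rfl; exact hnot hu hvw)
    · by_contra h
      exact hdisj v hvw (mem_missing.2 ⟨hu, hvC, h⟩)
  · by_cases hu : u ∈ C
    · by_contra h
      exact hnot hu (hvw.subset (mem_missing.2 ⟨hvC, hu, fun h' => h h'.symm⟩))
    · refine adj_of_disjoint_missing hG hC hu hvC (Finset.disjoint_left.2 fun x hx hx' => ?_)
      exact hdisj x (hvw.subset hx') hx

/-- For `u` outside `C`, the hypotheses exclude all positions of the two missing sets except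
disjointness. For `u` in `C`, a missed `u` would be below `w`. -/
theorem adj_of_not_mem_below (hG : P4Free G) (hC : IsMaximalClique G C) (hw : w ∉ C)
    (hu : u ∉ below G C w) (hne : missing G C u ≠ missing G C w)
    (hss : ¬ missing G C w ⊂ missing G C u) : G.Adj u w := by
  rw [mem_below hG hC hw] at hu
  by_cases huC : u ∈ C
  · by_contra h
    exact hu (Or.inl ⟨huC, mem_missing.2 ⟨hw, huC, fun h' => h h'.symm⟩⟩)
  · rcases missing_laminar hG hC u w with h | h | h
    · exact adj_of_disjoint_missing hG hC huC hw h
    · exact absurd (Or.inr ⟨huC, Finset.ssubset_iff_subset_ne.2 ⟨h, hne⟩⟩) hu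
    · exact absurd (Finset.ssubset_iff_subset_ne.2 ⟨h, hne.symm⟩) hss

theorem not_mem_of_missing_eq (hC : IsMaximalClique G C) (hw : w ∉ C)
    (h : missing G C u = missing G C w) : u ∉ C := by
  intro hu
  rw [missing_of_mem hu, eq_comm, missing_eq_empty_iff hC] at h
  exact hw h

theorem below_congr (hG : P4Free G) (hC : IsMaximalClique G C) (hu : u ∉ C) (hw : w ∉ C)
    (h : missing G C u = missing G C w) : below G C u = below G C w := by
  ext x
  rw [mem_below hG hC hu, mem_below hG hC hw, h]

theorem below_of_mem (hw : w ∈ C) : below G C w = ∅ := by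
  ext x
  simp [mem_below_def, missing_of_mem hw]

end Levels

/-! ### Elementary reconfiguration under token addition and removal -/

section Steps

variable {V : Type} [DecidableEq V] {G : SimpleGraph V}

theorem TARStep.symm {k : ℕ} {K L : Finset V} (h : TARStep G k K L) : TARStep G k L K :=
  ⟨h.2.1, h.1, h.2.2.2.1, h.2.2.1, by rw [Finset.union_comm]; exact h.2.2.2.2⟩

theorem reach_symm {k : ℕ} {K L : Finset V} (h : Relation.ReflTransGen (TARStep G k) K L) :
    Relation.ReflTransGen (TARStep G k) L K := by
  induction h with
  | refl => exact .refl
  | tail _ h ih => exact .head h.symm ih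

theorem reach_of_subset {k : ℕ} {K L : Finset V} (hKL : K ⊆ L) (hL : G.IsClique (L : Set V))
    (hk : k ≤ K.card) : Relation.ReflTransGen (TARStep G k) K L := by
  induction hn : (L \ K).card generalizing K with
  | zero =>
    rw [Finset.card_eq_zero, Finset.sdiff_eq_empty_iff_subset] at hn
    rw [hKL.antisymm hn]
  | succ n ih =>
    obtain ⟨v, hv⟩ : (L \ K).Nonempty := Finset.card_pos.1 (by omega)
    obtain ⟨hvL, hvK⟩ := Finset.mem_sdiff.1 hv
    have hsub : insert v K ⊆ L := Finset.insert_subset hvL hKL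
    refine .head (b := insert v K) ⟨isClique_mono hKL hL, isClique_mono hsub hL, hk, ?_, ?_⟩
      (ih hsub ?_ ?_)
    · exact hk.trans (Finset.card_le_card (Finset.subset_insert _ _))
    · have h1 : K \ insert v K = ∅ := by simp
      have h2 : insert v K \ K = {v} := by
        ext y
        simp only [Finset.mem_sdiff, Finset.mem_insert, Finset.mem_singleton]
        constructor
        · tauto
        · rintro rfl; exact ⟨Or.inl rfl, hvK⟩
      simp [h1, h2]
    · exact hk.trans (Finset.card_le_card (Finset.subset_insert _ _))
    · have : L \ insert v K = (L \ K).erase v := by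
        ext y; simp only [Finset.mem_sdiff, Finset.mem_insert, Finset.mem_erase]; tauto
      rw [this, Finset.card_erase_of_mem hv, hn]
      rfl

end Steps

/-! ### Clique numbers below vertices, and the barrier they form -/

section Reachability

variable {V : Type} [DecidableEq V] [Fintype V] {G : SimpleGraph V} {C : Finset V} {x : V → ℕ}

/-- `x w` is the largest size of a clique below `w`. -/
def IsBelowNum (G : SimpleGraph V) (C : Finset V) (x : V → ℕ) : Prop :=
  ∀ w, IsCliqueNumOn G (below G C w) (x w)

theorem IsBelowNum.eq_zero (hx : IsBelowNum G C x) {v : V} (hv : v ∈ C) : x v = 0 := by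
  obtain ⟨K, hK, -, h⟩ := (hx v).1
  rw [below_of_mem hv, Finset.subset_empty] at hK
  simp [← h, hK]

theorem IsBelowNum.pos (hG : P4Free G) (hC : IsMaximalClique G C) (hx : IsBelowNum G C x) {v : V}
    (hv : v ∉ C) : 0 < x v := by
  obtain ⟨c, hc, hvc⟩ := hC.2 v hv
  have := (hx v).2 {c} (by
    simp only [Finset.singleton_subset_iff, mem_below hG hC hv]
    exact Or.inl ⟨hc, mem_missing.2 ⟨hv, hc, hvc⟩⟩) (by simp)
  simpa [Nat.one_le_iff_ne_zero, Nat.pos_iff_ne_zero] using this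

theorem IsBelowNum.eq_of_missing_eq (hG : P4Free G) (hC : IsMaximalClique G C)
    (hx : IsBelowNum G C x) {u v : V} (hv : v ∉ C) (h : missing G C u = missing G C v) :
    x u = x v := by
  have hu := not_mem_of_missing_eq hC hv h
  have hb := below_congr hG hC hu hv h
  obtain ⟨⟨K, hK, hKc, hKn⟩, hmax⟩ := hx u
  obtain ⟨⟨L, hL, hLc, hLn⟩, hmax'⟩ := hx v
  have h1 := hmax L (hb ▸ hL) hLc
  have h2 := hmax' K (hb ▸ hK) hKc
  omega

/-- For `v` outside `C`, a vertex `c` of `C` missed by `w` but not by `v` is complete to everything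
below `v`; adding it to a maximum clique below `v` gives a larger clique below `w`. -/
theorem IsBelowNum.lt (hG : P4Free G) (hC : IsMaximalClique G C) (hx : IsBelowNum G C x) {v w : V}
    (hw : w ∉ C) (h : v ∈ below G C w) : x v < x w := by
  by_cases hv : v ∈ C
  · rw [hx.eq_zero hv]
    exact hx.pos hG hC hw
  have hvw : missing G C v ⊂ missing G C w := by
    rcases (mem_below hG hC hw).1 h with h | h
    · exact absurd h.1 hv
    · exact h.2
  obtain ⟨c, hcw, hcv⟩ := Finset.exists_of_ssubset hvw
  obtain ⟨K, hK, hKc, hKn⟩ := (hx v).1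
  have hcC := (mem_missing.1 hcw).2.1
  have hcadj : G.Adj c v := by
    by_contra hadj
    exact hcv (mem_missing.2 ⟨hv, hcC, fun h' => hadj h'.symm⟩)
  have hne : missing G C c ≠ missing G C v := fun h' => not_mem_of_missing_eq hC hv h' hcC
  have hcK : ∀ y ∈ K, G.Adj c y := fun y hy => adj_of_mem_below hG hC hcadj hne (hK hy)
  have hcn : c ∉ K := fun h' => G.irrefl (hcK c h')
  have := (hx w).2 (insert c K) (by
    intro y hy
    rw [mem_below hG hC hw]
    rcases Finset.mem_insert.1 hy with rfl | hy
    · exact Or.inl ⟨hcC, hcw⟩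
    · rcases (mem_below hG hC hv).1 (hK hy) with h' | h'
      · exact Or.inl ⟨h'.1, hvw.subset h'.2⟩
      · exact Or.inr ⟨h'.1, h'.2.trans hvw⟩)
    (isClique_insert hKc fun y hy _ => hcK y hy)
  rw [Finset.card_insert_of_notMem hcn] at this
  omega

/-- What a run of the algorithm from the maximal clique `C` with threshold `k` computes: the set
`S` of vertices that can be used, and the largest size `M` of a clique inside `S`. -/
structure IsClosure (G : SimpleGraph V) (C : Finset V) (k : ℕ) (S : Finset V) (M : ℕ) :
    Prop where
  exists_below :
    ∃ x, IsBelowNum G C x ∧ (∀ v, v ∈ S ↔ x v + k ≤ M) ∧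
      ∀ v ∈ S, v ∉ C → ∃ K : Finset V, (∀ u ∈ K, x u < x v) ∧ G.IsClique (K : Set V) ∧
        x v + k ≤ K.card
  cliqueNum : IsCliqueNumOn G S M
  le : k ≤ M

/-- Consider the first step that adds a vertex `w` outside `S` to a clique `A` inside `S`. Since `A`
has at least `k` vertices and is complete to `below G C w`, a suitable clique below `w` enlarges it
beyond `M` without leaving `S`. -/
theorem subset_of_reach (hG : P4Free G) (hC : IsMaximalClique G C) {k M : ℕ} {S : Finset V}
    (h : IsClosure G C k S M) {K L : Finset V} (hK : K ⊆ S)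
    (hKL : Relation.ReflTransGen (TARStep G k) K L) : L ⊆ S := by
  classical
  obtain ⟨⟨x, hx, hS, -⟩, hM, hkM⟩ := h
  induction hKL with
  | refl => exact hK
  | @tail A B _ hstep ih =>
    intro w hwB
    by_contra hwS
    have hwA : w ∉ A := fun h => hwS (ih h)
    have hsingle : (A \ B) ∪ (B \ A) = {w} := by
      obtain ⟨y, hy⟩ := Finset.card_eq_one.1 hstep.2.2.2.2
      have : w ∈ (A \ B) ∪ (B \ A) := by simp [hwA, hwB]
      rw [hy] at this ⊢
      rw [Finset.mem_singleton.1 this]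
    have hAB : A ⊆ B := by
      intro y hy
      by_contra hyB
      have : y ∈ (A \ B) ∪ (B \ A) := by simp [hy, hyB]
      rw [hsingle, Finset.mem_singleton] at this
      exact hwA (this ▸ hy)
    have hAw : ∀ u ∈ A, G.Adj u w := fun u hu =>
      hstep.2.1 (hAB hu) hwB (by rintro rfl; exact hwA hu)
    have hCS : C ⊆ S := fun c hc => by rw [hS, hx.eq_zero hc]; omega
    have hwC : w ∉ C := fun h => hwS (hCS h)
    -- By minimality of its level, everything below `z` is in `S`, while `z` is not, so `M < x z +
    -- k`.
    obtain ⟨z, hz, hzmin⟩ := Finset.exists_min_image ((insert w (below G C w)) \ S)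
      (fun v => (missing G C v).card) ⟨w, by simp [hwS]⟩
    simp only [Finset.mem_sdiff, Finset.mem_insert] at hz hzmin
    have hzC : z ∉ C := fun h => hz.2 (hCS h)
    have hsub : below G C z ⊆ below G C w := by
      rcases hz.1 with rfl | hzw
      · exact subset_rfl
      · have hss : missing G C z ⊂ missing G C w := by
          rcases (mem_below hG hC hwC).1 hzw with h | h
          · exact absurd h.1 hzC
          · exact h.2
        intro y hy
        rw [mem_below hG hC hwC]
        rcases (mem_below hG hC hzC).1 hy with h | h
        · exact Or.inl ⟨h.1, hss.subset h.2⟩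
        · exact Or.inr ⟨h.1, h.2.trans hss⟩
    have hbS : below G C z ⊆ S := by
      intro y hy
      by_contra hyS
      have h1 := hzmin y ⟨Or.inr (hsub hy), hyS⟩
      have h2 := (mem_below_def.1 hy).1
      omega
    obtain ⟨H, hH, hHc, hHn⟩ := (hx z).1
    -- A vertex of `A` in the class of `w` would have the same value of `x` and thus put `w` into
    -- `S`. The others are neighbours of `w` outside its class, hence complete to everything below
    -- it.
    have hcompl : ∀ u ∈ A, ∀ v ∈ H, G.Adj u v := by
      intro u hu v hv
      refine adj_of_mem_below hG hC (hAw u hu) (fun hmis => ?_) (hsub (hH hv))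
      have h1 := hx.eq_of_missing_eq hG hC hwC hmis
      have h2 := (hS u).1 (ih hu)
      rw [h1] at h2
      exact hwS ((hS w).2 h2)
    have hdisj : Disjoint A H := Finset.disjoint_left.2 fun u hu hu' => G.irrefl (hcompl u hu u hu')
    have h1 := hM.2 (A ∪ H) (Finset.union_subset ih (hH.trans hbS))
      (isClique_union hstep.1 hHc hcompl)
    rw [Finset.card_union_of_disjoint hdisj] at h1
    have h2 := hstep.2.2.1
    have h3 : ¬ x z + k ≤ M := fun h => hz.2 ((hS z).2 h)
    omega

end Reachability

end CliqueReconf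

namespace CliqueReconf

set_option linter.unusedSectionVars false

/-! ### Connecting maximum cliques of the closure to `C` -/

section Main

variable {V : Type} [DecidableEq V] [Fintype V] {G : SimpleGraph V} {C : Finset V}

/-- Induction on the bound `t` for `x` on `L`, then on the number of vertices of `L` that attain it.
One whole class attaining the bound is exchanged for a maximum clique below it. The maximality
`hmax` keeps the clique in between large enough, and it passes to the new clique. At `t = 0` the
clique lies in `C`, and `hmax` makes it all of `C`. -/
theorem reach_aux (hG : P4Free G) (hC : IsMaximalClique G C) {k M : ℕ} {x : V → ℕ}
    (hx : IsBelowNum G C x) (t : ℕ) (htM : t + k ≤ M)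
    (hS : ∀ v, x v + k ≤ M → v ∉ C → ∃ K : Finset V, (∀ u ∈ K, x u < x v) ∧
      G.IsClique (K : Set V) ∧ x v + k ≤ K.card) (c : ℕ) (L : Finset V)
    (hL : G.IsClique (L : Set V)) (hLt : ∀ v ∈ L, x v ≤ t)
    (hc : (L.filter (x · = t)).card ≤ c)
    (hmax : ∀ K : Finset V, G.IsClique (K : Set V) →
      (∀ u ∈ K, u ∈ C ∨ x u < t ∨ u ∈ L) → K.card ≤ L.card) :
    Relation.ReflTransGen (TARStep G k) L C := by
  classical
  induction t generalizing c L with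
  | zero =>
    have hLC : L ⊆ C := fun v hv => by
      by_contra hvC
      have h1 := hx.pos hG hC hvC
      have h2 := hLt v hv
      omega
    rw [Finset.eq_of_subset_of_card_le hLC (hmax C hC.1 fun u hu => Or.inl hu)]
  | succ t iht =>
    induction c generalizing L with
    | zero =>
      have hno : ∀ v ∈ L, x v ≤ t := fun v hv => by
        by_contra h
        have : v ∈ L.filter (x · = t + 1) := by
          rw [Finset.mem_filter]; exact ⟨hv, by have := hLt v hv; omega⟩
        have := Finset.card_pos.2 ⟨v, this⟩
        omega
      refine iht (by omega) _ L hL hno le_rfl fun K hK hKu => hmax K hK fun u hu => ?_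
      rcases hKu u hu with h | h | h
      · exact Or.inl h
      · exact Or.inr (Or.inl (by omega))
      · exact Or.inr (Or.inr h)
    | succ c ihc =>
      by_cases hw : ∃ w ∈ L, x w = t + 1
      swap
      · push Not at hw
        refine ihc L hL hLt ?_ hmax
        rw [Finset.filter_eq_empty_iff.2 (fun v hv => hw v hv)]
        simp
      obtain ⟨w, hwL, hxw⟩ := hw
      have hwC : w ∉ C := fun h => by have := hx.eq_zero h; omega
      -- `LW` is the class of `w` within `L`, which will be replaced by `H`; the rest `LR` consists
      -- of neighbours of `w` outside its class, hence is complete to `H`.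
      set LW := L.filter (fun u => missing G C u = missing G C w) with hLW
      set LR := L.filter (fun u => ¬ missing G C u = missing G C w) with hLR
      have hcardL : LW.card + LR.card = L.card := Finset.card_filter_add_card_filter_not _
      have hLRL : LR ⊆ L := Finset.filter_subset _ _
      have hLWL : LW ⊆ L := Finset.filter_subset _ _
      obtain ⟨H, hH, hHc, hHn⟩ := (hx w).1
      have hxH : ∀ u ∈ H, x u < t + 1 := fun u hu => hxw ▸ hx.lt hG hC hwC (hH hu)
      have hLRadj : ∀ u ∈ LR, G.Adj u w := by
        intro u hu
        rw [hLR, Finset.mem_filter] at hu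
        exact hL hu.1 hwL (by rintro rfl; exact hu.2 rfl)
      have hLRH : ∀ u ∈ LR, ∀ v ∈ H, G.Adj u v := fun u hu v hv =>
        adj_of_mem_below hG hC (hLRadj u hu) (Finset.mem_filter.1 hu).2 (hH hv)
      have hcompl : ∀ u, x u ≤ t + 1 → u ∉ below G C w →
          missing G C u ≠ missing G C w → ∀ v ∈ LW, G.Adj u v := by
        intro u hxu hub hne v hv
        have hmis := (Finset.mem_filter.1 hv).2
        have hvC := not_mem_of_missing_eq hC hwC hmis
        refine adj_of_not_mem_below hG hC hvC ?_ (hmis ▸ hne) fun hss => ?_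
        · rw [below_congr hG hC hvC hwC hmis]; exact hub
        · rw [hmis] at hss
          have huC : u ∉ C := fun h => by
            rw [missing_of_mem h] at hss
            exact absurd hss.subset (by
              rw [Finset.subset_empty, missing_eq_empty_iff hC]; exact hwC)
          have := hx.lt hG hC huC ((mem_below hG hC huC).2 (Or.inr ⟨hwC, hss⟩))
          omega
      -- Outside `below G C w` the vertices of `K` are complete to `LW`. So `LW` can be added to
      -- them, and the maximality of `L` bounds the union by `LW.card + LR.card`.
      have hbound : ∀ K : Finset V, G.IsClique (K : Set V) →
          (∀ u ∈ K, u ∈ C ∨ x u < t + 1 ∨ u ∈ LR ∨ u ∈ H) →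
          (K \ below G C w).card ≤ LR.card := by
        intro K hK hKu
        have hadj : ∀ u ∈ K \ below G C w, ∀ v ∈ LW, G.Adj u v := by
          intro u hu v hv
          rw [Finset.mem_sdiff] at hu
          rcases hKu u hu.1 with h | h | h | h
          · exact hcompl u (by rw [hx.eq_zero h]; omega) hu.2
              (fun h' => not_mem_of_missing_eq hC hwC h' h) v hv
          · refine hcompl u h.le hu.2 (fun h' => ?_) v hv
            have := hx.eq_of_missing_eq hG hC hwC h'
            omega
          · exact hcompl u (hLt u (hLRL h)) hu.2 (Finset.mem_filter.1 h).2 v hv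
          · exact absurd (hH h) hu.2
        have h1 := hmax ((K \ below G C w) ∪ LW)
          (isClique_union (isClique_mono Finset.sdiff_subset hK) (isClique_mono hLWL hL) hadj) (by
            intro u hu
            rcases Finset.mem_union.1 hu with hu | hu
            · rcases hKu u (Finset.mem_sdiff.1 hu).1 with h | h | h | h
              · exact Or.inl h
              · exact Or.inr (Or.inl h)
              · exact Or.inr (Or.inr (hLRL h))
              · exact Or.inr (Or.inl (hxH u h))
            · exact Or.inr (Or.inr (hLWL hu)))
        rw [Finset.card_union_of_disjoint
          (Finset.disjoint_left.2 fun u hu hu' => G.irrefl (hadj u hu u hu'))] at h1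
        omega
      have hsplit : ∀ K : Finset V, G.IsClique (K : Set V) →
          K.card ≤ t + 1 + (K \ below G C w).card := by
        intro K hK
        have h1 := Finset.card_sdiff_add_card_inter K (below G C w)
        have h2 := (hx w).2 (K ∩ below G C w) Finset.inter_subset_right
          (isClique_mono Finset.inter_subset_left hK)
        omega
      -- The clique `K` supplied by `hS` has at least `x w + k` vertices, of which at most `x w` are
      -- below `w` and at most `LR.card` are elsewhere.
      have hkLR : k ≤ LR.card := by
        obtain ⟨K, hKx, hKc, hKn⟩ := hS w (by omega) hwC
        have h1 := hbound K hKc fun u hu => Or.inr (Or.inl (hxw ▸ hKx u hu))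
        have h2 := hsplit K hKc
        omega
      have hL0 : G.IsClique ((LR ∪ H : Finset V) : Set V) :=
        isClique_union (isClique_mono hLRL hL) hHc hLRH
      have hL0card : (LR ∪ H).card = LR.card + (t + 1) := by
        rw [Finset.card_union_of_disjoint
          (Finset.disjoint_left.2 fun u hu hu' => G.irrefl (hLRH u hu u hu')), hHn, hxw]
      -- Shrink `L` to `LR`, then grow to `LR ∪ H`. Fewer vertices attain `t + 1`, because `w` is
      -- gone and `x` is smaller on `H`.
      refine ((reach_symm (reach_of_subset hLRL hL hkLR)).trans
        (reach_of_subset Finset.subset_union_left hL0 hkLR)).trans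
        (ihc (LR ∪ H) hL0 ?_ ?_ ?_)
      · intro v hv
        rcases Finset.mem_union.1 hv with h | h
        · exact hLt v (hLRL h)
        · exact (hxH v h).le
      · have hlt : ((LR ∪ H).filter (x · = t + 1)).card < (L.filter (x · = t + 1)).card := by
          refine Finset.card_lt_card (Finset.ssubset_iff_subset_ne.2 ⟨?_, ?_⟩)
          · intro v hv
            rw [Finset.mem_filter] at hv ⊢
            rcases Finset.mem_union.1 hv.1 with h | h
            · exact ⟨hLRL h, hv.2⟩
            · have := hxH v h; omega
          · intro heq
            have : w ∈ (LR ∪ H).filter (x · = t + 1) := by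
              rw [heq]; exact Finset.mem_filter.2 ⟨hwL, hxw⟩
            rcases Finset.mem_union.1 (Finset.mem_filter.1 this).1 with h | h
            · exact (Finset.mem_filter.1 h).2 rfl
            · have := hxH w h; omega
        omega
      · intro K hK hKu
        have h1 := hbound K hK fun u hu => by
          have := hKu u hu
          rw [Finset.mem_union] at this
          exact this
        have h2 := hsplit K hK
        omega

theorem IsClosure.subset {k M : ℕ} {S : Finset V} (h : IsClosure G C k S M) : C ⊆ S := by
  obtain ⟨⟨x, hx, hS, -⟩, -, hkM⟩ := h
  intro c hc
  rw [hS, hx.eq_zero hc]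
  omega

/-- On `S` the values of `x` are at most `M - k`, and the competitors in the maximality condition of
`reach_aux` lie in `S`, where no clique exceeds `M`. -/
theorem reach_of_card_eq (hG : P4Free G) (hC : IsMaximalClique G C) {k M : ℕ} {S : Finset V}
    (h : IsClosure G C k S M) {L : Finset V} (hL : G.IsClique (L : Set V)) (hLS : L ⊆ S)
    (hLM : L.card = M) : Relation.ReflTransGen (TARStep G k) C L := by
  have hCS := h.subset
  obtain ⟨⟨x, hx, hS, hex⟩, hM, hkM⟩ := h
  refine reach_symm (reach_aux hG hC hx (M - k) (by omega)
    (fun v hv hvC => hex v ((hS v).2 hv) hvC) _ L hL (fun v hv => ?_) le_rfl fun K hK hKu => ?_)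
  · have := (hS v).1 (hLS hv)
    omega
  · rw [hLM]
    refine hM.2 K (fun u hu => ?_) hK
    rcases hKu u hu with h | h | h
    · exact hCS h
    · exact (hS u).2 (by omega)
    · exact hLS h

/-- Correctness of the algorithm for token addition and removal. -/
theorem tarReachable_iff (hG : P4Free G) {A B C D S T : Finset V} {k M N : ℕ}
    (hAC : A ⊆ C) (hBD : B ⊆ D) (hC : IsMaximalClique G C) (hD : IsMaximalClique G D)
    (hkA : k ≤ A.card) (hkB : k ≤ B.card) (hS : IsClosure G C k S M) (hT : IsClosure G D k T N) :
    TARReachable G k A B ↔ M = N ∧ B ⊆ S := by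
  have hA := reach_of_subset hAC hC.1 hkA
  have hB := reach_of_subset hBD hD.1 hkB
  obtain ⟨⟨L, hLS, hLc, hLM⟩, hmaxS⟩ := id hS.cliqueNum
  obtain ⟨⟨L', hLT, hLc', hLN⟩, hmaxT⟩ := id hT.cliqueNum
  have hCL := reach_of_card_eq hG hC hS hLc hLS hLM
  have hDL := reach_of_card_eq hG hD hT hLc' hLT hLN
  constructor
  · rintro ⟨-, -, h⟩
    -- Since `C` and `D` are connected, each closure contains a maximum clique of the other, so
    -- their clique numbers agree.
    have hCD := ((reach_symm hA).trans h).trans hB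
    have h1 := hmaxT L (subset_of_reach hG hD hT hT.subset ((reach_symm hCD).trans hCL)) hLc
    have h2 := hmaxS L' (subset_of_reach hG hC hS hS.subset (hCD.trans hDL)) hLc'
    exact ⟨by omega, subset_of_reach hG hC hS (hAC.trans hS.subset) h⟩
  · rintro ⟨rfl, hBS⟩
    refine ⟨hkA, hkB, ?_⟩
    -- The walk from `B` through `D` to a maximum clique of `T` cannot leave `S`; its end has size
    -- `M`, so it is also connected to `C`.
    have hLS' := subset_of_reach hG hC hS hBS (hB.trans hDL)
    exact (hA.trans (reach_of_card_eq hG hC hS hLc' hLS' hLN)).trans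
      (reach_symm (hB.trans hDL))

end Main

/-! ### Sliding and jumping as token addition and removal -/

section Rules

variable {V : Type} [DecidableEq V] {G : SimpleGraph V}

theorem TARStep.cases {k : ℕ} {K L : Finset V} (h : TARStep G k K L) :
    L ⊆ K ∨ ∃ w, w ∉ K ∧ L = insert w K := by
  obtain ⟨y, hy⟩ := Finset.card_eq_one.1 h.2.2.2.2
  by_cases hLK : L ⊆ K
  · exact Or.inl hLK
  obtain ⟨w, hwL, hwK⟩ := Finset.not_subset.1 hLK
  have hmem : ∀ z, (z ∈ K ∧ z ∉ L) ∨ (z ∈ L ∧ z ∉ K) ↔ z = y := fun z => by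
    have := congrArg (z ∈ ·) hy
    simpa using this
  have hwy := (hmem w).1 (Or.inr ⟨hwL, hwK⟩)
  refine Or.inr ⟨w, hwK, ?_⟩
  ext z
  rw [Finset.mem_insert]
  constructor
  · intro hz
    by_cases hzK : z ∈ K
    · exact Or.inr hzK
    · exact Or.inl (((hmem z).1 (Or.inr ⟨hz, hzK⟩)).trans hwy.symm)
  · rintro (rfl | hz)
    · exact hwL
    · by_contra hzL
      have := ((hmem z).1 (Or.inl ⟨hz, hzL⟩)).trans hwy.symm
      exact hwK (this ▸ hz)

theorem tarReachable_of_step {k : ℕ} {C : Finset V} {R : Finset V → Finset V → Prop}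
    (hcard : ∀ K L, R K L → K.card = L.card)
    (hstep : ∀ K L, R K L → K.card = C.card → Relation.ReflTransGen (TARStep G k) K L)
    (hk : k ≤ C.card) {D : Finset V} (h : Relation.ReflTransGen R C D) :
    C.card = D.card ∧ TARReachable G k C D := by
  suffices h' : C.card = D.card ∧ Relation.ReflTransGen (TARStep G k) C D from
    ⟨h'.1, hk, by omega, h'.2⟩
  induction h with
  | refl => exact ⟨rfl, .refl⟩
  | tail _ h ih =>
    exact ⟨ih.1.trans (hcard _ _ h), ih.2.trans (hstep _ _ h ih.1.symm)⟩

/-- A slide passes through the union of the two cliques, which is a clique because of the edge.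
Conversely, along a sequence with threshold `C.card`, every subset of that size of the current
clique can be reached by slides. -/
theorem tsReachable_iff {C D : Finset V} :
    TSReachable G C D ↔ C.card = D.card ∧ TARReachable G C.card C D := by
  constructor
  · refine tarReachable_of_step (fun K L h => h.2.2.1) ?_ le_rfl
    rintro K L ⟨hK, hL, hcard, v, w, hv, hw, hvw⟩ hKC
    have hvm : v ∈ K \ L := by simp [hv]
    have hwm : w ∈ L \ K := by simp [hw]
    rw [Finset.mem_sdiff] at hvm hwm
    have hins : insert w K = insert v L := by
      ext z
      have h1 : z ∈ K ∧ z ∉ L ↔ z = v := by simpa using congrArg (z ∈ ·) hv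
      have h2 : z ∈ L ∧ z ∉ K ↔ z = w := by simpa using congrArg (z ∈ ·) hw
      simp only [Finset.mem_insert]
      tauto
    have hcl : G.IsClique ((insert w K : Finset V) : Set V) := by
      refine isClique_insert hK fun z hz hne => ?_
      by_cases hzL : z ∈ L
      · exact hL hwm.1 hzL hne
      · have : z ∈ K \ L := by simp [hz, hzL]
        rw [hv, Finset.mem_singleton] at this
        exact this ▸ hvw.symm
    refine (reach_of_subset (Finset.subset_insert w K) hcl (by omega)).trans
      (reach_symm (reach_of_subset ?_ hcl (by omega)))
    rw [hins]
    exact Finset.subset_insert v L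
  · rintro ⟨hcard, -, -, h⟩
    suffices h' : ∀ K, Relation.ReflTransGen (TARStep G C.card) C K → ∀ P ⊆ K,
        P.card = C.card → Relation.ReflTransGen (TSStep G) C P from
      h' D h D subset_rfl hcard.symm
    intro K hK
    induction hK with
    | refl =>
      intro P hP hPC
      rw [Finset.eq_of_subset_of_card_le hP hPC.ge]
    | @tail K K' _ hs ih =>
      intro P hP hPC
      rcases hs.cases with hsub | ⟨w, hwK, rfl⟩
      · exact ih P (hP.trans hsub) hPC
      by_cases hwP : w ∈ P
      swap
      · exact ih P (by rwa [Finset.subset_insert_iff_of_notMem hwP] at hP) hPC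
      -- `P` contains the new vertex `w`. Replacing `w` by a vertex `v` of the old clique gives a
      -- set treated before, and `v` slides to `w` inside the clique `insert w K`.
      obtain ⟨v, hvK, hvP⟩ : ∃ v ∈ K, v ∉ P.erase w := by
        by_contra hcon
        push Not at hcon
        have h1 := Finset.card_le_card (show K ⊆ P.erase w from hcon)
        rw [Finset.card_erase_of_mem hwP] at h1
        have h2 := hs.2.2.1
        have := Finset.card_pos.2 ⟨w, hwP⟩
        omega
      have hvw : v ≠ w := by rintro rfl; exact hwK hvK
      have hvP' : v ∉ P := fun h' => hvP (Finset.mem_erase.2 ⟨hvw, h'⟩)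
      have hcardP : (insert v (P.erase w)).card = P.card := by
        rw [Finset.card_insert_of_notMem hvP, Finset.card_erase_of_mem hwP]
        have := Finset.card_pos.2 ⟨w, hwP⟩
        omega
      have hsubK : insert v (P.erase w) ⊆ K := by
        refine Finset.insert_subset hvK ?_
        rw [← Finset.subset_insert_iff]
        exact hP
      refine (ih _ hsubK (hcardP.trans hPC)).tail
        ⟨isClique_mono hsubK hs.1, isClique_mono hP hs.2.1, hcardP, v, w, ?_, ?_, ?_⟩
      · ext z
        simp only [Finset.mem_sdiff, Finset.mem_insert, Finset.mem_erase, Finset.mem_singleton]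
        constructor
        · tauto
        · rintro rfl; tauto
      · ext z
        simp only [Finset.mem_sdiff, Finset.mem_insert, Finset.mem_erase, Finset.mem_singleton]
        constructor
        · tauto
        · rintro rfl
          exact ⟨hwP, by simp [hvw.symm]⟩
      · exact hs.2.1 (by simp [hvK]) (by simp) hvw

/-- A jump passes through the intersection, of size `C.card - 1`. Conversely, along a sequence with
that threshold, every clique of size `C.card` that shares all but at most one of its vertices with
the current clique can be reached by jumps. -/
theorem tjReachable_iff {C D : Finset V} (hD : G.IsClique (D : Set V)) :
    TJReachable G C D ↔ C.card = D.card ∧ TARReachable G (C.card - 1) C D := by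
  constructor
  · refine tarReachable_of_step (fun K L h => h.2.2.1) ?_ (by omega)
    rintro K L ⟨hK, hL, hcard, hv, hw⟩ hKC
    have h1 := Finset.card_sdiff_add_card_inter K L
    exact (reach_symm (reach_of_subset Finset.inter_subset_left hK (by omega))).trans
      (reach_of_subset Finset.inter_subset_right hL (by omega))
  · rintro ⟨hcard, -, -, h⟩
    rcases Nat.eq_zero_or_pos C.card with h0 | hpos
    · rw [Finset.card_eq_zero.1 h0, Finset.card_eq_zero.1 (hcard.symm.trans h0)]
      exact .refl
    suffices h' : ∀ K, Relation.ReflTransGen (TARStep G (C.card - 1)) C K → ∀ P : Finset V,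
        G.IsClique (P : Set V) → C.card ≤ (P ∩ K).card + 1 →
        P.card = C.card → Relation.ReflTransGen (TJStep G) C P from
      h' D h D hD (by rw [Finset.inter_self]; omega) hcard.symm
    have hjump : ∀ P Q : Finset V, G.IsClique (P : Set V) → G.IsClique (Q : Set V) →
        P.card = C.card → Q.card = C.card → C.card ≤ (Q ∩ P).card + 1 →
        Relation.ReflTransGen (TJStep G) P Q := by
      intro P Q hP hQ hPC hQC hPQ
      by_cases heq : C.card ≤ (Q ∩ P).card
      · have h1 := Finset.eq_of_subset_of_card_le
          (Finset.inter_subset_left (s₁ := Q) (s₂ := P)) (by omega)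
        have h2 := Finset.eq_of_subset_of_card_le
          (Finset.inter_subset_right (s₁ := Q) (s₂ := P)) (by omega)
        rw [← h1.symm.trans h2]
      · have h1 := Finset.card_sdiff_add_card_inter Q P
        have h2 := Finset.card_sdiff_add_card_inter P Q
        rw [Finset.inter_comm] at h2
        exact .single ⟨hP, hQ, by omega, by omega, by omega⟩
    intro K hK
    induction hK with
    | refl =>
      intro P hPc hP hPC
      -- That `C` is a clique is not assumed; it follows from the first step, or from `hD` if there
      -- is none.
      rcases Relation.ReflTransGen.cases_head h with rfl | ⟨K, hCK, -⟩
      · exact hjump _ _ hD hPc rfl hPC hP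
      · exact hjump _ _ hCK.1 hPc rfl hPC hP
    | @tail K K' _ hs ih =>
      intro P hPc hP hPC
      rcases hs.cases with hsub | ⟨w, hwK, rfl⟩
      · exact ih P hPc
          (hP.trans (by gcongr)) hPC
      by_cases hPK : C.card ≤ (P ∩ K).card + 1
      · exact ih P hPc hPK hPC
      have hwP : w ∈ P := by
        by_contra hwP
        rw [Finset.inter_insert_of_notMem hwP] at hP
        exact hPK hP
      have hcw : (P ∩ insert w K).card = (P ∩ K).card + 1 := by
        rw [Finset.inter_insert_of_mem hwP, Finset.card_insert_of_notMem (by simp [hwK])]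
      obtain ⟨v, hvK, hvP⟩ : ∃ v ∈ K, v ∉ P ∩ K := by
        by_contra hcon
        push Not at hcon
        have h1 := Finset.card_le_card (show K ⊆ P ∩ K from hcon)
        have h2 := hs.2.2.1
        omega
      have hvw : v ≠ w := by rintro rfl; exact hwK hvK
      have hvP' : v ∉ P := fun h' => hvP (Finset.mem_inter.2 ⟨h', hvK⟩)
      -- The intermediate clique consists of `v` and the common part of `P` and `insert w K`. It
      -- shares `C.card - 1` vertices with `K` and as many with `P`.
      have hsubK : insert v (P ∩ insert w K) ⊆ insert w K :=
        Finset.insert_subset (by simp [hvK]) Finset.inter_subset_right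
      have hcard' : (insert v (P ∩ insert w K)).card = C.card := by
        rw [Finset.card_insert_of_notMem (by simp [hvP'])]
        omega
      have hcl := isClique_mono hsubK hs.2.1
      refine (ih _ hcl ?_ hcard').trans (hjump _ _ hcl hPc hcard' hPC ?_)
      · have : insert v (P ∩ K) ⊆ insert v (P ∩ insert w K) ∩ K := by
          intro z hz
          rw [Finset.mem_insert] at hz
          rcases hz with rfl | hz
          · simp [hvK]
          · rw [Finset.mem_inter] at hz
            simp [hz.1, hz.2]
        have := Finset.card_le_card this
        rw [Finset.card_insert_of_notMem hvP] at this
        omega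
      · have : P ∩ insert w K ⊆ P ∩ insert v (P ∩ insert w K) := by
          intro z hz
          rw [Finset.mem_inter] at hz ⊢
          exact ⟨hz.1, Finset.mem_insert_of_mem (Finset.mem_inter.2 hz)⟩
        have := Finset.card_le_card this
        omega

end Rules

end CliqueReconf

/-! ## A small imperative language, compiled to random access machines -/

namespace RAM

/-- Expressions: variables, constants, addition, truncated subtraction, cells of the input and
entries of arrays. -/
inductive Exp
  | var (x : ℕ)
  | lit (c : ℕ)
  | add (a b : Exp)
  | sub (a b : Exp)
  | inp (a : Exp)
  | arr (j : ℕ) (a : Exp)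

instance : Add Exp := ⟨Exp.add⟩
instance : Sub Exp := ⟨Exp.sub⟩
instance (n : ℕ) : OfNat Exp n := ⟨Exp.lit n⟩

/-- Conditions. -/
inductive Cond
  | lt (a b : Exp)
  | eq (a b : Exp)

/-- Commands; `put j a b` assigns `b` to the entry `a` of the array `j`. -/
inductive Cmd
  | skip
  | set (x : ℕ) (e : Exp)
  | put (j : ℕ) (a b : Exp)
  | seq (c d : Cmd)
  | ite (b : Cond) (c d : Cmd)
  | loop (b : Cond) (c : Cmd)

infixr:60 " ;; " => Cmd.seq
infix:62 " ::= " => Cmd.set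

/-- Values of variables and arrays, and a clock. -/
structure St where
  v : ℕ → ℕ
  a : ℕ → ℕ → ℕ
  t : ℕ

namespace St

/-- Advance the clock. -/
def tick (σ : St) (n : ℕ) : St := ⟨σ.v, σ.a, σ.t + n⟩

/-- Assign to a variable. -/
def set (σ : St) (x y n : ℕ) : St := ⟨Function.update σ.v x y, σ.a, σ.t + n⟩

/-- Assign to an array entry. -/
def put (σ : St) (j i y n : ℕ) : St :=
  ⟨σ.v, Function.update σ.a j (Function.update (σ.a j) i y), σ.t + n⟩

variable (σ : St) (x y n j i : ℕ)

@[simp] theorem tick_v : (σ.tick n).v = σ.v := rfl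
@[simp] theorem tick_a : (σ.tick n).a = σ.a := rfl
@[simp] theorem tick_t : (σ.tick n).t = σ.t + n := rfl
@[simp] theorem set_v (e : ℕ) : (σ.set x y n).v e = if e = x then y else σ.v e := by
  simp [set, Function.update_apply]
@[simp] theorem set_a : (σ.set x y n).a = σ.a := rfl
@[simp] theorem set_t : (σ.set x y n).t = σ.t + n := rfl
@[simp] theorem put_v : (σ.put j i y n).v = σ.v := rfl
@[simp] theorem put_t : (σ.put j i y n).t = σ.t + n := rfl
@[simp] theorem put_a (e f : ℕ) :
    (σ.put j i y n).a e f = if e = j then (if f = i then y else σ.a e f) else σ.a e f := by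
  by_cases h : e = j
  · subst h; simp [put, Function.update_apply]
  · simp [put, h]

end St

/-- The number of arrays is `32`. They are interleaved and start at the address `base`; the input
is below `B`. Words are below `W`, variables and array entries are at most `N`. -/
structure Env where
  W : ℕ
  base : ℕ
  B : ℕ
  N : ℕ
  inp : ℕ → ℕ
  inp_le : ∀ a < B, inp a ≤ N
  lt_W : base + 32 * N + 40 < W

namespace Exp

/-- The value of an expression. -/
def val (E : Env) (σ : St) : Exp → ℕ
  | var x => σ.v x
  | lit c => c
  | add a b => a.val E σ + b.val E σ
  | sub a b => a.val E σ - b.val E σ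
  | inp a => E.inp (a.val E σ)
  | arr j a => σ.a j (a.val E σ)

/-- The evaluation of an expression stays within the bounds. -/
def Ok (E : Env) (σ : St) : Exp → Prop
  | var _ => True
  | lit c => c ≤ E.N
  | add a b => a.Ok E σ ∧ b.Ok E σ ∧ a.val E σ + b.val E σ ≤ E.N
  | sub a b => a.Ok E σ ∧ b.Ok E σ
  | inp a => a.Ok E σ ∧ a.val E σ < E.B
  | arr j a => a.Ok E σ ∧ j < 32

/-- The number of steps of the evaluation of an expression. -/
def cost : Exp → ℕ
  | var _ => 1
  | lit _ => 1
  | add a b => a.cost + b.cost + 1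
  | sub a b => a.cost + b.cost + 1
  | inp a => a.cost + 1
  | arr _ a => a.cost + 9

section

variable (E : Env) (σ : St) (a b : Exp) (x j n : ℕ)

@[simp] theorem val_var : (var x).val E σ = σ.v x := rfl
@[simp] theorem val_lit : (lit x).val E σ = x := rfl
@[simp] theorem val_ofNat : (ofNat(n) : Exp).val E σ = n := rfl
@[simp] theorem val_add : (a + b).val E σ = a.val E σ + b.val E σ := rfl
@[simp] theorem val_sub : (a - b).val E σ = a.val E σ - b.val E σ := rfl
@[simp] theorem val_inp : (inp a).val E σ = E.inp (a.val E σ) := rfl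
@[simp] theorem val_arr : (arr j a).val E σ = σ.a j (a.val E σ) := rfl
@[simp] theorem ok_var : (var x).Ok E σ ↔ True := Iff.rfl
@[simp] theorem ok_lit : (lit x).Ok E σ ↔ x ≤ E.N := Iff.rfl
@[simp] theorem ok_ofNat : (ofNat(n) : Exp).Ok E σ ↔ n ≤ E.N := Iff.rfl
@[simp] theorem ok_add : (a + b).Ok E σ ↔
    a.Ok E σ ∧ b.Ok E σ ∧ a.val E σ + b.val E σ ≤ E.N := Iff.rfl
@[simp] theorem ok_sub : (a - b).Ok E σ ↔ a.Ok E σ ∧ b.Ok E σ := Iff.rfl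
@[simp] theorem ok_inp : (inp a).Ok E σ ↔ a.Ok E σ ∧ a.val E σ < E.B := Iff.rfl
@[simp] theorem ok_arr : (arr j a).Ok E σ ↔ a.Ok E σ ∧ j < 32 := Iff.rfl
@[simp] theorem cost_var : (var x).cost = 1 := rfl
@[simp] theorem cost_lit : (lit x).cost = 1 := rfl
@[simp] theorem cost_ofNat : (ofNat(n) : Exp).cost = 1 := rfl
@[simp] theorem cost_add : (a + b).cost = a.cost + b.cost + 1 := rfl
@[simp] theorem cost_sub : (a - b).cost = a.cost + b.cost + 1 := rfl
@[simp] theorem cost_inp : (inp a).cost = a.cost + 1 := rfl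
@[simp] theorem cost_arr : (arr j a).cost = a.cost + 9 := rfl

end

end Exp

namespace Cond

/-- Truth of a condition. -/
def Holds (E : Env) (σ : St) : Cond → Prop
  | lt a b => a.val E σ < b.val E σ
  | eq a b => a.val E σ = b.val E σ

/-- The evaluation of a condition stays within the bounds. -/
def Ok (E : Env) (σ : St) : Cond → Prop
  | lt a b => a.Ok E σ ∧ b.Ok E σ
  | eq a b => a.Ok E σ ∧ b.Ok E σ

/-- The number of steps of the evaluation of a condition. -/
def cost : Cond → ℕ
  | lt a b => a.cost + b.cost
  | eq a b => a.cost + b.cost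

section

variable (E : Env) (σ : St) (a b : Exp)

@[simp] theorem holds_lt : (lt a b).Holds E σ ↔ a.val E σ < b.val E σ := Iff.rfl
@[simp] theorem holds_eq : (eq a b).Holds E σ ↔ a.val E σ = b.val E σ := Iff.rfl
@[simp] theorem ok_lt : (lt a b).Ok E σ ↔ a.Ok E σ ∧ b.Ok E σ := Iff.rfl
@[simp] theorem ok_eq : (eq a b).Ok E σ ↔ a.Ok E σ ∧ b.Ok E σ := Iff.rfl
@[simp] theorem cost_lt : (lt a b).cost = a.cost + b.cost := rfl
@[simp] theorem cost_eq : (eq a b).cost = a.cost + b.cost := rfl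

end

end Cond

namespace Cmd

/-- Every run of a command from `σ` ends in a state that satisfies `Q`, provided that loops come
with an invariant. -/
def wp (E : Env) : Cmd → (St → Prop) → St → Prop
  | skip, Q, σ => Q (σ.tick 1)
  | set x e, Q, σ => e.Ok E σ ∧ Q (σ.set x (e.val E σ) (e.cost + 1))
  | put j a b, Q, σ => a.Ok E σ ∧ b.Ok E σ ∧ j < 32 ∧ E.B ≤ E.base ∧
      Q (σ.put j (a.val E σ) (b.val E σ) (a.cost + b.cost + 9))
  | seq c d, Q, σ => c.wp E (d.wp E Q) σ
  | ite b c d, Q, σ => b.Ok E σ ∧ (b.Holds E σ → c.wp E Q (σ.tick (b.cost + 1))) ∧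
      (¬ b.Holds E σ → d.wp E Q (σ.tick (b.cost + 1)))
  | loop b c, Q, σ => ∃ (m : ℕ) (I : ℕ → St → Prop), I 0 σ ∧
      (∀ i < m, ∀ σ', I i σ' → b.Ok E σ' ∧ b.Holds E σ' ∧
        c.wp E (I (i + 1)) (σ'.tick (b.cost + 1))) ∧
      ∀ σ', I m σ' → b.Ok E σ' ∧ ¬ b.Holds E σ' ∧ Q (σ'.tick (b.cost + 1))

section

variable (E : Env) (Q : St → Prop) (σ : St) (x j : ℕ) (a b : Exp) (c d : Cmd) (e : Cond)

@[simp] theorem wp_skip : skip.wp E Q σ ↔ Q (σ.tick 1) := Iff.rfl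
@[simp] theorem wp_set : (x ::= a).wp E Q σ ↔
    a.Ok E σ ∧ Q (σ.set x (a.val E σ) (a.cost + 1)) := Iff.rfl
@[simp] theorem wp_put : (put j a b).wp E Q σ ↔ a.Ok E σ ∧ b.Ok E σ ∧ j < 32 ∧ E.B ≤ E.base ∧
      Q (σ.put j (a.val E σ) (b.val E σ) (a.cost + b.cost + 9)) := Iff.rfl
@[simp] theorem wp_seq : (c ;; d).wp E Q σ ↔ c.wp E (d.wp E Q) σ := Iff.rfl
@[simp] theorem wp_ite : (ite e c d).wp E Q σ ↔ e.Ok E σ ∧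
    (e.Holds E σ → c.wp E Q (σ.tick (e.cost + 1))) ∧
    (¬ e.Holds E σ → d.wp E Q (σ.tick (e.cost + 1))) := Iff.rfl

end

theorem wp_mono {E : Env} {c : Cmd} {Q R : St → Prop} {σ : St} (h : c.wp E Q σ)
    (hQR : ∀ σ', Q σ' → R σ') : c.wp E R σ := by
  induction c generalizing Q R σ with
  | skip => exact hQR _ h
  | set x e => exact ⟨h.1, hQR _ h.2⟩
  | put j a b => exact ⟨h.1, h.2.1, h.2.2.1, h.2.2.2.1, hQR _ h.2.2.2.2⟩
  | seq c d ihc ihd => exact ihc h fun σ' h' => ihd h' hQR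
  | ite b c d ihc ihd => exact ⟨h.1, fun hb => ihc (h.2.1 hb) hQR, fun hb => ihd (h.2.2 hb) hQR⟩
  | loop b c ihc =>
    obtain ⟨m, I, h0, h1, h2⟩ := h
    exact ⟨m, I, h0, h1, fun σ' h' => ⟨(h2 σ' h').1, (h2 σ' h').2.1, hQR _ (h2 σ' h').2.2⟩⟩

theorem wp_loop {E : Env} {b : Cond} {c : Cmd} {Q : St → Prop} {σ : St} (m : ℕ)
    (I : ℕ → St → Prop) (h0 : I 0 σ)
    (h1 : ∀ i < m, ∀ σ', I i σ' → b.Ok E σ' ∧ b.Holds E σ' ∧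
        c.wp E (I (i + 1)) (σ'.tick (b.cost + 1)))
    (h2 : ∀ σ', I m σ' → b.Ok E σ' ∧ ¬ b.Holds E σ' ∧ Q (σ'.tick (b.cost + 1))) :
    (loop b c).wp E Q σ := ⟨m, I, h0, h1, h2⟩

end Cmd

/-! ### Compilation -/

/-- The register of the `d`-th temporary value. -/
def tmp (d : ℕ) : ℕ := 2 * d + 3

/-- Replace the index in the `d`-th temporary by the address of this entry of the array `j`. -/
def addrProg (j d : ℕ) : Program :=
  .seq (.instr (.add (tmp d) (tmp d) (tmp d))) <| .seq (.instr (.add (tmp d) (tmp d) (tmp d))) <|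
  .seq (.instr (.add (tmp d) (tmp d) (tmp d))) <| .seq (.instr (.add (tmp d) (tmp d) (tmp d))) <|
  .seq (.instr (.add (tmp d) (tmp d) (tmp d))) <| .seq (.instr (.add (tmp d) (tmp d) 1)) <|
  .seq (.instr (.const (tmp (d + 1)) j)) (.instr (.add (tmp d) (tmp d) (tmp (d + 1))))

/-- Compute the value of an expression into the `d`-th temporary. -/
def Exp.compile : Exp → ℕ → Program
  | .var x, d => .instr (.move (tmp d) (2 * x))
  | .lit c, d => .instr (.const (tmp d) c)
  | .add a b, d => .seq (a.compile d) <| .seq (b.compile (d + 1))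
      (.instr (.add (tmp d) (tmp d) (tmp (d + 1))))
  | .sub a b, d => .seq (a.compile d) <| .seq (b.compile (d + 1))
      (.instr (.sub (tmp d) (tmp d) (tmp (d + 1))))
  | .inp a, d => .seq (a.compile d) (.instr (.load (tmp d) (tmp d)))
  | .arr j a, d => .seq (a.compile d) <| .seq (addrProg j d) (.instr (.load (tmp d) (tmp d)))

/-- Compute the two sides of a condition. -/
def Cond.compile : Cond → Program
  | .lt a b => .seq (a.compile 0) (b.compile 1)
  | .eq a b => .seq (a.compile 0) (b.compile 1)

/-- The test for a condition whose two sides have been computed. -/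
def Cond.test : Cond → Test
  | .lt _ _ => .lt (tmp 0) (tmp 1)
  | .eq _ _ => .eq (tmp 0) (tmp 1)

/-- The machine program of a command. -/
def Cmd.compile : Cmd → Program
  | .skip => .skip
  | .set x e => .seq (e.compile 0) (.instr (.move (2 * x) (tmp 0)))
  | .put j a b => .seq (b.compile 0) <| .seq (a.compile 1) <| .seq (addrProg j 1)
      (.instr (.store (tmp 1) (tmp 0)))
  | .seq c d => .seq c.compile d.compile
  | .ite b c d => .seq b.compile (.ite b.test c.compile d.compile)
  | .loop b c => .seq b.compile (.loop b.test (.seq c.compile b.compile))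

/-- The machine state `s` represents `σ`. -/
structure Rep (E : Env) (σ : St) (s : State) : Prop where
  reg : ∀ x, s.reg (2 * x) = σ.v x
  base : s.reg 1 = E.base
  inp : ∀ a < E.B, s.mem a = E.inp a
  arr : ∀ j < 32, ∀ i, s.mem (E.base + 32 * i + j) = σ.a j i
  fits : s.Fits E.W
  v_le : ∀ x, σ.v x ≤ E.N
  a_le : ∀ j < 32, ∀ i, σ.a j i ≤ E.N

theorem State.Fits.update {W : ℕ} {s : State} (h : s.Fits W) {d x : ℕ} (hx : x < W) :
    State.Fits W { s with reg := Function.update s.reg d x } := by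
  refine ⟨fun i => ?_, h.2⟩
  by_cases hi : i = d
  · subst hi; simpa using hx
  · simpa [hi] using h.1 i

theorem exec_reg {W : ℕ} {s : State} (h : s.Fits W) {i : Instr} {d x : ℕ}
    (hi : i.eval s = { s with reg := Function.update s.reg d x }) (hx : x < W) :
    Exec W (.instr i) s 1 { s with reg := Function.update s.reg d x } :=
  hi ▸ Exec.instr h (hi ▸ h.update hx)

theorem exec_double {W : ℕ} {s : State} (h : s.Fits W) {d y : ℕ} (hy : s.reg d = y)
    (hx : y + y < W) :
    Exec W (.instr (.add d d d)) s 1 { s with reg := Function.update s.reg d (y + y) } :=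
  exec_reg h (by simp [Instr.eval, hy]) hx

/-- Five doublings multiply the index by `32`, the number of interleaved arrays; the next temporary
is scratch space for `j`. -/
theorem exec_addr {W : ℕ} {s : State} (h : s.Fits W) {j d i b : ℕ} (hi : s.reg (tmp d) = i)
    (hb : s.reg 1 = b) (hlt : b + 32 * i + j < W) :
    ∃ s', Exec W (addrProg j d) s 8 s' ∧ s'.Fits W ∧ s'.mem = s.mem ∧
      s'.reg (tmp d) = b + 32 * i + j ∧
      ∀ r, r ≠ tmp d → r ≠ tmp (d + 1) → s'.reg r = s.reg r := by
  have ht : tmp d ≠ tmp (d + 1) := by simp [tmp]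
  have h1 : 1 ≠ tmp d := by simp [tmp]
  let f (x : ℕ) : State := { s with reg := Function.update s.reg (tmp d) x }
  have hf : ∀ x < W, (f x).Fits W := fun x hx => h.update hx
  have hff : ∀ x, x + x < W → Exec W (.instr (.add (tmp d) (tmp d) (tmp d))) (f x) 1 (f (x + x)) :=
    fun x hx => by
      have := exec_double (hf x (by omega)) (d := tmp d) (y := x) (by simp [f]) hx
      simpa [f] using this
  have e1 : Exec W (.instr (.add (tmp d) (tmp d) (tmp d))) s 1 (f (i + i)) :=
    exec_double h hi (by omega)
  have e2 := hff (i + i) (by omega)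
  have e3 := hff (i + i + (i + i)) (by omega)
  have e4 := hff (i + i + (i + i) + (i + i + (i + i))) (by omega)
  have e5 := hff (i + i + (i + i) + (i + i + (i + i)) + (i + i + (i + i) + (i + i + (i + i))))
    (by omega)
  set z := i + i + (i + i) + (i + i + (i + i)) + (i + i + (i + i) + (i + i + (i + i))) +
    (i + i + (i + i) + (i + i + (i + i)) + (i + i + (i + i) + (i + i + (i + i)))) with hz
  have hz' : z = 32 * i := by omega
  have e6 : Exec W (.instr (.add (tmp d) (tmp d) 1)) (f z) 1 (f (z + b)) := by
    have := exec_reg (hf z (by omega)) (i := .add (tmp d) (tmp d) 1) (d := tmp d) (x := z + b)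
      (by simp [f, Instr.eval, hb, h1]) (by omega)
    simpa [f] using this
  let g (x : ℕ) : State := { s with
    reg := Function.update (Function.update s.reg (tmp d) x) (tmp (d + 1)) j }
  have e7 : Exec W (.instr (.const (tmp (d + 1)) j)) (f (z + b)) 1 (g (z + b)) :=
    exec_reg (hf _ (by omega)) (by simp [f, Instr.eval]) (by omega)
  have hg : (g (z + b)).Fits W := (hf _ (by omega)).update (by omega)
  have e8 := exec_reg hg (i := .add (tmp d) (tmp d) (tmp (d + 1))) (d := tmp d) (x := z + b + j)
    (by simp [g, Instr.eval, ht]) (by omega)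
  refine ⟨_, e1.seq (e2.seq (e3.seq (e4.seq (e5.seq (e6.seq (e7.seq e8)))))), hg.update (by omega),
    rfl, by simp; omega, fun r hr hr' => by simp [g, hr, hr']⟩

theorem Exp.val_le {E : Env} {σ : St} {s : State} (h : Rep E σ s) {e : Exp} (he : e.Ok E σ) :
    e.val E σ ≤ E.N := by
  induction e with
  | var x => exact h.v_le x
  | lit c => exact he
  | add a b _ _ => exact he.2.2
  | sub a b iha _ => exact (Nat.sub_le _ _).trans (iha he.1)
  | inp a _ => exact E.inp_le _ he.2
  | arr j a _ => exact h.a_le _ he.2 _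

/-- Variables occupy the even registers, the base register `1`, and temporaries the odd registers
from `3` on, so that temporaries may be overwritten freely. -/
theorem Rep.of_agree {E : Env} {σ : St} {s s' : State} (h : Rep E σ s) (hmem : s'.mem = s.mem)
    (hfits : s'.Fits E.W) (hreg : ∀ r, (∀ d, r ≠ tmp d) → s'.reg r = s.reg r) : Rep E σ s' where
  reg x := by rw [hreg _ (fun d => by simp only [tmp]; omega), h.reg]
  base := by rw [hreg _ (fun d => by simp only [tmp]; omega), h.base]
  inp a ha := by rw [hmem, h.inp a ha]
  arr j hj i := by rw [hmem, h.arr j hj i]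
  fits := hfits
  v_le := h.v_le
  a_le := h.a_le

theorem tmp_ne {d e : ℕ} (h : d ≠ e) : tmp d ≠ tmp e := by simp only [tmp]; omega

theorem Rep.set_tmp {E : Env} {σ : St} {s : State} (h : Rep E σ s) {d x : ℕ} (hx : x ≤ E.N) :
    Rep E σ { s with reg := Function.update s.reg (tmp d) x } :=
  h.of_agree rfl (h.fits.update (by have := E.lt_W; omega)) fun r hr => by simp [hr d]

/-- Temporaries below `d` are preserved, so a left operand survives the evaluation of the right
operand into the next temporary. -/
theorem Exp.exec_compile {E : Env} {σ : St} (e : Exp) (he : e.Ok E σ) (d : ℕ) {s : State}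
    (h : Rep E σ s) : ∃ s', Exec E.W (e.compile d) s e.cost s' ∧ Rep E σ s' ∧
      s'.reg (tmp d) = e.val E σ ∧ ∀ d' < d, s'.reg (tmp d') = s.reg (tmp d') := by
  have hW := E.lt_W
  have hle := Exp.val_le h he
  have hkeep : ∀ (s : State) (x : ℕ), ∀ d' < d,
      (Function.update s.reg (tmp d) x) (tmp d') = s.reg (tmp d') := fun s x d' hd' => by
    simp [tmp_ne hd'.ne]
  induction e generalizing d s with
  | var x =>
    refine ⟨_, exec_reg h.fits (d := tmp d) (x := σ.v x) (by simp [Instr.eval, h.reg]) ?_,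
      h.set_tmp hle, by simp, hkeep s _⟩
    have := h.v_le x
    omega
  | lit c =>
    refine ⟨_, exec_reg h.fits (d := tmp d) (x := c) (by simp [Instr.eval]) ?_,
      h.set_tmp hle, by simp, hkeep s _⟩
    have : c ≤ E.N := he
    omega
  | add a b iha ihb =>
    obtain ⟨s₁, e₁, h₁, v₁, k₁⟩ := iha he.1 d h (Exp.val_le h he.1) hkeep
    obtain ⟨s₂, e₂, h₂, v₂, k₂⟩ := ihb he.2.1 (d + 1) h₁ (Exp.val_le h he.2.1)
      (fun s x d' hd' => by simp [tmp_ne hd'.ne])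
    have hlt : a.val E σ + b.val E σ ≤ E.N := he.2.2
    refine ⟨_, e₁.seq (e₂.seq (exec_reg h₂.fits (d := tmp d) (x := a.val E σ + b.val E σ) ?_ ?_)),
      h₂.set_tmp hlt, by simp; rfl, ?_⟩
    · simp [Instr.eval, v₂, k₂ d (by omega), v₁]
    · omega
    · intro d' hd'
      refine (hkeep s₂ _ d' hd').trans ?_
      rw [k₂ d' (by omega), k₁ d' hd']
  | sub a b iha ihb =>
    obtain ⟨s₁, e₁, h₁, v₁, k₁⟩ := iha he.1 d h (Exp.val_le h he.1) hkeep
    obtain ⟨s₂, e₂, h₂, v₂, k₂⟩ := ihb he.2 (d + 1) h₁ (Exp.val_le h he.2)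
      (fun s x d' hd' => by simp [tmp_ne hd'.ne])
    have hlt : a.val E σ - b.val E σ ≤ E.N := hle
    refine ⟨_, e₁.seq (e₂.seq (exec_reg h₂.fits (d := tmp d) (x := a.val E σ - b.val E σ) ?_ ?_)),
      h₂.set_tmp hlt, by simp; rfl, ?_⟩
    · simp [Instr.eval, v₂, k₂ d (by omega), v₁]
    · omega
    · intro d' hd'
      refine (hkeep s₂ _ d' hd').trans ?_
      rw [k₂ d' (by omega), k₁ d' hd']
  | inp a iha =>
    obtain ⟨s₁, e₁, h₁, v₁, k₁⟩ := iha he.1 d h (Exp.val_le h he.1) hkeep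
    have hlt : E.inp (a.val E σ) ≤ E.N := hle
    refine ⟨_, e₁.seq (exec_reg h₁.fits (d := tmp d) (x := E.inp (a.val E σ)) ?_ (by omega)),
      h₁.set_tmp hlt, by simp, ?_⟩
    · simp [Instr.eval, v₁, h₁.inp _ he.2]
    · intro d' hd'
      refine (hkeep s₁ _ d' hd').trans ?_
      rw [k₁ d' hd']
  | arr j a iha =>
    have hi := Exp.val_le h he.1
    obtain ⟨s₁, e₁, h₁, v₁, k₁⟩ := iha he.1 d h hi hkeep
    have hj : j < 32 := he.2
    obtain ⟨s₂, e₂, f₂, m₂, v₂, k₂⟩ := exec_addr h₁.fits (j := j) v₁ h₁.base (by omega)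
    have h₂ := h₁.of_agree m₂ f₂ fun r hr => k₂ r (hr _) (hr _)
    have hlt : σ.a j (a.val E σ) ≤ E.N := hle
    refine ⟨_, e₁.seq (e₂.seq (exec_reg f₂ (d := tmp d) (x := σ.a j (a.val E σ)) ?_ (by omega))),
      h₂.set_tmp hlt, by simp, ?_⟩
    · simp [Instr.eval, v₂, h₂.arr j hj]
    · intro d' hd'
      refine (hkeep s₂ _ d' hd').trans ?_
      rw [k₂ _ (tmp_ne hd'.ne) (tmp_ne (by omega)), k₁ d' hd']

theorem Cond.exec_compile {E : Env} {σ : St} (b : Cond) (hb : b.Ok E σ) {s : State}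
    (h : Rep E σ s) : ∃ s', Exec E.W b.compile s b.cost s' ∧ Rep E σ s' ∧
      (b.test.Holds s' ↔ b.Holds E σ) := by
  cases b with
  | lt a b =>
    obtain ⟨s₁, e₁, h₁, v₁, k₁⟩ := a.exec_compile hb.1 0 h
    obtain ⟨s₂, e₂, h₂, v₂, k₂⟩ := b.exec_compile hb.2 1 h₁
    exact ⟨s₂, e₁.seq e₂, h₂, by simp [Cond.test, Test.Holds, v₂, k₂ 0 (by omega), v₁]⟩
  | eq a b =>
    obtain ⟨s₁, e₁, h₁, v₁, k₁⟩ := a.exec_compile hb.1 0 h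
    obtain ⟨s₂, e₂, h₂, v₂, k₂⟩ := b.exec_compile hb.2 1 h₁
    exact ⟨s₂, e₁.seq e₂, h₂, by simp [Cond.test, Test.Holds, v₂, k₂ 0 (by omega), v₁]⟩

theorem Rep.tick {E : Env} {σ : St} {s : State} (h : Rep E σ s) (n : ℕ) : Rep E (σ.tick n) s :=
  ⟨h.reg, h.base, h.inp, h.arr, h.fits, h.v_le, h.a_le⟩

/-- The simulation theorem: a bound on the clock, proved with `wp`, becomes a bound on the number of
machine steps, and the bounds checked by `wp` keep all words below `W`. -/
theorem Cmd.exec_compile {E : Env} (c : Cmd) {Q : St → Prop} {σ : St} (hc : c.wp E Q σ)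
    {s : State} (h : Rep E σ s) : ∃ t s' σ', Exec E.W c.compile s t s' ∧ Rep E σ' s' ∧
      σ.t + t ≤ σ'.t ∧ Q σ' := by
  have hW := E.lt_W
  induction c generalizing Q σ s with
  | skip => exact ⟨1, s, _, Exec.skip h.fits, h.tick 1, le_rfl, hc⟩
  | set x e =>
    obtain ⟨s₁, e₁, h₁, v₁, -⟩ := e.exec_compile hc.1 0 h
    have hle := Exp.val_le h hc.1
    refine ⟨_, _, σ.set x (e.val E σ) (e.cost + 1), e₁.seq (exec_reg h₁.fits (d := 2 * x) (x :=
      e.val E σ)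
      (by simp [Instr.eval, v₁]) (by omega)), ⟨fun y => ?_, ?_, h₁.inp, h₁.arr,
      h₁.fits.update (by omega), fun y => ?_, h₁.a_le⟩, le_rfl, hc.2⟩
    · by_cases hy : y = x
      · subst hy; simp
      · have : 2 * y ≠ 2 * x := by omega
        simp [hy, h₁.reg]
    · have : 1 ≠ 2 * x := by omega
      simp [this, h₁.base]
    · rw [St.set_v]
      split_ifs
      · exact hle
      · exact h.v_le y
  | put j a b =>
    obtain ⟨ha, hb, hj, hB, hQ⟩ := hc
    have hia := Exp.val_le h ha
    have hib := Exp.val_le h hb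
    obtain ⟨s₁, e₁, h₁, v₁, -⟩ := b.exec_compile hb 0 h
    obtain ⟨s₂, e₂, h₂, v₂, k₂⟩ := a.exec_compile ha 1 h₁
    obtain ⟨s₃, e₃, f₃, m₃, v₃, k₃⟩ := exec_addr h₂.fits (j := j) v₂ h₂.base (by omega)
    have h₃ := h₂.of_agree m₃ f₃ fun r hr => k₃ r (hr _) (hr _)
    have v0 : s₃.reg (tmp 0) = b.val E σ := by
      rw [k₃ _ (tmp_ne (by omega)) (tmp_ne (by omega)), k₂ 0 (by omega), v₁]
    have hev : (Instr.store (tmp 1) (tmp 0)).eval s₃ = { s₃ with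
        mem := Function.update s₃.mem (E.base + 32 * a.val E σ + j) (b.val E σ) } := by
      simp [Instr.eval, v₃, v0]
    have hfits : ((Instr.store (tmp 1) (tmp 0)).eval s₃).Fits E.W := by
      rw [hev]
      refine ⟨f₃.1, fun i => ?_⟩
      by_cases hi : i = E.base + 32 * a.val E σ + j
      · subst hi; simp; omega
      · simpa [hi] using f₃.2 i
    refine ⟨_, _, σ.put j (a.val E σ) (b.val E σ) (a.cost + b.cost + 9),
      e₁.seq (e₂.seq (e₃.seq (Exec.instr f₃ hfits))), ?_, ?_, hQ⟩
    · refine ⟨by rw [hev]; exact h₃.reg, by rw [hev]; exact h₃.base, fun x hx => ?_,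
        fun j' hj' i => ?_, hfits, h.v_le, fun j' hj' i => ?_⟩
      · rw [hev]
        have : x ≠ E.base + 32 * a.val E σ + j := by omega
        simp [this, h₃.inp x hx]
      · rw [hev, St.put_a]
        by_cases hjj : j' = j
        · subst hjj
          by_cases hii : i = a.val E σ
          · subst hii; simp
          · have : E.base + 32 * i + j' ≠ E.base + 32 * a.val E σ + j' := by omega
            simp [hii, h₃.arr j' hj']
        · have : E.base + 32 * i + j' ≠ E.base + 32 * a.val E σ + j := by omega
          simp [this, hjj, h₃.arr j' hj']
      · rw [St.put_a]
        split_ifs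
        · exact hib
        · exact h.a_le j' hj' i
        · exact h.a_le j' hj' i
    · simp only [St.put_t]; omega
  | seq c d ihc ihd =>
    obtain ⟨t₁, s₁, σ₁, e₁, h₁, l₁, q₁⟩ := ihc hc h
    obtain ⟨t₂, s₂, σ₂, e₂, h₂, l₂, q₂⟩ := ihd q₁ h₁
    exact ⟨_, _, _, e₁.seq e₂, h₂, by omega, q₂⟩
  | ite b c d ihc ihd =>
    obtain ⟨hb, h1, h2⟩ := hc
    obtain ⟨s₁, e₁, h₁, v₁⟩ := b.exec_compile hb h
    by_cases hv : b.Holds E σ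
    · obtain ⟨t₂, s₂, σ₂, e₂, h₂, l₂, q₂⟩ := ihc (h1 hv) (h₁.tick _)
      rw [St.tick_t] at l₂
      exact ⟨_, _, _, e₁.seq (.iteTrue (v₁.2 hv) e₂), h₂, by omega, q₂⟩
    · obtain ⟨t₂, s₂, σ₂, e₂, h₂, l₂, q₂⟩ := ihd (h2 hv) (h₁.tick _)
      rw [St.tick_t] at l₂
      exact ⟨_, _, _, e₁.seq (.iteFalse (fun h' => hv (v₁.1 h')) e₂), h₂, by omega, q₂⟩
  | loop b c ihc =>
    obtain ⟨m, I, h0, h1, h2⟩ := hc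
    -- Induction on the number `r` of remaining rounds. The compiled loop is entered with its
    -- condition already evaluated, whereas the clock pays for it at the start of a round; hence the
    -- extra `b.cost`.
    have key : ∀ r i σ s, i + r = m → I i σ → Rep E σ s → (b.test.Holds s ↔ b.Holds E σ) →
        ∃ t s' σ', Exec E.W (.loop b.test (.seq c.compile b.compile)) s t s' ∧ Rep E σ' s' ∧
          σ.t + b.cost + t ≤ σ'.t ∧ Q σ' := by
      intro r
      induction r with
      | zero =>
        intro i σ s hi hI h ht
        obtain rfl : i = m := by omega
        obtain ⟨-, hv, hq⟩ := h2 σ hI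
        exact ⟨_, _, _, .loopFalse h.fits (fun h' => hv (ht.1 h')), h.tick (b.cost + 1), by
          rw [St.tick_t]; omega, hq⟩
      | succ r ihr =>
        intro i σ s hi hI h ht
        obtain ⟨-, hv, hw⟩ := h1 i (by omega) σ hI
        obtain ⟨t₁, s₁, σ₁, e₁, h₁, l₁, q₁⟩ := ihc hw (h.tick _)
        rw [St.tick_t] at l₁
        have hok : b.Ok E σ₁ := by
          by_cases him : i + 1 = m
          · exact (h2 σ₁ (him ▸ q₁)).1
          · exact (h1 (i + 1) (by omega) σ₁ q₁).1
        obtain ⟨s₂, e₂, h₂, v₂⟩ := b.exec_compile hok h₁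
        obtain ⟨t₃, s₃, σ₃, e₃, h₃, l₃, q₃⟩ := ihr (i + 1) σ₁ s₂ (by omega) q₁ h₂ v₂
        exact ⟨_, _, _, .loopTrue (ht.2 hv) (e₁.seq e₂) e₃, h₃, by omega, q₃⟩
    have hok : b.Ok E σ := by
      by_cases hm : 0 = m
      · exact (h2 σ (hm ▸ h0)).1
      · exact (h1 0 (by omega) σ h0).1
    obtain ⟨s₁, e₁, h₁, v₁⟩ := b.exec_compile hok h
    obtain ⟨t₂, s₂, σ₂, e₂, h₂, l₂, q₂⟩ := key m 0 σ s₁ (by omega) h0 h₁ v₁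
    exact ⟨_, _, _, e₁.seq e₂, h₂, by omega, q₂⟩

/-! ### Loops over numbers and over lists -/

namespace Cmd

/-- Run `c` with the values `0, 1, …` of the variable `x` below the variable `lim`. -/
def forVar (x lim : ℕ) (c : Cmd) : Cmd :=
  x ::= 0 ;; loop (.lt (.var x) (.var lim)) (c ;; x ::= .var x + 1)

/-- The constants are clock costs: `2` for the initial assignment, `3` for the test and `4` for the
increment. -/
theorem wp_forVar {E : Env} {x lim : ℕ} {c : Cmd} {Q : St → Prop} {σ : St} (m : ℕ)
    (J : ℕ → St → Prop) (hm : m + 1 ≤ E.N) (h0 : J 0 (σ.set x 0 2))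
    (hlim : ∀ i σ', J i σ' → σ'.v lim = m)
    (hstep : ∀ i < m, ∀ σ', J i σ' → σ'.v x = i →
      c.wp E (fun σ'' => σ''.v x = i ∧ J (i + 1) (σ''.set x (i + 1) 4)) (σ'.tick 3))
    (hQ : ∀ σ', J m σ' → Q (σ'.tick 3)) : (forVar x lim c).wp E Q σ := by
  simp only [forVar, wp_seq, wp_set, Exp.ok_ofNat, Exp.val_ofNat, Exp.cost_ofNat]
  refine ⟨by omega, wp_loop m (fun i σ' => J i σ' ∧ σ'.v x = i) ⟨h0, by simp⟩ ?_ ?_⟩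
  · rintro i hi σ' ⟨hJ, hx⟩
    refine ⟨by simp, by simp [hx, hlim i σ' hJ, hi], ?_⟩
    rw [wp_seq]
    refine wp_mono (hstep i hi σ' hJ hx) ?_
    rintro σ'' ⟨hx', hJ'⟩
    refine ⟨⟨trivial, ?_, ?_⟩, ?_, ?_⟩
    · change 1 ≤ E.N; omega
    · change σ''.v x + 1 ≤ E.N; omega
    · change J (i + 1) (σ''.set x (σ''.v x + 1) 4); rwa [hx']
    · simp [hx']
  · rintro σ' ⟨hJ, hx⟩
    exact ⟨by simp, by simp [hx, hlim m σ' hJ], hQ σ' hJ⟩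

/-- Run `c` with the values in the variable `u` that are listed in the input, after their number,
from the address `q` on. The variables `p` and `e` hold the current and the last address. -/
def forBlock (p e u : ℕ) (q : Exp) (c : Cmd) : Cmd :=
  p ::= q ;; e ::= .var p + .inp (.var p) ;;
    loop (.lt (.var p) (.var e)) (p ::= .var p + 1 ;; u ::= .inp (.var p) ;; c)

end Cmd

/-- The input holds, from the address `q` on, the length of `l` and then its entries. -/
def IsBlock (E : Env) {n : ℕ} (q : ℕ) (l : List (Fin n)) : Prop :=
  q + l.length < E.B ∧ E.inp q = l.length ∧ ∀ j (h : j < l.length), E.inp (q + 1 + j) = (l[j] : ℕ)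

namespace Cmd

/-- The body must preserve the two address variables; `J` describes the effect of the entries read
so far. The clock constants are `5` for the end address, `3` for the test, `4` for advancing and `3`
for reading. -/
theorem wp_forBlock {E : Env} {n p e u : ℕ} {q : Exp} {c : Cmd} {Q : St → Prop} {σ : St}
    {l : List (Fin n)} (J : ℕ → St → Prop) (q₀ : ℕ) (hq : q.Ok E σ) (hq₀ : q.val E σ = q₀)
    (hl : IsBlock E q₀ l)
    (hB : E.B ≤ E.N) (hpe : p ≠ e)
    (h0 : J 0 ((σ.set p q₀ (q.cost + 1)).set e (q₀ + l.length) 5))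
    (hstep : ∀ j (h : j < l.length) σ', J j σ' → σ'.v e = q₀ + l.length →
      c.wp E (fun σ'' => σ''.v p = q₀ + j + 1 ∧ σ''.v e = q₀ + l.length ∧ J (j + 1) σ'')
        (((σ'.tick 3).set p (q₀ + j + 1) 4).set u (l[j] : ℕ) 3))
    (hQ : ∀ σ', J l.length σ' → Q (σ'.tick 3)) : (forBlock p e u q c).wp E Q σ := by
  obtain ⟨hlen, hinp, hget⟩ := hl
  simp only [forBlock, wp_seq, wp_set, hq₀]
  refine ⟨hq, ?_, ?_⟩
  · simp only [Exp.ok_add, Exp.ok_inp, Exp.ok_var, Exp.val_inp, Exp.val_var, St.set_v, if_true,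
      hinp, true_and]
    omega
  refine wp_loop l.length
    (fun j σ' => J j σ' ∧ σ'.v p = q₀ + j ∧ σ'.v e = q₀ + l.length) ?_ ?_ ?_
  · simp [hpe, hinp]
    simpa [hinp] using h0
  · rintro j hj σ' ⟨hJ, hp, he⟩
    refine ⟨by simp, by simp [hp, he, hj], ?_⟩
    simp only [wp_seq, wp_set]
    have h1 : Exp.val E (σ'.tick ((Cond.lt (.var p) (.var e)).cost + 1)) (Exp.var p + 1)
        = q₀ + j + 1 := by simp [hp]
    rw [h1]
    refine ⟨?_, ?_, ?_⟩
    · simp [hp]; omega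
    · simp; omega
    · have h2 : Exp.val E ((σ'.tick ((Cond.lt (.var p) (.var e)).cost + 1)).set p (q₀ + j + 1)
          ((Exp.var p + 1).cost + 1)) (.inp (.var p)) = (l[j] : ℕ) := by
        simp [← hget j hj, add_right_comm]
      rw [h2]
      refine wp_mono (hstep j hj σ' hJ he) ?_
      rintro σ'' ⟨h3, h4, h5⟩
      exact ⟨h5, by omega, h4⟩
  · rintro σ' ⟨hJ, hp, he⟩
    exact ⟨by simp, by simp [hp, he], hQ σ' hJ⟩

end Cmd

/-! ### The graph in memory -/

/-- The fixed part of an instance with `n` vertices and threshold `k`: the adjacency list of `v`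
is found in the input at the address `off v`. -/
structure Layout (E : Env) (n : ℕ) (G : SimpleGraph (Fin n)) (adj : Fin n → List (Fin n))
    (off : Fin n → ℕ) (k : ℕ) : Prop where
  nodup : ∀ v, (adj v).Nodup
  mem_adj : ∀ v w, w ∈ adj v ↔ G.Adj v w
  block : ∀ v, IsBlock E (off v) (adj v)
  B_le : E.B ≤ E.base
  B_le_N : E.B ≤ E.N
  le_N : 2 * n + k + 10 ≤ E.N

/-- The number of vertices, the threshold and the addresses of the adjacency lists are stored
in the variables `1` and `2` and in the array `0`. -/
structure Stored (n k : ℕ) (off : Fin n → ℕ) (σ : St) : Prop where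
  n_eq : σ.v 1 = n
  k_eq : σ.v 2 = k
  off_eq : ∀ v : Fin n, σ.a 0 v = off v

theorem Stored.congr {n k : ℕ} {off : Fin n → ℕ} {σ σ' : St} (h : Stored n k off σ)
    (h1 : σ'.v 1 = σ.v 1) (h2 : σ'.v 2 = σ.v 2) (h3 : σ'.a 0 = σ.a 0) : Stored n k off σ' :=
  ⟨h1.trans h.n_eq, h2.trans h.k_eq, fun v => h3 ▸ h.off_eq v⟩

/-- The weight of a set of vertices bounds the time spent on it. -/
def weight {n : ℕ} (adj : Fin n → List (Fin n)) (S : Finset (Fin n)) : ℕ :=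
  ∑ v ∈ S, ((adj v).length + 1)

theorem weight_insert {n : ℕ} (adj : Fin n → List (Fin n)) {S : Finset (Fin n)} {v : Fin n}
    (h : v ∉ S) : weight adj (insert v S) = (adj v).length + 1 + weight adj S :=
  Finset.sum_insert h

theorem weight_mono {n : ℕ} (adj : Fin n → List (Fin n)) {S T : Finset (Fin n)} (h : S ⊆ T) :
    weight adj S ≤ weight adj T :=
  Finset.sum_le_sum_of_subset h

theorem length_adj_le {n : ℕ} {l : List (Fin n)} (h : l.Nodup) : l.length ≤ n := by
  simpa using h.length_le_card

/-! ### Extension to a maximal clique -/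

namespace Cmd

/-- Add the vertex in the variable `x` to the clique. -/
def addVertex (o x : ℕ) : Cmd :=
  put (o + 1) (.var x) 1 ;; 8 ::= .var 8 + 1 ;;
    forBlock 18 19 20 (.arr 0 (.var x)) (put (o + 2) (.var 20) (.arr (o + 2) (.var 20) + 1))

/-- Extend the clique listed at the address `q` to a maximal one. -/
def extend (o q : ℕ) : Cmd :=
  8 ::= 0 ;; forBlock 15 16 17 (.var q) (addVertex o 17) ;;
    forVar 9 1 (ite (.eq (.arr (o + 1) (.var 9)) 0)
      (ite (.eq (.arr (o + 2) (.var 9)) (.var 8)) (addVertex o 9) skip) skip)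

end Cmd

open CliqueReconf

open Classical in
/-- The array `o + 1` marks the vertices of the clique `C`, the array `o + 2` counts the neighbours
of each vertex in `C`, and the variable `8` holds the size of `C`. -/
structure HasClique {n : ℕ} (G : SimpleGraph (Fin n)) (o : ℕ) (C : Finset (Fin n)) (σ : St) :
    Prop where
  mark : ∀ u : Fin n, σ.a (o + 1) u = if u ∈ C then 1 else 0
  count : ∀ u : Fin n, σ.a (o + 2) u = (C.filter (G.Adj u)).card
  size : σ.v 8 = C.card

section

variable {E : Env} {n : ℕ} {G : SimpleGraph (Fin n)} {adj : Fin n → List (Fin n)}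
  {off : Fin n → ℕ} {k o : ℕ}

theorem card_fin_le (C : Finset (Fin n)) : C.card ≤ n := by
  simpa using Finset.card_le_univ C

theorem take_succ_of_lt {l : List (Fin n)} {j : ℕ} (h : j < l.length) :
    l.take (j + 1) = l.take j ++ [l[j]] := by simp

theorem Layout.adj_length (hE : Layout E n G adj off k) (v : Fin n) : (adj v).length ≤ n :=
  length_adj_le (hE.nodup v)

theorem wp_addVertex (hE : Layout E n G adj off k) {C : Finset (Fin n)} {v : Fin n} {x : ℕ}
    {σ : St} (ho : o < 20) (hv : v ∉ C) (hσ : Stored n k off σ) (hC : HasClique G o C σ)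
    (hx : σ.v x = v) (hx' : x ∉ [8, 18, 19, 20]) :
    (Cmd.addVertex o x).wp E (fun σ' => HasClique G o (insert v C) σ' ∧
      (∀ y ∉ [8, 18, 19, 20], σ'.v y = σ.v y) ∧
      (∀ j, j ≠ o + 1 → j ≠ o + 2 → σ'.a j = σ.a j) ∧
      σ'.t ≤ σ.t + 100 * ((adj v).length + 1)) σ := by
  classical
  have hN := hE.le_N
  have hcard : C.card ≤ n := card_fin_le C
  have hlen := hE.adj_length
  have hB := hE.B_le
  simp only [List.mem_cons, List.not_mem_nil, or_false, not_or] at hx'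
  simp only [Cmd.addVertex, Cmd.wp_seq, Cmd.wp_put, Cmd.wp_set]
  refine ⟨by simp, by simp; omega, by omega, hE.B_le, by simp [hC.size]; omega, ?_⟩
  -- Each entry read raises one counter. As `adj v` has no repetitions, the total for `u` is `1` or
  -- `0` according to adjacency.
  refine Cmd.wp_forBlock (l := adj v) (fun j σ' =>
    (∀ u : Fin n, σ'.a (o + 2) u = (C.filter (G.Adj u)).card + ((adj v).take j).count u) ∧
    (∀ u : Fin n, σ'.a (o + 1) u = if u ∈ insert v C then 1 else 0) ∧ σ'.v 8 = C.card + 1 ∧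
    (∀ y ∉ [8, 18, 19, 20], σ'.v y = σ.v y) ∧
    (∀ j, j ≠ o + 1 → j ≠ o + 2 → σ'.a j = σ.a j) ∧
    σ'.t ≤ σ.t + 50 + 50 * j) (off v) ?_ ?_ (hE.block v) hE.B_le_N (by simp)
    ?_ ?_ ?_
  · simp
  · simp [hx, hx', hσ.off_eq v]
  · refine ⟨fun u => by simp [hC.count u], fun u => ?_, by simp [hC.size], fun y hy => ?_,
      fun j h1 h2 => ?_, by simp⟩
    · by_cases huv : u = v
      · subst huv; simp [hx]
      · have : (u : ℕ) ≠ v := fun h => huv (Fin.ext h)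
        simp [hx, this, huv, hC.mark u]
    · simp only [List.mem_cons, List.not_mem_nil, or_false, not_or] at hy
      simp [hy]
    · ext i
      simp [h1]
  · rintro j hj σ' ⟨h1, h2, h3, h4, h5, h6⟩ he
    have hc := h1 ((adj v)[j])
    have hc1 : (C.filter (G.Adj (adj v)[j])).card ≤ n := card_fin_le _
    have hc2 : ((adj v).take j).count ((adj v)[j]) ≤ (adj v).length :=
      List.count_le_length.trans (List.length_take_le' _ _)
    have := hlen v
    simp only [Cmd.wp_put]
    refine ⟨by simp, ?_, by omega, hE.B_le, by simp, by simp [he], ?_, ?_, by simp [h3], ?_, ?_, ?_⟩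
    · simp only [Exp.ok_add, Exp.ok_arr, Exp.ok_var, Exp.ok_ofNat, Exp.val_arr, Exp.val_var,
        St.set_v, if_true, St.set_a, St.tick_a, hc, true_and, Exp.val_ofNat]
      omega
    · intro u
      rw [take_succ_of_lt hj, List.count_append, List.count_singleton]
      simp only [St.put_a, if_true, Exp.val_var, St.set_v, Exp.val_add, Exp.val_arr,
        St.set_a, St.tick_a, Exp.val_ofNat, beq_iff_eq]
      by_cases hu : u = (adj v)[j]
      · subst hu; simp [hc, add_assoc]
      · have hu1 : (u : ℕ) ≠ ((adj v)[j] : ℕ) := fun h => hu (Fin.ext h)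
        have hu2 : ¬ (adj v)[j] = u := fun h => hu h.symm
        simp [hu1, hu2, h1 u]
    · intro u; simp [h2 u]
    · intro y hy
      have := h4 y hy
      simp only [List.mem_cons, List.not_mem_nil, or_false, not_or] at hy
      simp [hy, this]
    · intro i hi1 hi2
      ext r
      simp [hi2, h5 i hi1 hi2]
    · simp; omega
  · rintro σ' ⟨h1, h2, h3, h4, h5, h6⟩
    refine ⟨⟨h2, fun u => ?_, ?_⟩, h4, h5, by simp; omega⟩
    · rw [St.tick_a, h1 u, List.take_length, Finset.filter_insert, (hE.nodup v).count]
      simp only [hE.mem_adj, G.adj_comm v u]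
      split_ifs with h
      · rw [Finset.card_insert_of_notMem (by simp [hv])]
      · rfl
    · rw [St.tick_v, h3, Finset.card_insert_of_notMem hv]

/-- One scan suffices: a vertex rejected once has a non-neighbour in the clique, which only grows.
Every vertex is added at most once, so the time is bounded by the total weight. -/
theorem wp_extend (hE : Layout E n G adj off k) {A : List (Fin n)} {q : ℕ}
    {σ : St} (ho : o < 20) (hσ : Stored n k off σ) (hA : A.Nodup)
    (hAc : G.IsClique (A.toFinset : Set (Fin n))) (hq : q < 8) (hblock : IsBlock E (σ.v q) A)
    (h0 : ∀ i, σ.a (o + 1) i = 0 ∧ σ.a (o + 2) i = 0) :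
    (Cmd.extend o q).wp E (fun σ' => ∃ C, A.toFinset ⊆ C ∧ IsMaximalClique G C ∧
      HasClique G o C σ' ∧ (∀ y < 8, σ'.v y = σ.v y) ∧
      (∀ j, j ≠ o + 1 → j ≠ o + 2 → σ'.a j = σ.a j) ∧
      σ'.t ≤ σ.t + 100 + 200 * (weight adj Finset.univ + n)) σ := by
  classical
  have hN := hE.le_N
  have hlenA := length_adj_le hA
  simp only [Cmd.extend, Cmd.wp_seq, Cmd.wp_set]
  refine ⟨by simp, ?_⟩
  refine Cmd.wp_forBlock (l := A) (fun j σ' =>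
    HasClique G o (A.take j).toFinset σ' ∧ (∀ y < 8, σ'.v y = σ.v y) ∧
    (∀ j, j ≠ o + 1 → j ≠ o + 2 → σ'.a j = σ.a j) ∧
    σ'.t ≤ σ.t + 10 + 110 * weight adj (A.take j).toFinset) (σ.v q) ?_ ?_ hblock hE.B_le_N
    (by simp) ?_ ?_ ?_
  · simp
  · have : q ≠ 8 := by omega
    simp [this]
  · refine ⟨⟨fun u => by simp [h0], fun u => by simp [h0], by simp⟩, fun y hy => ?_,
      fun j _ _ => rfl, by simp; omega⟩
    have h1 : y ≠ 8 := by omega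
    have h2 : y ≠ 15 := by omega
    have h3 : y ≠ 16 := by omega
    simp [h1, h2, h3]
  · rintro j hj σ' ⟨h1, h2, h3, h4⟩ he
    have hnot : A[j] ∉ (A.take j).toFinset := by
      rw [List.mem_toFinset, List.mem_take_iff_getElem]
      rintro ⟨i, hi, hij⟩
      rw [List.Nodup.getElem_inj_iff hA] at hij
      omega
    have hins : (A.take (j + 1)).toFinset = insert A[j] (A.take j).toFinset := by
      rw [take_succ_of_lt hj, List.toFinset_append, Finset.union_comm]; rfl
    refine Cmd.wp_mono (wp_addVertex hE ho hnot
      (hσ.congr (by simp [h2]) (by simp [h2]) (by simp [h3]))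
      ⟨by simpa using h1.mark, by simpa using h1.count, by simpa using h1.size⟩
      (by simp) (by simp)) ?_
    rintro σ'' ⟨g1, g2, g3, g4⟩
    refine ⟨by rw [g2 15 (by simp)]; simp, by rw [g2 16 (by simp)]; simp [he],
      by rw [hins]; exact g1, ?_, ?_, ?_⟩
    · intro y hy
      rw [g2 y (by simp; omega), ← h2 y hy]
      have h2 : y ≠ 15 := by omega
      have h3 : y ≠ 17 := by omega
      simp [h2, h3]
    · intro i hi1 hi2
      rw [g3 i hi1 hi2, ← h3 i hi1 hi2]; rfl
    · rw [hins, weight_insert adj hnot]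
      simp only [St.set_t, St.tick_t] at g4
      omega
  · rintro σ₁ ⟨h1, h2, h3, h4⟩
    rw [List.take_length] at h1 h4
    have hσ₁ : Stored n k off σ₁ := hσ.congr (h2 1 (by simp)) (h2 2 (by simp))
      (h3 0 (by omega) (by omega))
    refine Cmd.wp_forVar n (fun i σ' => ∃ C, A.toFinset ⊆ C ∧ G.IsClique (C : Set (Fin n)) ∧
      (∀ u : Fin n, (u : ℕ) < i → u ∉ C → ∃ c ∈ C, ¬ G.Adj u c) ∧ HasClique G o C σ' ∧
      (∀ y < 8, σ'.v y = σ.v y) ∧ (∀ j, j ≠ o + 1 → j ≠ o + 2 → σ'.a j = σ.a j) ∧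
      σ'.t ≤ σ.t + 20 + 110 * weight adj C + 100 * i) (by omega) ?_ ?_ ?_ ?_
    · refine ⟨A.toFinset, subset_rfl, hAc, by simp, ⟨h1.mark, h1.count, by simp [h1.size]⟩,
        fun y hy => ?_, h3, by simp; omega⟩
      have : y ≠ 9 := by omega
      simp [h2 y hy, this]
    · rintro i σ' ⟨C, -, -, -, -, h, -⟩
      rw [h 1 (by simp), hσ.n_eq]
    · rintro i hi σ' ⟨C, hAC, hC, hmax, g1, g2, g3, g4⟩ hx
      have hmark := g1.mark ⟨i, hi⟩
      have hcount := g1.count ⟨i, hi⟩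
      simp only at hmark hcount
      have hadj : ∀ c ∈ C, (⟨i, hi⟩ : Fin n) ∉ C → C.filter (G.Adj ⟨i, hi⟩) = C →
          G.Adj ⟨i, hi⟩ c := fun c hc _ h => (Finset.mem_filter.1 (h.symm ▸ hc)).2
      simp only [Cmd.wp_ite, Cmd.wp_skip]
      refine ⟨by simp; omega, fun hb => ⟨by simp; omega, fun hb' => ?_, fun hb' => ?_⟩,
        fun hb => ?_⟩
      · have hnot : (⟨i, hi⟩ : Fin n) ∉ C := by
          intro h
          simp [hx, hmark, h] at hb
        have hfull : C.filter (G.Adj ⟨i, hi⟩) = C := by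
          refine Finset.eq_of_subset_of_card_le (Finset.filter_subset _ _) ?_
          simp [hx, hcount, g1.size] at hb'
          convert hb'.ge
        refine Cmd.wp_mono (wp_addVertex hE ho hnot
          (hσ.congr (by simp [g2]) (by simp [g2]) (by rw [← g3 0 (by omega) (by omega)]; rfl))
          ⟨by simpa using g1.mark, by simpa using g1.count, by simpa using g1.size⟩
          (by simp [hx]) (by simp)) ?_
        rintro σ'' ⟨f1, f2, f3, f4⟩
        refine ⟨by rw [f2 9 (by simp)]; simp [hx], insert (⟨i, hi⟩ : Fin n) C,
          hAC.trans (Finset.subset_insert _ _),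
          isClique_insert hC fun c hc _ => hadj c hc hnot hfull, ?_,
          ⟨f1.mark, f1.count, by simpa using f1.size⟩, ?_, ?_, ?_⟩
        · intro u hu huC
          have hui : u ≠ ⟨i, hi⟩ := fun h => huC (by simp [h])
          have huC' : u ∉ C := fun h => huC (by simp [h])
          have : (u : ℕ) ≠ i := fun h => hui (Fin.ext h)
          obtain ⟨c, hc, hcu⟩ := hmax u (by omega) huC'
          exact ⟨c, by simp [hc], hcu⟩
        · intro y hy
          have : y ≠ 9 := by omega
          rw [St.set_v, if_neg this, f2 y (by simp; omega), ← g2 y hy]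
          rfl
        · intro i hi1 hi2
          rw [St.set_a, f3 i hi1 hi2, ← g3 i hi1 hi2]; rfl
        · rw [weight_insert adj hnot]
          simp at f4 ⊢
          omega
      · refine ⟨by simp [hx], C, hAC, hC, ?_, ⟨g1.mark, g1.count, by simp [g1.size]⟩, ?_, g3, ?_⟩
        · intro u hu huC
          by_cases hui : (u : ℕ) = i
          · by_contra hcon
            push Not at hcon
            have hui' : u = ⟨i, hi⟩ := Fin.ext hui
            subst hui'
            refine hb' ?_
            simp [hx, hcount, g1.size]
            congr
            exact Finset.filter_true_of_mem hcon
          · exact hmax u (by omega) huC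
        · intro y hy
          have : y ≠ 9 := by omega
          simp [this, g2 y hy]
        · simp; omega
      · have hin : (⟨i, hi⟩ : Fin n) ∈ C := by
          by_contra h
          simp [hx, hmark, h] at hb
        refine ⟨by simp [hx], C, hAC, hC, ?_, ⟨g1.mark, g1.count, by simp [g1.size]⟩, ?_, g3, ?_⟩
        · intro u hu huC
          by_cases hui : (u : ℕ) = i
          · have hui' : u = ⟨i, hi⟩ := Fin.ext hui
            exact absurd (hui' ▸ hin) huC
          · exact hmax u (by omega) huC
        · intro y hy
          have : y ≠ 9 := by omega
          simp [this, g2 y hy]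
        · simp; omega
    · rintro σ' ⟨C, hAC, hC, hmax, g1, g2, g3, g4⟩
      refine ⟨C, hAC, ⟨hC, fun v hv => hmax v v.2 hv⟩, ⟨g1.mark, g1.count, g1.size⟩, g2, g3, ?_⟩
      have := weight_mono adj (Finset.subset_univ C)
      simp
      omega

end

/-! ### Sorting by counting -/

namespace Cmd

/-- Sort the vertices by their entries in the array `key`, into the array `ord`. -/
def sort (key pos ord : ℕ) : Cmd :=
  forVar 9 1 (put pos (.arr key (.var 9)) (.arr pos (.arr key (.var 9)) + 1)) ;;
  21 ::= .var 1 + 1 ;; 22 ::= 0 ;;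
  forVar 9 21 (23 ::= .arr pos (.var 9) ;; put pos (.var 9) (.var 22) ;;
    22 ::= .var 22 + .var 23) ;;
  forVar 9 1 (put ord (.arr pos (.arr key (.var 9))) (.var 9) ;;
    put pos (.arr key (.var 9)) (.arr pos (.arr key (.var 9)) + 1))

/-- Compute the number of vertices of the clique that are not adjacent to a vertex. -/
def levels (o : ℕ) : Cmd :=
  forVar 9 1 (ite (.eq (.arr (o + 1) (.var 9)) 0)
    (put (o + 3) (.var 9) (.var 8 - .arr (o + 2) (.var 9))) skip)

/-- Give the vertex in the variable `10` the least positive colour not used by a neighbour. -/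
def greedy (col mark : ℕ) : Cmd :=
  forBlock 18 19 20 (.arr 0 (.var 10)) (put mark (.arr col (.var 20)) (.var 10 + 1)) ;;
  14 ::= 1 ;; loop (.eq (.arr mark (.var 14)) (.var 10 + 1)) (14 ::= .var 14 + 1) ;;
  put col (.var 10) (.var 14)

/-- Count in the variable `13` the colours that occur among the neighbours of lower level of the
vertex in the variable `10`. -/
def countColors (o : ℕ) : Cmd :=
  13 ::= 0 ;; forBlock 18 19 20 (.arr 0 (.var 10))
    (ite (.lt (.arr (o + 3) (.var 20)) (.arr (o + 3) (.var 10)))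
      (ite (.eq (.arr (o + 8) (.arr (o + 6) (.var 20))) (.var 10 + 1)) skip
        (put (o + 8) (.arr (o + 6) (.var 20)) (.var 10 + 1) ;; 13 ::= .var 13 + 1)) skip)

end Cmd

/-- `r` enumerates the vertices in an order in which `f` does not decrease. -/
structure IsRank {n : ℕ} (f r : Fin n → ℕ) : Prop where
  inj : Function.Injective r
  lt : ∀ u, r u < n
  surj : ∀ i < n, ∃ u, r u = i
  mono : ∀ u w, f u < f w → r u < r w

/-- The number of vertices with value below `c`, or with value `c` and below `i`. -/
def countBelow {n : ℕ} (f : Fin n → ℕ) (c i : ℕ) : ℕ :=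
  (Finset.univ.filter fun w => f w < c ∨ (f w = c ∧ (w : ℕ) < i)).card

/-- This is the position in the lexicographic order of pairs of value and index. Being injective
into `n` places, it is surjective. -/
theorem isRank_countBelow {n : ℕ} (f : Fin n → ℕ) :
    IsRank f (fun u => countBelow f (f u) u) := by
  have hlt : ∀ u w : Fin n, (f u < f w ∨ (f u = f w ∧ (u : ℕ) < w)) →
      countBelow f (f u) u < countBelow f (f w) w := by
    intro u w h
    refine Finset.card_lt_card (Finset.ssubset_iff_of_subset ?_ |>.2 ⟨u, ?_, ?_⟩)
    · intro y
      simp only [Finset.mem_filter, Finset.mem_univ, true_and]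
      omega
    · simpa using h
    · simp
  have hinj : Function.Injective (fun u => countBelow f (f u) u) := by
    intro u w h
    by_contra hne
    have hne' : (u : ℕ) ≠ w := fun h => hne (Fin.ext h)
    have h1 := hlt u w
    have h2 := hlt w u
    simp only at h
    omega
  have hn : ∀ u : Fin n, countBelow f (f u) u < n := by
    intro u
    have : countBelow f (f u) u < (Finset.univ : Finset (Fin n)).card :=
      Finset.card_lt_card (Finset.ssubset_iff_of_subset (Finset.subset_univ _) |>.2
        ⟨u, Finset.mem_univ u, by simp⟩)
    simpa using this
  refine ⟨hinj, hn, fun i hi => ?_, fun u w h => hlt u w (Or.inl h)⟩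
  have hinj' : Function.Injective (fun u : Fin n => (⟨countBelow f (f u) u, hn u⟩ : Fin n)) :=
    fun u w h => hinj (by simpa using h)
  obtain ⟨u, hu⟩ := (Finite.injective_iff_surjective.1 hinj') ⟨i, hi⟩
  exact ⟨u, by simpa using hu⟩

theorem countBelow_le {n : ℕ} (f : Fin n → ℕ) (c i : ℕ) : countBelow f c i ≤ n :=
  card_fin_le _

theorem countBelow_succ {n : ℕ} (f : Fin n → ℕ) (c : ℕ) {i : ℕ} (hi : i < n) :
    countBelow f c (i + 1) = countBelow f c i + if f ⟨i, hi⟩ = c then 1 else 0 := by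
  unfold countBelow
  split_ifs with h
  · rw [← Finset.card_insert_of_notMem (a := (⟨i, hi⟩ : Fin n)) (by simp [h])]
    congr 1
    ext w
    have : w = ⟨i, hi⟩ ↔ (w : ℕ) = i := by rw [Fin.ext_iff]
    simp only [Finset.mem_insert, Finset.mem_filter, Finset.mem_univ, true_and, this]
    by_cases hw : (w : ℕ) = i
    · have hw' : w = ⟨i, hi⟩ := Fin.ext hw
      subst hw'
      simp [h]
    · omega
  · rw [add_zero]
    refine congrArg Finset.card ?_
    ext w
    simp only [Finset.mem_filter, Finset.mem_univ, true_and]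
    by_cases hw : (w : ℕ) = i
    · have hw' : w = ⟨i, hi⟩ := Fin.ext hw
      subst hw'
      simp [h]
    · omega

/-- The bucket of the value `c + 1` begins where that of `c` ends. -/
theorem countBelow_zero_succ {n : ℕ} (f : Fin n → ℕ) (c : ℕ) :
    countBelow f (c + 1) 0 = countBelow f c n := by
  unfold countBelow
  congr 1
  ext w
  have := w.2
  simp only [Finset.mem_filter, Finset.mem_univ, true_and]
  omega

theorem countBelow_eq_add {n : ℕ} (f : Fin n → ℕ) (c i : ℕ) :
    countBelow f c i = countBelow f c 0 +
      (Finset.univ.filter fun w => f w = c ∧ (w : ℕ) < i).card := by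
  unfold countBelow
  rw [← Finset.card_union_of_disjoint (Finset.disjoint_filter.2 fun w _ h h' => by omega)]
  refine congrArg Finset.card ?_
  ext w
  simp

/-! ### Correctness and running time of the subroutines -/

section

variable {E : Env} {n : ℕ} {G : SimpleGraph (Fin n)} {adj : Fin n → List (Fin n)}
  {off : Fin n → ℕ} {k o : ℕ}

theorem wp_sort {f : Fin n → ℕ} {key pos ord : ℕ} {σ : St} (hB : E.B ≤ E.base)
    (hN : 2 * n + 10 ≤ E.N) (hn : σ.v 1 = n)
    (hf : ∀ u : Fin n, σ.a key u = f u) (hfn : ∀ u, f u ≤ n) (hpos : ∀ i, σ.a pos i = 0)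
    (h1 : key < 32) (h2 : pos < 32) (h3 : ord < 32) (h4 : key ≠ pos) (h5 : key ≠ ord)
    (h6 : pos ≠ ord) :
    (Cmd.sort key pos ord).wp E (fun σ' => (∃ r : Fin n → ℕ, IsRank f r ∧
        ∀ u : Fin n, σ'.a ord (r u) = u) ∧ (∀ y ∉ [9, 21, 22, 23], σ'.v y = σ.v y) ∧
      (∀ j, j ≠ pos → j ≠ ord → σ'.a j = σ.a j) ∧ σ'.t ≤ σ.t + 300 * (n + 1)) σ := by
  classical
  simp only [Cmd.sort, Cmd.wp_seq]
  -- Bucket sizes: the number of vertices with index less than `i` and value `c`.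
  refine Cmd.wp_forVar n (fun i σ' => (∀ c, σ'.a pos c = countBelow f c i - countBelow f c 0) ∧
    (∀ y ∉ [9, 21, 22, 23], σ'.v y = σ.v y) ∧ (∀ j, j ≠ pos → j ≠ ord → σ'.a j = σ.a j) ∧
    σ'.t ≤ σ.t + 10 + 100 * i) (by omega) ?_ ?_ ?_ ?_
  · refine ⟨fun c => by simp [hpos], fun y hy => ?_, fun j _ _ => rfl, by simp⟩
    have : y ≠ 9 := by simp at hy; omega
    simp [this]
  · rintro i σ' ⟨-, g2, -⟩
    rw [g2 1 (by simp), hn]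
  · rintro i hi σ' ⟨g1, g2, g3, g4⟩ hx
    have hkey : σ'.a key i = f ⟨i, hi⟩ := by rw [g3 key h4 h5]; exact hf ⟨i, hi⟩
    have hle := countBelow_le f (f ⟨i, hi⟩) i
    simp only [Cmd.wp_put]
    refine ⟨by simpa, ?_, h2, hB, by simp [hx], fun c => ?_, fun y hy => ?_, fun j hj hj' => ?_, ?_⟩
    · simp [hx, hkey, g1, h1, h2]; omega
    · rw [countBelow_succ f c hi]
      have hadd := countBelow_eq_add f c i
      have hfi : (f ⟨i, hi⟩ = c) ↔ c = f ⟨i, hi⟩ := eq_comm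
      simp [hx, hkey, g1, hfi]
      split_ifs with h
      · subst h; omega
      · omega
    · have : y ≠ 9 := by simp at hy; omega
      simp [this, g2 y hy]
    · ext r
      simp [hj, g3 j hj hj']
    · simp; omega
  rintro σ₁ ⟨g1, g2, g3, g4⟩
  simp only [Cmd.wp_set, Cmd.wp_seq]
  have hn₁ : σ₁.v 1 = n := by rw [g2 1 (by simp), hn]
  refine ⟨by simp [hn₁]; omega, by simp, ?_⟩
  -- Prefix sums turn sizes into starting places. The values range over `0, …, n`, which makes `n +
  -- 1` buckets.
  refine Cmd.wp_forVar (n + 1) (fun i σ' => (∀ c, σ'.a pos c = if c < i then countBelow f c 0 else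
      countBelow f c n - countBelow f c 0) ∧ σ'.v 22 = countBelow f i 0 ∧ σ'.v 21 = n + 1 ∧
    (∀ y ∉ [9, 21, 22, 23], σ'.v y = σ.v y) ∧ (∀ j, j ≠ pos → j ≠ ord → σ'.a j = σ.a j) ∧
    σ'.t ≤ σ.t + 30 + 100 * n + 50 * i) (by omega) ?_ ?_ ?_ ?_
  · refine ⟨fun c => by simp [g1], by simp [countBelow], by simp [hn₁], fun y hy => ?_, g3,
      by simp; omega⟩
    have := g2 y hy
    simp only [List.mem_cons, List.not_mem_nil, or_false, not_or] at hy
    simp [hy, this]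
  · rintro i σ' ⟨-, -, g, -⟩
    exact g
  · rintro i hi σ' ⟨f1, f2, f3, f4, f5, f6⟩ hx
    have hadd := countBelow_eq_add f i n
    have hle := countBelow_le f i n
    simp only [Cmd.wp_seq, Cmd.wp_set, Cmd.wp_put]
    refine ⟨by simp [h2], by simp, by simp, h2, hB, ?_, ?_⟩
    · simp [hx, f1, f2]; omega
    · refine ⟨by simp [hx], fun c => ?_, ?_, by simp [f3], fun y hy => ?_, fun j hj hj' => ?_, ?_⟩
      · by_cases hc : c = i
        · subst hc; simp [hx, f2]
        · have : c < i + 1 ↔ c < i := by omega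
          simp [hx, hc, f1, this]
      · simp [hx, f1, f2]
        rw [countBelow_zero_succ]
        omega
      · have := f4 y hy
        simp only [List.mem_cons, List.not_mem_nil, or_false, not_or] at hy
        simp [hy, this]
      · ext r
        simp [hj, f5 j hj hj']
      · simp; omega
  rintro σ₂ ⟨f1, f2, f3, f4, f5, f6⟩
  have hn₂ : σ₂.v 1 = n := by rw [f4 1 (by simp), hn]
  -- Now `pos c` is the next free place in the bucket of `c`, which is the rank of the next vertex
  -- with this value.
  refine Cmd.wp_forVar n (fun i σ' => (∀ c ≤ n, σ'.a pos c = countBelow f c i) ∧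
    (∀ u : Fin n, (u : ℕ) < i → σ'.a ord (countBelow f (f u) u) = u) ∧
    (∀ y ∉ [9, 21, 22, 23], σ'.v y = σ.v y) ∧ (∀ j, j ≠ pos → j ≠ ord → σ'.a j = σ.a j) ∧
    σ'.t ≤ σ.t + 100 + 150 * n + 100 * i) (by omega) ?_ ?_ ?_ ?_
  · refine ⟨fun c hc => ?_, by simp, fun y hy => ?_, f5, by simp; omega⟩
    · have : c < n + 1 := by omega
      simp [f1, this]
    · have := f4 y hy
      simp only [List.mem_cons, List.not_mem_nil, or_false, not_or] at hy
      simp [hy, this]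
  · rintro i σ' ⟨-, -, g, -⟩
    rw [g 1 (by simp), hn]
  · rintro i hi σ' ⟨e1, e2, e3, e4, e5⟩ hx
    have hkey : σ'.a key i = f ⟨i, hi⟩ := by rw [e4 key h4 h5]; exact hf ⟨i, hi⟩
    have hle := countBelow_le f (f ⟨i, hi⟩) i
    have hpi := e1 (f ⟨i, hi⟩) (hfn _)
    simp only [Cmd.wp_seq, Cmd.wp_put]
    refine ⟨by simp [h1, h2], by simp, h3, hB, by simp [h1], ?_, h2, hB, ?_⟩
    · simp [hx, hkey, h1, h2, h5, h6, hpi]; omega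
    · refine ⟨by simp [hx], fun c hc => ?_, fun u hu => ?_, fun y hy => ?_,
        fun j hj hj' => ?_, ?_⟩
      · rw [countBelow_succ f c hi]
        have hfi : (f ⟨i, hi⟩ = c) ↔ c = f ⟨i, hi⟩ := eq_comm
        simp [hx, hkey, h5, h6, hfi]
        split_ifs with h
        · subst h; rw [hpi]
        · simp [e1 c hc]
      · have hui : countBelow f (f u) u = countBelow f (f ⟨i, hi⟩) i ↔ (u : ℕ) = i := by
          have := (isRank_countBelow f).inj.eq_iff (a := u) (b := ⟨i, hi⟩)
          simp only at this
          rw [this, Fin.ext_iff]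
        simp [hx, hkey, h5, h6.symm, hpi, hui]
        split_ifs with h
        · exact h.symm
        · exact e2 u (by omega)
      · have := e3 y hy
        simp only [List.mem_cons, List.not_mem_nil, or_false, not_or] at hy
        simp [hy, this]
      · ext r
        simp [hj, hj', e4 j hj hj']
      · simp; omega
  · rintro σ' ⟨e1, e2, e3, e4, e5⟩
    exact ⟨⟨_, isRank_countBelow f, fun u => e2 u u.2⟩, e3, e4, by simp; omega⟩

theorem wp_levels (hE : Layout E n G adj off k) {C : Finset (Fin n)} {σ : St} (ho : o < 20)
    (hn : σ.v 1 = n) (hC : HasClique G o C σ) (h0 : ∀ i, σ.a (o + 3) i = 0) :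
    (Cmd.levels o).wp E (fun σ' => (∀ u : Fin n, σ'.a (o + 3) u = (missing G C u).card) ∧
      (∀ y, y ≠ 9 → σ'.v y = σ.v y) ∧ (∀ j, j ≠ o + 3 → σ'.a j = σ.a j) ∧
      σ'.t ≤ σ.t + 100 * (n + 1)) σ := by
  classical
  have hN := hE.le_N
  refine Cmd.wp_forVar n (fun i σ' => (∀ u : Fin n, σ'.a (o + 3) u = if (u : ℕ) < i then
      (missing G C u).card else 0) ∧ (∀ y, y ≠ 9 → σ'.v y = σ.v y) ∧
      (∀ j, j ≠ o + 3 → σ'.a j = σ.a j) ∧ σ'.t ≤ σ.t + 10 + 70 * i) (by omega) ?_ ?_ ?_ ?_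
  · exact ⟨fun u => by simp [h0], fun y hy => by simp [hy], fun j _ => rfl, by simp⟩
  · rintro i σ' ⟨-, g, -⟩
    rw [g 1 (by simp), hn]
  · rintro i hi σ' ⟨g1, g2, g3, g4⟩ hx
    have hm : σ'.a (o + 1) i = if (⟨i, hi⟩ : Fin n) ∈ C then 1 else 0 := by
      rw [g3 _ (by omega)]; exact hC.mark ⟨i, hi⟩
    have hcn : σ'.a (o + 2) i = (C.filter (G.Adj ⟨i, hi⟩)).card := by
      rw [g3 _ (by omega)]
      convert hC.count ⟨i, hi⟩
    have hv8 : σ'.v 8 = C.card := by rw [g2 8 (by simp), hC.size]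
    have hlt : ∀ u : Fin n, (u : ℕ) < i + 1 ↔ (u : ℕ) < i ∨ u = ⟨i, hi⟩ := fun u => by
      rw [Fin.ext_iff]; simp only; omega
    simp only [Cmd.wp_ite, Cmd.wp_put, Cmd.wp_skip]
    refine ⟨by simp; omega, fun hb => ⟨by simp, by simp; omega, by omega, hE.B_le, ?_⟩,
      fun hb => ?_⟩
    · have hnot : (⟨i, hi⟩ : Fin n) ∉ C := by
        intro h
        simp [hx, hm, h] at hb
      refine ⟨by simp [hx], fun u => ?_, fun y hy => by simp [hy, g2], fun j hj => ?_,
        by simp; omega⟩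
      · by_cases hu : u = ⟨i, hi⟩
        · subst hu
          simp [hx, missing, hnot, hv8, hcn]
          have := Finset.card_filter_add_card_filter_not (s := C) (G.Adj ⟨i, hi⟩)
          convert (show C.card - (C.filter (G.Adj ⟨i, hi⟩)).card =
            (C.filter (fun c => ¬ G.Adj ⟨i, hi⟩ c)).card by omega)
        · have : (u : ℕ) ≠ i := fun h => hu (Fin.ext h)
          simp [hx, this, g1, hlt, hu]
      · ext r
        simp [hj, g3 j hj]
    · have hin : (⟨i, hi⟩ : Fin n) ∈ C := by
        by_contra h
        simp [hx, hm, h] at hb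
      refine ⟨by simp [hx], fun u => ?_, fun y hy => by simp [hy, g2], g3, by simp; omega⟩
      by_cases hu : u = ⟨i, hi⟩
      · subst hu
        have := g1 ⟨i, hi⟩
        simp only [lt_irrefl, if_false] at this
        simp [this, missing_of_mem hin]
      · simp [g1, hlt, hu]
  · rintro σ' ⟨g1, g2, g3, g4⟩
    exact ⟨fun u => by simp [g1], g2, g3, by simp; omega⟩

/-- A list cannot contain more positive numbers than its length. This bounds the search for a free
colour by the degree. -/
theorem exists_least_free (L : List ℕ) : ∃ m ≤ L.length, m + 1 ∉ L ∧ ∀ i < m, i + 1 ∈ L := by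
  classical
  have hex : ∃ m, m + 1 ∉ L := by
    obtain ⟨m, hm⟩ := Infinite.exists_notMem_finset (insert 0 L.toFinset)
    refine ⟨m - 1, fun h => hm ?_⟩
    rcases Nat.eq_zero_or_pos m with rfl | hpos
    · simp
    · rw [Nat.sub_add_cancel hpos] at h
      simp [h]
  refine ⟨Nat.find hex, ?_, Nat.find_spec hex, fun i hi => not_not.1 (Nat.find_min hex hi)⟩
  have hsub : (Finset.range (Nat.find hex)).image (· + 1) ⊆ L.toFinset := by
    intro x hx
    obtain ⟨i, hi, rfl⟩ := Finset.mem_image.1 hx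
    exact List.mem_toFinset.2 (not_not.1 (Nat.find_min hex (Finset.mem_range.1 hi)))
  have := (Finset.card_le_card hsub).trans (List.toFinset_card_le L)
  rwa [Finset.card_image_of_injective _ (add_left_injective 1), Finset.card_range] at this

/-- Used colours are stamped with `v + 1`, so the mark array never has to be cleared. Uncoloured
neighbours have colour `0` and stamp a cell that the search, starting at `1`, does not visit. -/
theorem wp_greedy (hE : Layout E n G adj off k) {col mark : ℕ} {v : Fin n} {σ : St}
    (hcol : col < 32) (hmark : mark < 32) (hcm : col ≠ mark) (hσ : Stored n k off σ)
    (hv : σ.v 10 = v) (hfresh : ∀ i, σ.a mark i ≠ v + 1) :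
    (Cmd.greedy col mark).wp E (fun σ' => ∃ c, 0 < c ∧ σ'.v 14 = c ∧
      (∀ u, G.Adj v u → σ.a col u ≠ c) ∧
      (∀ c', 0 < c' → c' < c → ∃ u, G.Adj v u ∧ σ.a col u = c') ∧
      (∀ u, σ'.a col u = if u = v then c else σ.a col u) ∧
      (∀ i, σ'.a mark i = v + 1 ∨ σ'.a mark i = σ.a mark i) ∧
      (∀ y ∉ [14, 18, 19, 20], σ'.v y = σ.v y) ∧ (∀ j, j ≠ col → j ≠ mark → σ'.a j = σ.a j) ∧
      σ'.t ≤ σ.t + 150 * ((adj v).length + 1)) σ := by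
  have hN := hE.le_N
  have hlen := hE.adj_length v
  have hvn := v.2
  simp only [Cmd.greedy, Cmd.wp_seq]
  refine Cmd.wp_forBlock (l := adj v) (fun j σ' =>
    (∀ i, σ'.a mark i = if i ∈ ((adj v).take j).map (fun u : Fin n => σ.a col u) then (v : ℕ) + 1
      else σ.a mark i) ∧
    (∀ y ∉ [14, 18, 19, 20], σ'.v y = σ.v y) ∧ (∀ j, j ≠ mark → σ'.a j = σ.a j) ∧
    σ'.t ≤ σ.t + 50 + 50 * j) (off v) ?_ ?_ (hE.block v) hE.B_le_N (by simp) ?_ ?_ ?_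
  · simp
  · simp [hv, hσ.off_eq v]
  · refine ⟨fun i => by simp, fun y hy => ?_, fun j _ => rfl, by simp⟩
    simp only [List.mem_cons, List.not_mem_nil, or_false, not_or] at hy
    simp [hy]
  · rintro j hj σ' ⟨h1, h2, h3, h4⟩ he
    have hcu : σ'.a col = σ.a col := h3 col hcm
    have hv' : σ'.v 10 = v := by rw [h2 10 (by simp), hv]
    simp only [Cmd.wp_put]
    refine ⟨by simpa, by simp [hv']; omega, hmark, hE.B_le, by simp, by simp [he], fun i => ?_,
      fun y hy => ?_, fun i hi => ?_, by simp; omega⟩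
    · rw [take_succ_of_lt hj]
      simp only [St.put_a, if_true, Exp.val_arr, Exp.val_var, St.set_v, St.set_a, St.tick_a, hcu,
        List.map_append, List.mem_append, List.map_cons, List.map_nil, List.mem_singleton]
      by_cases hi : i = σ.a col ((adj v)[j] : ℕ)
      · simp [hi, hv']
      · simp [hi, h1 i]
    · have := h2 y hy
      simp only [List.mem_cons, List.not_mem_nil, or_false, not_or] at hy
      simp [hy, this]
    · ext r
      simp [hi, h3 i hi]
  rintro σ₁ ⟨h1, h2, h3, h4⟩
  rw [List.take_length] at h1
  obtain ⟨m, hm, hfree, hused⟩ := exists_least_free ((adj v).map (fun u : Fin n => σ.a col u))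
  rw [List.length_map] at hm
  have hmk : ∀ i, σ₁.a mark i = v + 1 ↔ i ∈ (adj v).map (fun u : Fin n => σ.a col u) := by
    intro i
    rw [h1 i]
    split_ifs with h
    · simp [h]
    · simp [h, hfresh i]
  have hmem : ∀ c, c ∈ (adj v).map (fun u : Fin n => σ.a col u) ↔ ∃ u, G.Adj v u ∧ σ.a col u =
    c := by
    intro c
    simp [List.mem_map, hE.mem_adj]
  have hv₁ : σ₁.v 10 = v := by rw [h2 10 (by simp), hv]
  simp only [Cmd.wp_set, Cmd.wp_seq]
  refine ⟨by simp; omega, ?_⟩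
  refine Cmd.wp_loop m (fun i σ' => σ'.v 14 = i + 1 ∧ (∀ y, y ≠ 14 → σ'.v y = σ₁.v y) ∧
    σ'.a = σ₁.a ∧ σ'.t ≤ σ₁.t + 10 + 50 * i) ?_ ?_ ?_
  · exact ⟨by simp, fun y hy => by simp [hy], by simp, by simp⟩
  · rintro i hi σ' ⟨f1, f2, f3, f4⟩
    have hv' : σ'.v 10 = v := by rw [f2 10 (by simp), hv₁]
    simp only [Cmd.wp_set]
    refine ⟨by simp [hv', hmark]; omega, ?_, by simp [f1]; omega, by simp [f1], fun y hy => ?_,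
      by simp [f3], by simp; omega⟩
    · simp only [Cond.holds_eq, Exp.val_arr, Exp.val_var, f1, f3, Exp.val_add, hv', Exp.val_ofNat]
      exact (hmk _).2 (hused i hi)
    · simp [hy, f2 y hy]
  · rintro σ₂ ⟨f1, f2, f3, f4⟩
    have hv' : σ₂.v 10 = v := by rw [f2 10 (by simp), hv₁]
    simp only [Cmd.wp_put]
    refine ⟨by simp [hv', hmark]; omega, ?_, by simp, by simp, hcol, hE.B_le, m + 1, by omega,
      by simp [f1], fun u hu hc => ?_, fun c' hc' hlt => ?_, fun u => ?_, fun i => ?_,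
      fun y hy => ?_, fun j hj hj' => ?_, by simp; omega⟩
    · simp only [Cond.holds_eq, Exp.val_arr, Exp.val_var, f1, f3, Exp.val_add, hv', Exp.val_ofNat]
      exact fun h => hfree ((hmk _).1 h)
    · exact hfree ((hmem _).2 ⟨u, hu, hc⟩)
    · have := hused (c' - 1) (by omega)
      rw [Nat.sub_add_cancel hc'] at this
      exact (hmem _).1 this
    · simp [hv', f1, f3, h3 col hcm]
    · have := h1 i
      simp [hcm.symm, f3]
      split_ifs at this with h
      · exact Or.inl this
      · exact Or.inr this
    · have h5 := h2 y hy
      simp only [List.mem_cons, List.not_mem_nil, or_false, not_or] at hy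
      simp [f2 y hy.1, h5]
    · ext r
      simp [hj, f3, h3 j hj']

/-- The stamp `v + 1` records that a colour has been seen, so each colour is counted at its first
occurrence only. -/
theorem wp_countColors (hE : Layout E n G adj off k) {v : Fin n} {σ : St} (ho : o < 20)
    {lev col : Fin n → ℕ} (hσ : Stored n k off σ) (hv : σ.v 10 = v)
    (hlev : ∀ u : Fin n, σ.a (o + 3) u = lev u) (hcol : ∀ u : Fin n, σ.a (o + 6) u = col u)
    (hfresh : ∀ i, σ.a (o + 8) i ≠ v + 1) :
    (Cmd.countColors o).wp E (fun σ' =>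
      σ'.v 13 = (((adj v).toFinset.filter (fun u => lev u < lev v)).image col).card ∧
      (∀ i, σ'.a (o + 8) i = v + 1 ∨ σ'.a (o + 8) i = σ.a (o + 8) i) ∧
      (∀ y ∉ [13, 18, 19, 20], σ'.v y = σ.v y) ∧ (∀ j, j ≠ o + 8 → σ'.a j = σ.a j) ∧
      σ'.t ≤ σ.t + 150 * ((adj v).length + 1)) σ := by
  have hN := hE.le_N
  have hlen := hE.adj_length v
  have hvn := v.2
  simp only [Cmd.countColors, Cmd.wp_seq, Cmd.wp_set]
  refine ⟨by simp, ?_⟩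
  refine Cmd.wp_forBlock (l := adj v) (fun j σ' =>
    σ'.v 13 = ((((adj v).take j).toFinset.filter (fun u => lev u < lev v)).image col).card ∧
    (∀ i, σ'.a (o + 8) i =
      if i ∈ (((adj v).take j).toFinset.filter (fun u => lev u < lev v)).image col
        then (v : ℕ) + 1 else σ.a (o + 8) i) ∧
    (∀ y ∉ [13, 18, 19, 20], σ'.v y = σ.v y) ∧ (∀ j, j ≠ o + 8 → σ'.a j = σ.a j) ∧
    σ'.t ≤ σ.t + 50 + 140 * j) (off v) ?_ ?_ (hE.block v) hE.B_le_N (by simp) ?_ ?_ ?_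
  · simp
  · simp [hv, hσ.off_eq v]
  · refine ⟨by simp, fun i => by simp, fun y hy => ?_, fun j _ => rfl, by simp⟩
    simp only [List.mem_cons, List.not_mem_nil, or_false, not_or] at hy
    simp [hy]
  · rintro j hj σ' ⟨h1, h2, h3, h4, h5⟩ he
    set u := (adj v)[j] with hu
    have hcu : σ'.a (o + 6) u = col u := by rw [h4 _ (by omega), hcol]
    have hlu : σ'.a (o + 3) u = lev u := by rw [h4 _ (by omega), hlev]
    have hlv : σ'.a (o + 3) v = lev v := by rw [h4 _ (by omega), hlev]
    have hv' : σ'.v 10 = v := by rw [h3 10 (by simp), hv]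
    set I := (((adj v).take j).toFinset.filter (fun u => lev u < lev v)).image col with hI
    have htake : ((adj v).take (j + 1)).toFinset = insert u ((adj v).take j).toFinset := by
      rw [take_succ_of_lt hj, List.toFinset_append, Finset.union_comm]; rfl
    have hIcard : I.card ≤ n := by
      refine Finset.card_image_le.trans (card_fin_le _)
    have h2u := h2 (col u)
    have hframe : ∀ y ∉ [13, 18, 19, 20], ∀ z w, (((σ'.tick 3).set 18 z 4).set 20 w 3).v y =
      σ.v y := by
      intro y hy z w
      have := h3 y hy
      simp only [List.mem_cons, List.not_mem_nil, or_false, not_or] at hy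
      simp [hy, this]
    simp only [Cmd.wp_ite, Cmd.wp_skip, Cmd.wp_seq, Cmd.wp_put, Cmd.wp_set]
    refine ⟨by simp; omega, fun hb => ⟨by simp [hv']; omega, fun hb' => ?_, fun hb' => ?_⟩,
      fun hb => ?_⟩
    · have hlt : lev u < lev v := by simpa [hlu, hlv, hv'] using hb
      have hin : col u ∈ I := by
        by_contra h
        simp [hcu, hv', h2u, h] at hb'
        exact hfresh _ hb'
      rw [htake, Finset.filter_insert, if_pos hlt, Finset.image_insert, Finset.insert_eq_of_mem hin]
      exact ⟨by simp, by simp [he], by simpa using h1, h2, fun y hy => hframe y hy _ _, h4,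
        by simp; omega⟩
    · have hlt : lev u < lev v := by simpa [hlu, hlv, hv'] using hb
      have hin : col u ∉ I := by
        intro h
        simp [hcu, hv', h2u, h] at hb'
      rw [htake, Finset.filter_insert, if_pos hlt, Finset.image_insert]
      refine ⟨by simp; omega, by simp [hv']; omega, by omega, hE.B_le, ?_, by simp, by simp [he],
        ?_, fun i => ?_, fun y hy => ?_, fun i hi => ?_, by simp; omega⟩
      · simp [h1]; omega
      · rw [Finset.card_insert_of_notMem hin]
        simp [h1]
      · by_cases hi : i = col u
        · simp [hi, hcu, hv']
        · simp only [Finset.mem_insert, hi, false_or]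
          rw [← h2 i]
          simp [hcu, hi]
      · have := hframe y hy (off v + j + 1) u
        simp only [List.mem_cons, List.not_mem_nil, or_false, not_or] at hy
        simp [hy] at this
        simp [hy, this]
      · ext r
        simp [hi, h4 i hi]
    · have hlt : ¬ lev u < lev v := by simpa [hlu, hlv, hv'] using hb
      rw [htake, Finset.filter_insert, if_neg hlt]
      exact ⟨by simp, by simp [he], by simpa using h1, h2, fun y hy => hframe y hy _ _, h4,
        by simp; omega⟩
  · rintro σ' ⟨h1, h2, h3, h4, h5⟩
    rw [List.take_length] at h1 h2
    refine ⟨h1, fun i => ?_, h3, h4, by simp; omega⟩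
    rw [St.tick_a, h2 i]
    split_ifs
    · exact Or.inl rfl
    · exact Or.inr rfl

end

/-! ### The two passes of greedy colouring -/

section Passes

variable {n : ℕ} {G : SimpleGraph (Fin n)} {C : Finset (Fin n)}

/-- The vertices of rank less than `i`. -/
def initial (r : Fin n → ℕ) (i : ℕ) : Finset (Fin n) := Finset.univ.filter fun u => r u < i

theorem mem_initial {r : Fin n → ℕ} {i : ℕ} {u : Fin n} : u ∈ initial r i ↔ r u < i := by
  simp [initial]

theorem initial_succ {f r : Fin n → ℕ} (hr : IsRank f r) {v : Fin n} :
    initial r (r v + 1) = insert v (initial r (r v)) := by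
  ext u
  rw [Finset.mem_insert, mem_initial, mem_initial, ← hr.inj.eq_iff (a := u)]
  omega

theorem initial_zero (r : Fin n → ℕ) : initial r 0 = ∅ := by
  ext u; simp [mem_initial]

theorem initial_all {f r : Fin n → ℕ} (hr : IsRank f r) : initial r n = Finset.univ := by
  ext u; simp [mem_initial, hr.lt u]

/-- The vertices of level less than `l`. -/
noncomputable def lower (G : SimpleGraph (Fin n)) (C : Finset (Fin n)) (l : ℕ) :
    Finset (Fin n) :=
  Finset.univ.filter fun u => (missing G C u).card < l

theorem mem_lower {l : ℕ} {u : Fin n} : u ∈ lower G C l ↔ (missing G C u).card < l := by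
  simp [lower]

/-- The largest size of a clique below `v` is the number of colours of lower level that are not
used by neighbours of `v`. -/
theorem isCliqueNumOn_below (hG : P4Free G) (hC : IsMaximalClique G C) {v : Fin n}
    {col : Fin n → ℕ} {m : ℕ} {R : Finset (Fin n)}
    (hR : ∀ u, u ∈ R ↔ G.Adj v u ∧ u ∈ lower G C (missing G C v).card)
    (hproper : ∀ u w, G.Adj u w → u ∈ lower G C (missing G C v).card →
      w ∈ lower G C (missing G C v).card → col u ≠ col w)
    (hpos : ∀ u ∈ lower G C (missing G C v).card, 0 < col u ∧ col u ≤ m)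
    (hm : IsCliqueNumOn G (lower G C (missing G C v).card) m) :
    IsCliqueNumOn G (below G C v) (m - (R.image col).card) := by
  classical
  have hbl : ∀ u ∈ below G C v, u ∈ lower G C (missing G C v).card := fun u hu =>
    mem_lower.2 (mem_below_def.1 hu).1
  have hRX : ∀ u ∈ R, ∀ w ∈ below G C v, G.Adj u w := by
    intro u hu w hw
    have hu' := (hR u).1 hu
    refine adj_of_mem_below hG hC hu'.1.symm (fun h => ?_) hw
    have := mem_lower.1 hu'.2
    rw [h] at this
    exact lt_irrefl _ this
  have hsub : R.image col ⊆ Finset.Icc 1 m := by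
    intro c hc
    obtain ⟨u, hu, rfl⟩ := Finset.mem_image.1 hc
    exact Finset.mem_Icc.2 (hpos u ((hR u).1 hu).2)
  -- `R` is complete to `below G C v`, so a clique below `v` uses none of the colours of `R`.
  have hupper : ∀ K ⊆ below G C v, G.IsClique (K : Set (Fin n)) →
      K.card ≤ m - (R.image col).card := by
    intro K hK hKc
    have := card_le_of_proper (col := col) (T := Finset.Icc 1 m \ R.image col)
      (fun u hu w hw huw => hproper u w huw (hbl u (hK hu)) (hbl w (hK hw))) (fun u hu => by
        refine Finset.mem_sdiff.2 ⟨Finset.mem_Icc.2 (hpos u (hbl u (hK hu))), fun h => ?_⟩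
        obtain ⟨w, hw, hwu⟩ := Finset.mem_image.1 h
        exact hproper w u (hRX w hw u (hK hu)) ((hR w).1 hw).2 (hbl u (hK hu)) hwu) hKc
    rwa [Finset.card_sdiff_of_subset hsub, Nat.card_Icc, Nat.add_sub_cancel] at this
  refine ⟨?_, hupper⟩
  obtain ⟨Q, hQ, hQc, hQm⟩ := hm.1
  -- The neighbours of `v` in a maximum clique `Q` of the lower levels have distinct colours, all
  -- occurring on `R`. Removing them leaves a clique below `v` that attains the upper bound.
  have h1 : (Q.filter (G.Adj v)).card ≤ (R.image col).card := by
    refine card_le_of_proper (G := G) (col := col) (fun u hu w hw huw => ?_) (fun u hu => ?_)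
      (isClique_mono (Finset.filter_subset _ _) hQc)
    · exact hproper u w huw (hQ (Finset.mem_filter.1 hu).1) (hQ (Finset.mem_filter.1 hw).1)
    · have := Finset.mem_filter.1 hu
      exact Finset.mem_image_of_mem col ((hR u).2 ⟨this.2, hQ this.1⟩)
  have h2 : Q.filter (fun u => ¬ G.Adj v u) ⊆ below G C v := by
    intro u hu
    rw [Finset.mem_filter] at hu
    exact mem_below_def.2 ⟨mem_lower.1 (hQ hu.1), fun h => hu.2 h.symm⟩
  have h3 := Finset.card_filter_add_card_filter_not (s := Q) (G.Adj v)
  have hc := isClique_mono (Finset.filter_subset (fun u => ¬ G.Adj v u) Q) hQc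
  have h4 := hupper _ h2 hc
  exact ⟨_, h2, hc, by omega⟩

/-- The state of the first pass, when the vertices of rank less than `i` have been coloured: the
current level is `l`, and `m` colours were used for lower levels. -/
structure PassOne (G : SimpleGraph (Fin n)) (C : Finset (Fin n)) (r : Fin n → ℕ) (i : ℕ)
    (col x : Fin n → ℕ) (M l m : ℕ) : Prop where
  coloring : IsGreedyColoring G (initial r i) col 0 M
  le_level : ∀ u, r u < i → (missing G C u).card ≤ l
  level_le : ∀ u, i ≤ r u → l ≤ (missing G C u).card
  cliqueNum : IsCliqueNumOn G (lower G C l) m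
  col_le : ∀ u ∈ lower G C l, col u ≤ m
  below : ∀ u, r u < i → IsCliqueNumOn G (below G C u) (x u)

theorem PassOne.zero (r x : Fin n → ℕ) : PassOne G C r 0 (fun _ => 0) x 0 0 0 where
  coloring := by rw [initial_zero]; exact IsGreedyColoring.empty G 0
  le_level := by simp
  level_le := by simp
  cliqueNum := by
    have : lower G C 0 = ∅ := by ext; simp [mem_lower]
    rw [this]
    exact ⟨⟨∅, by simp⟩, fun K hK _ => by simp [Finset.subset_empty.1 hK]⟩
  col_le := by simp
  below := by simp

theorem PassOne.mem_initial_of_lower {r : Fin n → ℕ} {i : ℕ}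
    {col x : Fin n → ℕ} {M l m : ℕ} (h : PassOne G C r i col x M l m) {u : Fin n}
    (hu : u ∈ lower G C l) : u ∈ initial r i := by
  rw [mem_initial]
  by_contra hcon
  have := h.level_le u (by omega)
  have := mem_lower.1 hu
  omega

/-- In an order of nondecreasing level, the coloured vertices are now exactly those of lower level
than `v`, so `M` is their clique number. -/
theorem PassOne.new_level (hG : P4Free G) {r : Fin n → ℕ}
    (hr : IsRank (fun u => (missing G C u).card) r) {v : Fin n}
    {col x : Fin n → ℕ} {M l m : ℕ} (h : PassOne G C r (r v) col x M l m)
    (hv : (missing G C v).card ≠ l) :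
    PassOne G C r (r v) col x M (missing G C v).card M := by
  have hl := h.level_le v le_rfl
  have hlow : lower G C (missing G C v).card = initial r (r v) := by
    ext u
    rw [mem_lower, mem_initial]
    refine ⟨hr.mono u v, fun hu => ?_⟩
    have := h.le_level u hu
    omega
  refine ⟨h.coloring, fun u hu => (h.le_level u hu).trans hl, fun u hu => ?_, ?_,
    fun u _ => h.coloring.le u, h.below⟩
  · by_contra hcon
    have := hr.mono u v (by omega)
    omega
  · rw [hlow]
    exact h.coloring.isCliqueNumOn hG

/-- Colouring `v` does not touch lower levels, so `m` stays valid, and `isCliqueNumOn_below`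
identifies the new value of `x`. -/
theorem PassOne.step (hG : P4Free G) (hC : IsMaximalClique G C) {r : Fin n → ℕ}
    (hr : IsRank (fun u => (missing G C u).card) r) {v : Fin n}
    {col col' x x' : Fin n → ℕ} {M m c : ℕ} {R : Finset (Fin n)}
    (h : PassOne G C r (r v) col x M (missing G C v).card m)
    (hR : ∀ u, u ∈ R ↔ G.Adj v u ∧ u ∈ lower G C (missing G C v).card)
    (hx' : ∀ u, x' u = if u = v then m - (R.image col).card else x u)
    (hc : 0 < c) (hfree : ∀ u, G.Adj v u → col u ≠ c)
    (hlt : ∀ c', 0 < c' → c' < c → ∃ u, G.Adj v u ∧ col u = c')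
    (hcol' : ∀ u, col' u = if u = v then c else col u) :
    PassOne G C r (r v + 1) col' x' (max M c) (missing G C v).card m := by
  have hvn : v ∉ initial r (r v) := by simp [mem_initial]
  have hlow := fun u hu => h.mem_initial_of_lower (u := u) hu
  have hbelow := isCliqueNumOn_below hG hC hR
    (fun u w huw hu hw => h.coloring.proper u (hlow u hu) w (hlow w hw) huw)
    (fun u hu => ⟨Nat.pos_of_ne_zero ((h.coloring.ne_zero_iff u).2 (hlow u hu)), h.col_le u hu⟩)
    h.cliqueNum
  refine ⟨?_, fun u hu => ?_, fun u hu => h.level_le u (by omega), h.cliqueNum, fun u hu => ?_,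
    fun u hu => ?_⟩
  · rw [initial_succ hr]
    refine h.coloring.insert hvn hc (fun u _ => hfree u) (fun c' h1 h2 => ?_) hcol'
    obtain ⟨u, hvu, huc⟩ := hlt c' h1 h2
    -- Uncoloured vertices have colour `0`, so a neighbour of positive colour is among the coloured
    -- ones.
    exact ⟨u, (h.coloring.ne_zero_iff u).1 (by omega), hvu, huc⟩
  · rcases Nat.lt_succ_iff_lt_or_eq.1 hu with hu | hu
    · exact h.le_level u hu
    · rw [hr.inj hu]
  · have : u ≠ v := by
      rintro rfl
      exact lt_irrefl _ (mem_lower.1 hu)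
    rw [hcol', if_neg this]
    exact h.col_le u hu
  · rw [hx']
    by_cases huv : u = v
    · subst huv
      rwa [if_pos rfl]
    · rw [if_neg huv]
      exact h.below u (lt_of_le_of_ne (by omega) fun h' => huv (hr.inj h'))

/-- The state of the second pass, when the vertices of rank less than `i` have been examined, and
those in `S` have been coloured. -/
structure PassTwo (G : SimpleGraph (Fin n)) (C : Finset (Fin n)) (k : ℕ) (x r : Fin n → ℕ) (i : ℕ)
    (S : Finset (Fin n)) (col : Fin n → ℕ) (M : ℕ) : Prop where
  coloring : IsGreedyColoring G S col C.card M
  rank_lt : ∀ u ∈ S, r u < i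
  le : ∀ u ∈ S, x u + k ≤ M
  lt : ∀ u, r u < i → u ∉ S → M < x u + k
  exists_clique : ∀ u ∈ S, u ∉ C → ∃ K : Finset (Fin n), (∀ w ∈ K, x w < x u) ∧
    G.IsClique (K : Set (Fin n)) ∧ x u + k ≤ K.card

theorem PassTwo.zero (k : ℕ) (x r : Fin n → ℕ) : PassTwo G C k x r 0 ∅ (fun _ => 0) C.card :=
  ⟨IsGreedyColoring.empty G _, by simp, by simp, by simp, by simp⟩

theorem PassTwo.reject {k : ℕ} {x r : Fin n → ℕ} (hr : IsRank x r) {v : Fin n}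
    {S : Finset (Fin n)} {col : Fin n → ℕ} {M : ℕ} (h : PassTwo G C k x r (r v) S col M)
    (hv : M < x v + k) : PassTwo G C k x r (r v + 1) S col M := by
  refine ⟨h.coloring, fun u hu => (h.rank_lt u hu).trans (Nat.lt_succ_self _), h.le,
    fun u hu huS => ?_, h.exists_clique⟩
  rcases Nat.lt_succ_iff_lt_or_eq.1 hu with hu | hu
  · exact h.lt u hu huS
  · rwa [hr.inj hu]

/-- `M` may grow here, which could invalidate earlier rejections; but there are none, since the
order is by `x` and acceptance of `v` implies that of all vertices before it. -/
theorem PassTwo.accept (hG : P4Free G) (hC : IsMaximalClique G C) {k : ℕ} {x r : Fin n → ℕ}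
    (hx : IsBelowNum G C x) (hr : IsRank x r) {v : Fin n}
    {S : Finset (Fin n)} {col col' : Fin n → ℕ} {M c : ℕ} (h : PassTwo G C k x r (r v) S col M)
    (hv : x v + k ≤ M) (hc : 0 < c) (hfree : ∀ u, G.Adj v u → col u ≠ c)
    (hlt : ∀ c', 0 < c' → c' < c → ∃ u, G.Adj v u ∧ col u = c')
    (hcol' : ∀ u, col' u = if u = v then c else col u) :
    PassTwo G C k x r (r v + 1) (insert v S) col' (max M c) := by
  have hvS : v ∉ S := fun hvS => lt_irrefl _ (h.rank_lt v hvS)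
  have hle : ∀ u, r u < r v → x u ≤ x v := fun u hu => by
    by_contra hcon
    have := hr.mono v u (by omega)
    omega
  have hall : ∀ u, r u < r v → u ∈ S := fun u hu => by
    by_contra huS
    have := h.lt u hu huS
    have := hle u hu
    omega
  refine ⟨?_, fun u hu => ?_, fun u hu => ?_, fun u hu huS => ?_, fun u hu huC => ?_⟩
  · refine h.coloring.insert hvS hc (fun u _ => hfree u) (fun c' h1 h2 => ?_) hcol'
    obtain ⟨u, hvu, huc⟩ := hlt c' h1 h2
    exact ⟨u, (h.coloring.ne_zero_iff u).1 (by omega), hvu, huc⟩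
  · rcases Finset.mem_insert.1 hu with rfl | hu
    · exact Nat.lt_succ_self _
    · exact (h.rank_lt u hu).trans (Nat.lt_succ_self _)
  · refine le_trans ?_ (le_max_left M c)
    rcases Finset.mem_insert.1 hu with rfl | hu
    · exact hv
    · exact h.le u hu
  · rw [Finset.mem_insert, not_or] at huS
    exact absurd (hall u (lt_of_le_of_ne (by omega) fun h' => huS.1 (hr.inj h'))) huS.2
  · rcases Finset.mem_insert.1 hu with rfl | hu
    swap
    · exact h.exists_clique u hu huC
    -- A vertex outside `C` accepted earlier with the same `x` passes on its clique. Otherwise all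
    -- of `S` has smaller `x`, and a clique of size `M`, in `S` or `C` itself, will do.
    by_cases hex : ∃ w ∈ S, w ∉ C ∧ x w = x u
    · obtain ⟨w, hw, hwC, hwx⟩ := hex
      rw [← hwx]
      exact h.exists_clique w hw hwC
    push Not at hex
    have hCx : ∀ w ∈ C, x w < x u := fun w hw => by
      rw [hx.eq_zero hw]
      exact hx.pos hG hC huC
    rcases h.coloring.exists_clique hG with hM | ⟨K, hKS, hK, hKM⟩
    · exact ⟨C, hCx, hC.1, by omega⟩
    · refine ⟨K, fun w hw => ?_, hK, by omega⟩
      by_cases hwC : w ∈ C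
      · exact hCx w hwC
      · exact lt_of_le_of_ne (hle w (h.rank_lt w (hKS hw))) (hex w (hKS hw) hwC)

/-- The default value of `M` is attained by `C`, whose vertices all have `x` equal to `0` and hence,
as `k ≤ C.card`, belong to `S`. -/
theorem PassTwo.isClosure (hG : P4Free G) (hC : IsMaximalClique G C) {k : ℕ} {x r : Fin n → ℕ}
    (hx : IsBelowNum G C x) (hr : IsRank x r) (hk : k ≤ C.card)
    {S : Finset (Fin n)} {col : Fin n → ℕ} {M : ℕ} (h : PassTwo G C k x r n S col M) :
    IsClosure G C k S M := by
  have hS : ∀ v, v ∈ S ↔ x v + k ≤ M := fun v => by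
    refine ⟨h.le v, fun hv => ?_⟩
    by_contra hvS
    have := h.lt v (hr.lt v) hvS
    omega
  have hCM := h.coloring.default_le
  refine ⟨⟨x, hx, hS, h.exists_clique⟩, ⟨?_, fun K hK hKc => h.coloring.card_le hK hKc⟩,
    hk.trans hCM⟩
  rcases h.coloring.exists_clique hG with hM | hK
  · refine ⟨C, fun c hc => ?_, hC.1, hM.symm⟩
    rw [hS, hx.eq_zero hc]
    omega
  · exact hK

end Passes

namespace Cmd

/-- The first pass computes, in the array `o + 9`, the largest sizes of cliques below the
vertices. -/
def passOne (o : ℕ) : Cmd :=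
  11 ::= 0 ;; 12 ::= 0 ;; 5 ::= 0 ;; forVar 9 1 (
    10 ::= .arr (o + 5) (.var 9) ;;
    ite (.eq (.arr (o + 3) (.var 10)) (.var 11)) skip
      (12 ::= .var 5 ;; 11 ::= .arr (o + 3) (.var 10)) ;;
    countColors o ;; put (o + 9) (.var 10) (.var 12 - .var 13) ;;
    greedy (o + 6) (o + 7) ;; ite (.lt (.var 5) (.var 14)) (5 ::= .var 14) skip)

/-- The second pass colours, in the array `o + 12`, the vertices that can be used. -/
def passTwo (o : ℕ) : Cmd :=
  5 ::= .var 8 ;; forVar 9 1 (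
    10 ::= .arr (o + 11) (.var 9) ;;
    ite (.lt (.var 5) (.arr (o + 9) (.var 10) + .var 2)) skip
      (greedy (o + 12) (o + 13) ;; ite (.lt (.var 5) (.var 14)) (5 ::= .var 14) skip))

/-- The whole algorithm for the clique listed at the address in the variable `q`. -/
def run (o q : ℕ) : Cmd :=
  extend o q ;; levels o ;; sort (o + 3) (o + 4) (o + 5) ;; passOne o ;;
    sort (o + 9) (o + 10) (o + 11) ;; passTwo o

end Cmd

/-! ### The two passes as programs -/

section

variable {E : Env} {n : ℕ} {G : SimpleGraph (Fin n)} {adj : Fin n → List (Fin n)}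
  {off : Fin n → ℕ} {k o : ℕ} {C : Finset (Fin n)}

/-- All entries of the array `j` are marks left by vertices of rank less than `i`. -/
def Marked (r : Fin n → ℕ) (i j : ℕ) (σ : St) : Prop :=
  ∀ c, σ.a j c = 0 ∨ ∃ u : Fin n, r u < i ∧ σ.a j c = u + 1

theorem Marked.fresh {r : Fin n → ℕ} {v : Fin n} {j : ℕ} {σ : St}
    (h : Marked r (r v) j σ) (c : ℕ) : σ.a j c ≠ v + 1 := by
  rcases h c with h | ⟨u, hu, h⟩
  · omega
  · rw [h]
    intro huv
    have : u = v := Fin.ext (by omega)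
    exact lt_irrefl _ (this ▸ hu)

theorem Marked.succ {r : Fin n → ℕ} {v : Fin n} {j : ℕ} {σ σ' : St} (h : Marked r (r v) j σ)
    (h' : ∀ c, σ'.a j c = v + 1 ∨ σ'.a j c = σ.a j c) : Marked r (r v + 1) j σ' := by
  intro c
  rcases h' c with h1 | h1
  · exact Or.inr ⟨v, by omega, h1⟩
  · rw [h1]
    rcases h c with h2 | ⟨u, hu, h2⟩
    · exact Or.inl h2
    · exact Or.inr ⟨u, by omega, h2⟩

/-- A vertex costs time proportional to its degree plus one, so the clock is bounded through the
weight of the initial segment already treated. -/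
theorem wp_passOne (hE : Layout E n G adj off k) (hG : P4Free G) (hC : IsMaximalClique G C)
    {r : Fin n → ℕ} {σ : St} (ho : o < 18) (hσ : Stored n k off σ)
    (hlev : ∀ u : Fin n, σ.a (o + 3) u = (missing G C u).card)
    (hr : IsRank (fun u => (missing G C u).card) r) (hord : ∀ u, σ.a (o + 5) (r u) = u)
    (h0 : ∀ i, σ.a (o + 6) i = 0 ∧ σ.a (o + 7) i = 0 ∧ σ.a (o + 8) i = 0) :
    (Cmd.passOne o).wp E (fun σ' => IsBelowNum G C (fun u => σ'.a (o + 9) u) ∧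
      (∀ y < 9, y ≠ 5 → σ'.v y = σ.v y) ∧
      (∀ j, j < o + 6 ∨ o + 9 < j → σ'.a j = σ.a j) ∧
      σ'.t ≤ σ.t + 1000 * (weight adj Finset.univ + n + 1)) σ := by
  have hN := hE.le_N
  simp only [Cmd.passOne, Cmd.wp_seq, Cmd.wp_set]
  refine ⟨by simp, by simp, by simp, ?_⟩
  refine Cmd.wp_forVar n (fun i σ' =>
    PassOne G C r i (fun u => σ'.a (o + 6) u) (fun u => σ'.a (o + 9) u) (σ'.v 5) (σ'.v 11)
      (σ'.v 12) ∧ Marked r i (o + 7) σ' ∧ Marked r i (o + 8) σ' ∧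
    (∀ y < 9, y ≠ 5 → σ'.v y = σ.v y) ∧ (∀ j, j < o + 6 ∨ o + 9 < j → σ'.a j = σ.a j) ∧
    σ'.t ≤ σ.t + 20 + 400 * weight adj (initial r i) + 300 * i) (by omega) ?_ ?_ ?_ ?_
  · refine ⟨?_, fun c => by simp [h0], fun c => by simp [h0], fun y hy hy5 => ?_,
      fun j _ => by simp, by simp; omega⟩
    · simp [h0]
      exact PassOne.zero r _
    · have h1 : y ≠ 9 := by omega
      have h2 : y ≠ 11 := by omega
      have h3 : y ≠ 12 := by omega
      simp [h1, h2, h3, hy5]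
  · rintro i σ' ⟨-, -, -, g, -⟩
    rw [g 1 (by simp) (by simp), hσ.n_eq]
  · rintro i hi σ₁ ⟨p, m7, m8, fv, fa, ft⟩ hx
    obtain ⟨v, rfl⟩ := hr.surj i hi
    have hov : σ₁.a (o + 5) (r v) = v := by rw [fa _ (by omega), hord]
    have hlv : ∀ u : Fin n, σ₁.a (o + 3) u = (missing G C u).card := fun u => by
      rw [fa _ (by omega), hlev]
    simp only [Cmd.wp_seq, Cmd.wp_set]
    have hval : Exp.val E (σ₁.tick 3) (.arr (o + 5) (.var 9)) = v := by simp [hx, hov]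
    rw [hval]
    refine ⟨by simp; omega, ?_⟩
    set σ₂ := (σ₁.tick 3).set 10 v ((Exp.arr (o + 5) (.var 9)).cost + 1) with hσ₂
    -- At a new level, all colours used so far belong to lower levels, so the current maximum in
    -- variable `5` becomes `m`.
    have hlevel : (Cmd.ite (.eq (.arr (o + 3) (.var 10)) (.var 11)) Cmd.skip
        (12 ::= .var 5 ;; 11 ::= .arr (o + 3) (.var 10))).wp E (fun σ₃ =>
        PassOne G C r (r v) (fun u => σ₃.a (o + 6) u) (fun u => σ₃.a (o + 9) u) (σ₃.v 5)
          (missing G C v).card (σ₃.v 12) ∧ σ₃.v 11 = (missing G C v).card ∧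
        (∀ y, y ≠ 11 → y ≠ 12 → σ₃.v y = σ₂.v y) ∧ σ₃.a = σ₂.a ∧ σ₃.t ≤ σ₂.t + 50) σ₂ := by
      simp only [Cmd.wp_ite, Cmd.wp_skip, Cmd.wp_seq, Cmd.wp_set]
      refine ⟨by simp; omega, fun hb => ?_, fun hb => ⟨by simp, by simp; omega, ?_⟩⟩
      · have hb' : (missing G C v).card = σ₁.v 11 := by simpa [hσ₂, hlv] using hb
        exact ⟨by rw [hb']; simpa [hσ₂] using p, by rw [hb']; simp [hσ₂],
          fun y _ _ => rfl, rfl, by simp⟩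
      · have hb' : (missing G C v).card ≠ σ₁.v 11 := by simpa [hσ₂, hlv] using hb
        exact ⟨by simpa [hσ₂] using p.new_level hG hr hb', by simp [hσ₂, hlv],
          fun y h1 h2 => by simp [h1, h2], rfl, by simp⟩
    refine Cmd.wp_mono hlevel ?_
    rintro σ₃ ⟨p₃, v11, fv₃, fa₃, ft₃⟩
    have fa₃' : σ₃.a = σ₁.a := fa₃
    have st₃ : Stored n k off σ₃ := hσ.congr
      (by rw [fv₃ 1 (by simp) (by simp), ← fv 1 (by simp) (by simp)]; simp [hσ₂])
      (by rw [fv₃ 2 (by simp) (by simp), ← fv 2 (by simp) (by simp)]; simp [hσ₂])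
      (by rw [fa₃', fa 0 (by omega)])
    have v10₃ : σ₃.v 10 = v := by rw [fv₃ 10 (by simp) (by simp)]; simp [hσ₂]
    rw [Cmd.wp_seq]
    refine Cmd.wp_mono (wp_countColors hE (by omega) st₃ v10₃ (lev := fun u => (missing G C u).card)
      (col := fun u => σ₃.a (o + 6) u) (fun u => by rw [fa₃', hlv]) (fun u => rfl)
      (by rw [fa₃']; exact m8.fresh)) ?_
    rintro σ₄ ⟨v13, mk₄, fv₄, fa₄, ft₄⟩
    simp only [Cmd.wp_seq, Cmd.wp_put]
    refine ⟨by simp, by simp, by omega, hE.B_le, ?_⟩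
    set σ₅ := σ₄.put (o + 9) ((Exp.var 10).val E σ₄) ((Exp.var 12 - Exp.var 13).val E σ₄)
      ((Exp.var 10).cost + (Exp.var 12 - Exp.var 13).cost + 9) with hσ₅
    have v10₄ : σ₄.v 10 = v := by rw [fv₄ 10 (by simp), v10₃]
    have st₄ : Stored n k off σ₄ := st₃.congr (fv₄ 1 (by simp)) (fv₄ 2 (by simp)) (fa₄ 0 (by omega))
    have st₅ : Stored n k off σ₅ := st₄.congr rfl rfl (by ext; simp [hσ₅])
    have a₅ : ∀ j, j ≠ o + 9 → j ≠ o + 8 → σ₅.a j = σ₁.a j := fun j h1 h2 => by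
      rw [← fa₃', ← fa₄ j h2]; ext; simp [hσ₅, h1]
    refine Cmd.wp_mono (wp_greedy hE (col := o + 6) (mark := o + 7) (v := v) (by omega) (by omega)
      (by omega) st₅ (by simp [hσ₅, v10₄])
      (by rw [a₅ _ (by omega) (by omega)]; exact m7.fresh)) ?_
    rintro σ₆ ⟨c, hc, v14, hfree, hlt, hcol, mk₆, fv₆, fa₆, ft₆⟩
    have hcol₅ : σ₅.a (o + 6) = σ₃.a (o + 6) := by rw [a₅ _ (by omega) (by omega), fa₃']
    rw [hcol₅] at hfree hlt hcol
    have v5₆ : σ₆.v 5 = σ₃.v 5 := by rw [fv₆ 5 (by simp), ← fv₄ 5 (by simp)]; rfl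
    have v12₆ : σ₆.v 12 = σ₃.v 12 := by rw [fv₆ 12 (by simp), ← fv₄ 12 (by simp)]; rfl
    have v11₆ : σ₆.v 11 = (missing G C v).card := by
      rw [fv₆ 11 (by simp), ← v11, ← fv₄ 11 (by simp)]; rfl
    have v9₆ : σ₆.v 9 = r v := by
      rw [fv₆ 9 (by simp)]
      change σ₄.v 9 = _
      rw [fv₄ 9 (by simp), fv₃ 9 (by simp) (by simp)]
      simp [hσ₂, hx]
    have hx9 : ∀ u : Fin n, σ₆.a (o + 9) u = if u = v then σ₃.v 12 - σ₄.v 13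
        else σ₃.a (o + 9) u := by
      intro u
      rw [fa₆ _ (by omega) (by omega), ← fv₄ 12 (by simp), ← fa₄ (o + 9) (by omega)]
      simp [hσ₅, v10₄, Fin.val_inj]
    have hp := p₃.step hG hC hr (x' := fun u => σ₆.a (o + 9) u) (col' := fun u => σ₆.a (o + 6) u)
      (R := (adj v).toFinset.filter fun u => (missing G C u).card < (missing G C v).card)
      (fun u => by simp [hE.mem_adj, mem_lower]) (fun u => by rw [hx9, v13]) hc
      (fun u => hfree u) hlt (fun u => (hcol u).trans (by simp only [Fin.val_inj]))
    have hm7 : Marked r (r v + 1) (o + 7) σ₆ := m7.succ fun c => by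
      have := mk₆ c
      rwa [a₅ (o + 7) (by omega) (by omega)] at this
    have hm8 : Marked r (r v + 1) (o + 8) σ₆ := m8.succ fun c => by
      have h1 := mk₄ c
      have h2 : σ₆.a (o + 8) = σ₄.a (o + 8) := by
        rw [fa₆ _ (by omega) (by omega)]; ext; simp [hσ₅]
      rwa [h2, ← fa₃']
    have hfv : ∀ y < 9, y ≠ 5 → σ₆.v y = σ.v y := fun y hy hy5 => by
      have h1 : y ≠ 10 := by omega
      rw [fv₆ y (by simp; omega), ← fv y hy hy5]
      change σ₄.v y = _
      rw [fv₄ y (by simp; omega), fv₃ y (by omega) (by omega)]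
      simp [hσ₂, h1]
    have hfa : ∀ j, j < o + 6 ∨ o + 9 < j → σ₆.a j = σ.a j := fun j hj => by
      rw [fa₆ j (by omega) (by omega), a₅ j (by omega) (by omega), fa j hj]
    have hft : σ₆.t ≤ σ.t + 20 + 400 * weight adj (initial r (r v + 1)) + 300 * r v + 200 := by
      rw [initial_succ hr, weight_insert adj (by simp [mem_initial])]
      have h2 : σ₂.t = σ₁.t + 14 := by simp [hσ₂]
      have h5 : σ₅.t = σ₄.t + 13 := by simp [hσ₅]
      omega
    -- Both branches of the last conditional leave the maximum of the old bound and `c` in variable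
    -- `5`; the invariant is verified once for either.
    have hset : ∀ (σ₇ : St), σ₇.a = σ₆.a → (∀ y, y ≠ 5 → y ≠ 9 → σ₇.v y = σ₆.v y) →
        σ₇.v 5 = max (σ₃.v 5) c → σ₇.t ≤ σ₆.t + 50 →
        PassOne G C r (r v + 1) (fun u => σ₇.a (o + 6) u) (fun u => σ₇.a (o + 9) u) (σ₇.v 5)
          (σ₇.v 11) (σ₇.v 12) ∧ Marked r (r v + 1) (o + 7) σ₇ ∧ Marked r (r v + 1) (o + 8) σ₇ ∧
        (∀ y < 9, y ≠ 5 → σ₇.v y = σ.v y) ∧ (∀ j, j < o + 6 ∨ o + 9 < j → σ₇.a j = σ.a j) ∧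
        σ₇.t ≤ σ.t + 20 + 400 * weight adj (initial r (r v + 1)) + 300 * (r v + 1) := by
      intro σ₇ ha hv hv5 ht
      refine ⟨?_, ?_, ?_, fun y hy hy5 => ?_, fun j hj => ?_, by omega⟩
      · rw [ha, hv 11 (by simp) (by simp), hv 12 (by simp) (by simp), hv5, v11₆, v12₆]
        exact hp
      · unfold Marked; rw [ha]; exact hm7
      · unfold Marked; rw [ha]; exact hm8
      · rw [hv y hy5 (by omega), hfv y hy hy5]
      · rw [ha, hfa j hj]
    simp only [Cmd.wp_ite, Cmd.wp_skip, Cmd.wp_set]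
    refine ⟨by simp, fun hb => ⟨by simp, by simp [v9₆], hset _ rfl ?_ ?_ (by simp)⟩,
      fun hb => ⟨by simp [v9₆], hset _ rfl ?_ ?_ (by simp)⟩⟩
    · intro y h1 h2; simp [h1, h2]
    · have hb' : σ₃.v 5 < c := by simpa [v5₆, v14] using hb
      simp [v14, hb'.le]
    · intro y h1 h2; simp [h2]
    · have hb' : c ≤ σ₃.v 5 := by simpa [v5₆, v14] using hb
      simp [v5₆, hb']
  · rintro σ' ⟨p, -, -, fv, fa, ft⟩
    refine ⟨fun u => p.below u (hr.lt u), fv, fa, ?_⟩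
    rw [initial_all hr] at ft
    simp
    omega

theorem wp_passTwo (hE : Layout E n G adj off k) (hG : P4Free G) (hC : IsMaximalClique G C)
    (hk : k ≤ C.card) {x r : Fin n → ℕ} {σ : St} (ho : o < 18) (hσ : Stored n k off σ)
    (hv8 : σ.v 8 = C.card) (hxa : ∀ u : Fin n, σ.a (o + 9) u = x u) (hx : IsBelowNum G C x)
    (hr : IsRank x r) (hord : ∀ u, σ.a (o + 11) (r u) = u)
    (h0 : ∀ i, σ.a (o + 12) i = 0 ∧ σ.a (o + 13) i = 0) :
    (Cmd.passTwo o).wp E (fun σ' => ∃ S, IsClosure G C k S (σ'.v 5) ∧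
      (∀ u : Fin n, σ'.a (o + 12) u ≠ 0 ↔ u ∈ S) ∧ (∀ y < 8, y ≠ 5 → σ'.v y = σ.v y) ∧
      (∀ j, j < o + 12 ∨ o + 13 < j → σ'.a j = σ.a j) ∧
      σ'.t ≤ σ.t + 500 * (weight adj Finset.univ + n + 1)) σ := by
  have hN := hE.le_N
  have hxn : ∀ u, x u ≤ n := fun u => by
    obtain ⟨K, -, -, hK⟩ := (hx u).1
    rw [← hK]
    exact card_fin_le K
  simp only [Cmd.passTwo, Cmd.wp_seq, Cmd.wp_set]
  refine ⟨by simp, ?_⟩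
  refine Cmd.wp_forVar n (fun i σ' =>
    (∃ S, PassTwo G C k x r i S (fun u => σ'.a (o + 12) u) (σ'.v 5)) ∧ Marked r i (o + 13) σ' ∧
    (∀ y < 8, y ≠ 5 → σ'.v y = σ.v y) ∧ (∀ j, j < o + 12 ∨ o + 13 < j → σ'.a j = σ.a j) ∧
    σ'.t ≤ σ.t + 20 + 200 * weight adj (initial r i) + 150 * i) (by omega) ?_ ?_ ?_ ?_
  · refine ⟨⟨∅, ?_⟩, fun c => by simp [h0], fun y hy hy5 => ?_, fun j _ => by simp,
      by simp; omega⟩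
    · simp [h0, hv8]
      exact PassTwo.zero k x r
    · have h1 : y ≠ 9 := by omega
      simp [h1, hy5]
  · rintro i σ' ⟨-, -, g, -⟩
    rw [g 1 (by simp) (by simp), hσ.n_eq]
  · rintro i hi σ₁ ⟨⟨S, p⟩, m, fv, fa, ft⟩ hx9
    obtain ⟨v, rfl⟩ := hr.surj i hi
    have hov : σ₁.a (o + 11) (r v) = v := by rw [fa _ (by omega), hord]
    have hxv : σ₁.a (o + 9) v = x v := by rw [fa _ (by omega), hxa]
    have v2 : σ₁.v 2 = k := by rw [fv 2 (by simp) (by simp), hσ.k_eq]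
    have hxvn := hxn v
    simp only [Cmd.wp_seq, Cmd.wp_set]
    have hval : Exp.val E (σ₁.tick 3) (.arr (o + 11) (.var 9)) = v := by simp [hx9, hov]
    rw [hval]
    refine ⟨by simp; omega, ?_⟩
    set σ₂ := (σ₁.tick 3).set 10 v ((Exp.arr (o + 11) (.var 9)).cost + 1) with hσ₂
    have hσ₂v : ∀ y, y ≠ 10 → σ₂.v y = σ₁.v y := fun y hy => by simp [hσ₂, hy]
    have t₂ : σ₂.t = σ₁.t + 14 := by simp [hσ₂]
    have hmono := weight_mono adj (S := initial r (r v)) (T := initial r (r v + 1))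
      (fun u hu => mem_initial.2 (by have := mem_initial.1 hu; omega))
    have hins : weight adj (initial r (r v + 1)) =
        (adj v).length + 1 + weight adj (initial r (r v)) := by
      rw [initial_succ hr, weight_insert adj (by simp [mem_initial])]
    simp only [Cmd.wp_ite, Cmd.wp_skip, Cmd.wp_seq]
    refine ⟨by simp [hσ₂, hxv, v2]; omega, fun hb => ?_, fun hb => ?_⟩
    · have hb' : σ₁.v 5 < x v + k := by simpa [hσ₂, hxv, v2] using hb
      refine ⟨by simp [hσ₂, hx9], ⟨S, by simpa [hσ₂] using p.reject hr hb'⟩,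
        fun c => ?_, fun y hy hy5 => ?_, fa, by simp [t₂]; omega⟩
      · rcases m c with h | ⟨u, hu, h⟩
        · exact Or.inl h
        · exact Or.inr ⟨u, by omega, h⟩
      · have h1 : y ≠ 9 := by omega
        simp [h1, hσ₂v y (by omega), fv y hy hy5]
    · have hb' : x v + k ≤ σ₁.v 5 := by simpa [hσ₂, hxv, v2] using hb
      set σ₃ := σ₂.tick ((Cond.lt (.var 5) (.arr (o + 9) (.var 10) + .var 2)).cost + 1) with hσ₃
      have t₃ : σ₃.t = σ₂.t + 14 := by simp [hσ₃]
      have st₃ : Stored n k off σ₃ := hσ.congr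
        (by rw [← fv 1 (by simp) (by simp)]; exact hσ₂v 1 (by simp))
        (by rw [← fv 2 (by simp) (by simp)]; exact hσ₂v 2 (by simp)) (fa 0 (by omega))
      refine Cmd.wp_mono (wp_greedy hE (col := o + 12) (mark := o + 13) (v := v) (by omega)
        (by omega) (by omega) st₃ (by simp [hσ₃, hσ₂]) (m.fresh)) ?_
      rintro σ₄ ⟨c, hc, v14, hfree, hlt, hcol, mk, fv₄, fa₄, ft₄⟩
      have v5 : σ₄.v 5 = σ₁.v 5 := by
        rw [fv₄ 5 (by simp), ← hσ₂v 5 (by simp)]; rfl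
      have v9 : σ₄.v 9 = r v := by
        rw [fv₄ 9 (by simp), ← hx9, ← hσ₂v 9 (by simp)]; rfl
      have hp := p.accept hG hC hx hr hb' (col' := fun u => σ₄.a (o + 12) u) hc
        (fun u => hfree u) hlt (fun u => (hcol u).trans (by simp only [Fin.val_inj]; rfl))
      have hm : Marked r (r v + 1) (o + 13) σ₄ := m.succ mk
      have hset : ∀ (σ₇ : St), σ₇.a = σ₄.a → (∀ y, y ≠ 5 → y ≠ 9 → σ₇.v y = σ₄.v y) →
          σ₇.v 5 = max (σ₁.v 5) c → σ₇.t ≤ σ₄.t + 50 →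
          (∃ S, PassTwo G C k x r (r v + 1) S (fun u => σ₇.a (o + 12) u) (σ₇.v 5)) ∧
          Marked r (r v + 1) (o + 13) σ₇ ∧ (∀ y < 8, y ≠ 5 → σ₇.v y = σ.v y) ∧
          (∀ j, j < o + 12 ∨ o + 13 < j → σ₇.a j = σ.a j) ∧
          σ₇.t ≤ σ.t + 20 + 200 * weight adj (initial r (r v + 1)) + 150 * (r v + 1) := by
        intro σ₇ ha hv hv5 ht
        refine ⟨⟨insert v S, ?_⟩, ?_, fun y hy hy5 => ?_, fun j hj => ?_, by omega⟩
        · rw [ha, hv5]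
          exact hp
        · unfold Marked; rw [ha]; exact hm
        · rw [hv y hy5 (by omega), fv₄ y (by simp; omega), ← fv y hy hy5,
            ← hσ₂v y (by omega)]
          rfl
        · rw [ha, fa₄ j (by omega) (by omega), ← fa j hj]
          rfl
      refine ⟨by simp, fun hb => ⟨by simp, by simp [v9], hset _ rfl ?_ ?_ (by simp)⟩,
        fun hb => ⟨by simp [v9], hset _ rfl ?_ ?_ (by simp)⟩⟩
      · intro y h1 h2; simp [h1, h2]
      · have hb' : σ₁.v 5 < c := by simpa [v5, v14] using hb
        simp [v14, hb'.le]
      · intro y h1 h2; simp [h2]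
      · have hb' : c ≤ σ₁.v 5 := by simpa [v5, v14] using hb
        simp [v5, hb']
  · rintro σ' ⟨⟨S, p⟩, -, fv, fa, ft⟩
    refine ⟨S, p.isClosure hG hC hx hr hk, p.coloring.ne_zero_iff, fv, fa, ?_⟩
    rw [initial_all hr] at ft
    simp
    omega

end

/-! ### The decision procedure and the input format -/

namespace Cmd

/-- Decide reachability of the second clique from the first with the threshold in the
variable `2`; the variables `3` and `4` hold the addresses of the cliques. -/
def decideTAR : Cmd :=
  0 ::= 0 ;; ite (.lt (.inp (.var 3)) (.var 2)) skip (
    ite (.lt (.inp (.var 4)) (.var 2)) skip (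
      run 0 3 ;; 6 ::= .var 5 ;; run 13 4 ;; ite (.eq (.var 5) (.var 6))
        (0 ::= 1 ;; forBlock 15 16 17 (.var 4) (ite (.eq (.arr 12 (.var 17)) 0) (0 ::= 0) skip))
        skip))

/-- Find the two cliques and the end of the input, whose graph starts at the address `p`. -/
def scan (p : ℕ) : Cmd :=
  1 ::= .inp (.lit p) ;; 7 ::= .lit (p + 1) ;;
  forVar 9 1 (7 ::= .var 7 + .inp (.var 7) + 1) ;;
  3 ::= .var 7 ;; 4 ::= .var 3 + .inp (.var 3) + 1 ;; 7 ::= .var 4 + .inp (.var 4) + 1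

/-- Store the addresses of the adjacency lists. -/
def index (p : ℕ) : Cmd :=
  7 ::= .lit (p + 1) ;;
  forVar 9 1 (put 0 (.var 9) (.var 7) ;; 7 ::= .var 7 + .inp (.var 7) + 1)

end Cmd

/-! ### Correctness of the decision procedure and of reading the input -/

section

variable {E : Env} {n : ℕ} {G : SimpleGraph (Fin n)} {adj : Fin n → List (Fin n)}
  {off : Fin n → ℕ} {k o : ℕ}

set_option maxRecDepth 8000 in
theorem wp_run (hE : Layout E n G adj off k) (hG : P4Free G) {A : List (Fin n)} {q : ℕ} {σ : St}
    (ho : o < 18) (hσ : Stored n k off σ) (hA : A.Nodup)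
    (hAc : G.IsClique (A.toFinset : Set (Fin n))) (hk : k ≤ A.length) (hq : q < 8)
    (hblock : IsBlock E (σ.v q) A)
    (h0 : ∀ j, o + 1 ≤ j → j ≤ o + 13 → ∀ i, σ.a j i = 0) :
    (Cmd.run o q).wp E (fun σ' => ∃ C S, A.toFinset ⊆ C ∧ IsMaximalClique G C ∧
      IsClosure G C k S (σ'.v 5) ∧ (∀ u : Fin n, σ'.a (o + 12) u ≠ 0 ↔ u ∈ S) ∧
      (∀ y < 8, y ≠ 5 → σ'.v y = σ.v y) ∧ (∀ j, j < o + 1 ∨ o + 13 < j → σ'.a j = σ.a j) ∧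
      σ'.t ≤ σ.t + 2800 * (weight adj Finset.univ + n + 1)) σ := by
  have hN := hE.le_N
  simp only [Cmd.run, Cmd.wp_seq]
  refine Cmd.wp_mono (wp_extend hE (by omega) hσ hA hAc hq hblock
    (fun i => ⟨h0 _ (by omega) (by omega) i, h0 _ (by omega) (by omega) i⟩)) ?_
  rintro σ₁ ⟨C, hAC, hC, hc, v₁, a₁, t₁⟩
  have st₁ : Stored n k off σ₁ := hσ.congr (v₁ 1 (by simp)) (v₁ 2 (by simp))
    (a₁ 0 (by omega) (by omega))
  rw [Cmd.wp_seq]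
  refine Cmd.wp_mono (wp_levels hE (by omega) st₁.n_eq hc
    (fun i => by rw [a₁ _ (by omega) (by omega), h0 _ (by omega) (by omega)])) ?_
  rintro σ₂ ⟨l₂, v₂, a₂, t₂⟩
  have hlevn : ∀ u, (missing G C u).card ≤ n := fun u => card_fin_le _
  rw [Cmd.wp_seq]
  refine Cmd.wp_mono (wp_sort hE.B_le (by omega) (by rw [v₂ 1 (by simp), st₁.n_eq]) l₂ hlevn
    (fun i => by rw [a₂ _ (by omega), a₁ _ (by omega) (by omega), h0 _ (by omega) (by omega)])
    (by omega) (by omega) (by omega) (by omega) (by omega) (by omega)) ?_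
  rintro σ₃ ⟨⟨r, hr, ord₃⟩, v₃, a₃, t₃⟩
  have a₃' : ∀ j, j ≠ o + 1 → j ≠ o + 2 → j ≠ o + 3 → j ≠ o + 4 → j ≠ o + 5 → σ₃.a j = σ.a j :=
    fun j h1 h2 h3 h4 h5 => by rw [a₃ j h4 h5, a₂ j h3, a₁ j h1 h2]
  have v₃' : ∀ y < 8, σ₃.v y = σ.v y := fun y hy => by
    rw [v₃ y (by simp; omega), v₂ y (by omega), v₁ y hy]
  have st₃ : Stored n k off σ₃ := hσ.congr (v₃' 1 (by simp)) (v₃' 2 (by simp))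
    (a₃' 0 (by omega) (by omega) (by omega) (by omega) (by omega))
  rw [Cmd.wp_seq]
  refine Cmd.wp_mono (wp_passOne hE hG hC ho st₃
    (fun u => by rw [a₃ _ (by omega) (by omega), l₂]) hr ord₃ (fun i => ?_)) ?_
  · refine ⟨?_, ?_, ?_⟩ <;>
      rw [a₃' _ (by omega) (by omega) (by omega) (by omega) (by omega),
        h0 _ (by omega) (by omega)]
  rintro σ₄ ⟨hx, v₄, a₄, t₄⟩
  have hxn : ∀ u : Fin n, σ₄.a (o + 9) u ≤ n := fun u => by
    obtain ⟨K, -, -, hK⟩ := (hx u).1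
    simp only at hK
    rw [← hK]
    exact card_fin_le K
  have h0₄ : ∀ j, o + 10 ≤ j → j ≤ o + 13 → ∀ i, σ₄.a j i = 0 := fun j h1 h2 i => by
    rw [a₄ j (by omega), a₃' j (by omega) (by omega) (by omega) (by omega) (by omega),
      h0 j (by omega) h2]
  rw [Cmd.wp_seq]
  refine Cmd.wp_mono (wp_sort hE.B_le (by omega)
    (by rw [v₄ 1 (by simp) (by simp), st₃.n_eq]) (fun u => rfl) hxn (h0₄ _ (by omega) (by omega))
    (by omega) (by omega) (by omega) (by omega) (by omega) (by omega)) ?_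
  rintro σ₅ ⟨⟨r', hr', ord₅⟩, v₅, a₅, t₅⟩
  have v₅' : ∀ y < 8, y ≠ 5 → σ₅.v y = σ.v y := fun y hy hy5 => by
    rw [v₅ y (by simp; omega), v₄ y (by omega) hy5, v₃' y hy]
  have st₅ : Stored n k off σ₅ := hσ.congr (v₅' 1 (by simp) (by simp)) (v₅' 2 (by simp) (by simp))
    (by rw [a₅ 0 (by omega) (by omega), a₄ 0 (by omega),
      a₃' 0 (by omega) (by omega) (by omega) (by omega) (by omega)])
  have hkC : k ≤ C.card := by
    refine hk.trans ?_
    rw [← List.toFinset_card_of_nodup hA]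
    exact Finset.card_le_card hAC
  refine Cmd.wp_mono (wp_passTwo hE hG hC hkC ho st₅
    (by rw [v₅ 8 (by simp), v₄ 8 (by simp) (by simp), v₃ 8 (by simp), v₂ 8 (by simp), hc.size])
    (fun u => by rw [a₅ _ (by omega) (by omega)]) hx hr' ord₅ (fun i => ?_)) ?_
  · refine ⟨?_, ?_⟩ <;> rw [a₅ _ (by omega) (by omega), h0₄ _ (by omega) (by omega)]
  rintro σ₆ ⟨S, hS, hmem, v₆, a₆, t₆⟩
  refine ⟨C, S, hAC, hC, hS, hmem, fun y hy hy5 => by rw [v₆ y hy hy5, v₅' y hy hy5],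
    fun j hj => ?_, by omega⟩
  rw [a₆ j (by omega), a₅ j (by omega) (by omega), a₄ j (by omega),
    a₃' j (by omega) (by omega) (by omega) (by omega) (by omega)]

-- Cliques with fewer than `k` vertices are refused first, which provides the size condition of both
-- runs. The second run works on the arrays `14` to `26`, still zero, so that array `12` keeps the
-- set `S` of the first.
set_option maxRecDepth 8000 in
theorem wp_decideTAR (hE : Layout E n G adj off k) (hG : P4Free G) {A B : List (Fin n)} {σ : St}
    (hσ : Stored n k off σ) (hA : A.Nodup) (hAc : G.IsClique (A.toFinset : Set (Fin n)))
    (hB : B.Nodup) (hBc : G.IsClique (B.toFinset : Set (Fin n)))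
    (hA' : IsBlock E (σ.v 3) A) (hB' : IsBlock E (σ.v 4) B)
    (h0 : ∀ j, 1 ≤ j → ∀ i, σ.a j i = 0) :
    Cmd.decideTAR.wp E (fun σ' =>
      (TARReachable G k A.toFinset B.toFinset → σ'.v 0 = 1) ∧
      (¬ TARReachable G k A.toFinset B.toFinset → σ'.v 0 = 0) ∧
      σ'.v 3 = σ.v 3 ∧ σ'.v 4 = σ.v 4 ∧
      σ'.t ≤ σ.t + 6000 * (weight adj Finset.univ + n + 1)) σ := by
  have hN := hE.le_N
  have hlenB := length_adj_le hB
  have hcA := List.toFinset_card_of_nodup hA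
  have hcB := List.toFinset_card_of_nodup hB
  simp only [Cmd.decideTAR, Cmd.wp_seq, Cmd.wp_set, Cmd.wp_ite, Cmd.wp_skip]
  refine ⟨by simp, ?_, fun hb => ?_, fun hb => ⟨?_, fun hb' => ?_, fun hb' => ?_⟩⟩
  · have := hA'.1
    simp; omega
  · have hlt : A.length < k := by simpa [hA'.2.1, hσ.k_eq] using hb
    refine ⟨fun h => ?_, fun _ => by simp, by simp, by simp, by simp; omega⟩
    have := h.1
    omega
  · have := hB'.1
    simp; omega
  · have hlt : B.length < k := by simpa [hB'.2.1, hσ.k_eq] using hb'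
    refine ⟨fun h => ?_, fun _ => by simp, by simp, by simp, by simp; omega⟩
    have := h.2.1
    omega
  have hkA : k ≤ A.length := by simpa [hA'.2.1, hσ.k_eq] using hb
  have hkB : k ≤ B.length := by simpa [hB'.2.1, hσ.k_eq] using hb'
  set σ₀ := ((σ.set 0 (Exp.val E σ 0) (Exp.cost 0 + 1)).tick
    ((Cond.lt (.inp (.var 3)) (.var 2)).cost + 1)).tick
    ((Cond.lt (.inp (.var 4)) (.var 2)).cost + 1) with hσ₀
  have t₀ : σ₀.t = σ.t + 10 := by simp [hσ₀]
  have v₀ : ∀ y, y ≠ 0 → σ₀.v y = σ.v y := fun y hy => by simp [hσ₀, hy]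
  have v₀0 : σ₀.v 0 = 0 := by simp [hσ₀]
  have st₀ : Stored n k off σ₀ := hσ.congr (v₀ 1 (by simp)) (v₀ 2 (by simp)) rfl
  refine Cmd.wp_mono (wp_run (o := 0) hE hG (by simp) st₀ hA hAc hkA (by simp)
    (by rw [v₀ 3 (by simp)]; exact hA') (fun j h1 _ i => h0 j (by omega) i)) ?_
  rintro σ₁ ⟨C, S, hAC, hC, hS, hmem, v₁, a₁, t₁⟩
  simp only [Cmd.wp_seq, Cmd.wp_set]
  refine ⟨by simp, ?_⟩
  set σ₂ := σ₁.set 6 ((Exp.var 5).val E σ₁) ((Exp.var 5).cost + 1) with hσ₂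
  have v₂ : ∀ y < 8, y ≠ 0 → y ≠ 5 → y ≠ 6 → σ₂.v y = σ.v y := fun y hy h1 h2 h3 => by
    rw [← v₀ y h1, ← v₁ y hy h2]; simp [hσ₂, h3]
  have v₂0 : σ₂.v 0 = 0 := by
    have h := v₁ 0 (by simp) (by simp)
    rw [v₀0] at h
    simpa [hσ₂] using h
  have st₂ : Stored n k off σ₂ := hσ.congr (v₂ 1 (by simp) (by simp) (by simp) (by simp))
    (v₂ 2 (by simp) (by simp) (by simp) (by simp)) (a₁ 0 (by simp))
  refine Cmd.wp_mono (wp_run (o := 13) hE hG (by simp) st₂ hB hBc hkB (by simp)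
    (by rw [v₂ 4 (by simp) (by simp) (by simp) (by simp)]; exact hB')
    (fun j h1 _ i => by
      change σ₁.a j i = 0
      rw [a₁ j (by omega)]
      exact h0 j (by omega) i)) ?_
  rintro σ₃ ⟨D, T, hBD, hD, hT, -, v₃, a₃, t₃⟩
  have hiff := tarReachable_iff hG hAC hBD hC hD (hcA ▸ hkA) (hcB ▸ hkB) hS hT
  have v6 : σ₃.v 6 = σ₁.v 5 := by rw [v₃ 6 (by simp) (by simp)]; simp [hσ₂]
  have v₃' : ∀ y < 8, y ≠ 0 → y ≠ 5 → y ≠ 6 → σ₃.v y = σ.v y := fun y hy h1 h2 h3 => by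
    rw [v₃ y hy h2, v₂ y hy h1 h2 h3]
  have t₃' : σ₃.t ≤ σ.t + 20 + 5600 * (weight adj Finset.univ + n + 1) := by
    have : σ₂.t = σ₁.t + 2 := by simp [hσ₂]
    omega
  have a12 : σ₃.a 12 = σ₁.a 12 := a₃ 12 (by simp)
  have hmem' : ∀ u : Fin n, σ₁.a 12 u ≠ 0 ↔ u ∈ S := hmem
  simp only [Cmd.wp_ite, Cmd.wp_skip, Cmd.wp_seq, Cmd.wp_set]
  refine ⟨by simp, fun hb => ⟨by simp; omega, ?_⟩, fun hb => ?_⟩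
  · have heq : σ₁.v 5 = σ₃.v 5 := by simpa [v6] using (Eq.symm hb)
    have hq : σ₃.v 4 = σ.v 4 := v₃' 4 (by simp) (by simp) (by simp) (by simp)
    -- The answer starts as `1` and drops to `0` at any vertex of `B` outside `S`, which is
    -- recognised by its colour `0`.
    refine Cmd.wp_forBlock (l := B) (fun j σ' =>
      ((∀ u ∈ B.take j, u ∈ S) → σ'.v 0 = 1) ∧ (¬ (∀ u ∈ B.take j, u ∈ S) → σ'.v 0 = 0) ∧
      σ'.v 3 = σ.v 3 ∧ σ'.v 4 = σ.v 4 ∧ σ'.a 12 = σ₁.a 12 ∧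
      σ'.t ≤ σ.t + 70 + 5600 * (weight adj Finset.univ + n + 1) + 50 * j) (σ.v 4) ?_ ?_ hB'
      hE.B_le_N (by simp) ?_ ?_ ?_
    · simp
    · simp [hq]
    · refine ⟨by simp, by simp, ?_, by simp [hq], a12, by simp; omega⟩
      simp [v₃' 3 (by simp) (by simp) (by simp) (by simp)]
    · rintro j hj σ' ⟨h1, h2, h3, h4, h5, h6⟩ he
      have hall : (∀ u ∈ B.take (j + 1), u ∈ S) ↔ (∀ u ∈ B.take j, u ∈ S) ∧ B[j] ∈ S := by
        rw [take_succ_of_lt hj]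
        simp only [List.mem_append, List.mem_singleton, or_imp, forall_and, forall_eq]
      have hj' := hmem' B[j]
      rw [hall]
      simp only [Cmd.wp_ite, Cmd.wp_skip, Cmd.wp_set]
      refine ⟨by simp, fun hb => ?_, fun hb => ?_⟩
      · have hS' : B[j] ∉ S := by
          rw [← hj', not_not]
          simpa [h5] using hb
        refine ⟨by simp, by simp, by simp [he], fun h => absurd h.2 hS', fun _ => by simp,
          by simp [h3], by simp [h4], by simpa using h5, by simp; omega⟩
      · have hS' : B[j] ∈ S := by
          rw [← hj']
          simpa [h5] using hb
        refine ⟨by simp, by simp [he], fun h => by simp [h1 h.1],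
          fun h => ?_, by simp [h3], by simp [h4], by simpa using h5, by simp; omega⟩
        have := h2 fun h' => h ⟨h', hS'⟩
        simp [this]
    · rintro σ' ⟨h1, h2, h3, h4, h5, h6⟩
      rw [List.take_length] at h1 h2
      have hsub : B.toFinset ⊆ S ↔ ∀ u ∈ B, u ∈ S := by
        simp [Finset.subset_iff]
      rw [hiff, hsub]
      exact ⟨fun h => h1 h.2, fun h => h2 fun h' => h ⟨heq, h'⟩, h3, h4, by simp; omega⟩
  · have hne : ¬ σ₁.v 5 = σ₃.v 5 := fun h => hb (by simp [v6, h])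
    rw [hiff]
    refine ⟨fun h => absurd h.1 hne, fun _ => ?_, ?_, ?_, by simp; omega⟩
    · rw [St.tick_v, St.tick_v, v₃ 0 (by simp) (by simp), v₂0]
    · exact v₃' 3 (by simp) (by simp) (by simp) (by simp)
    · exact v₃' 4 (by simp) (by simp) (by simp) (by simp)

/-- `pos i` is the address of the adjacency list of `i`, and `pos n` that of the first clique. -/
structure Format (E : Env) (n : ℕ) (adj : Fin n → List (Fin n)) (A B : List (Fin n)) (p : ℕ)
    (pos : ℕ → ℕ) : Prop where
  lt : p < E.B
  n_eq : E.inp p = n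
  pos_zero : pos 0 = p + 1
  pos_succ : ∀ v : Fin n, pos (v + 1) = pos v + (adj v).length + 1
  block : ∀ v : Fin n, IsBlock E (pos v) (adj v)
  block_source : IsBlock E (pos n) A
  block_target : IsBlock E (pos n + A.length + 1) B
  B_eq : E.B = pos n + A.length + 1 + B.length + 1

/-- Only variables are written, since the free memory begins at the end of the input, which is not
yet known. Lists are skipped by their lengths, in constant time each. -/
theorem wp_scan {A B : List (Fin n)} {p : ℕ} {pos : ℕ → ℕ} {σ : St}
    (hF : Format E n adj A B p pos) (hN : E.B ≤ E.N) (hn : n + 1 ≤ E.N) :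
    (Cmd.scan p).wp E (fun σ' => σ'.v 1 = n ∧ σ'.v 3 = pos n ∧ σ'.v 4 = pos n + A.length + 1 ∧
      σ'.v 7 = E.B ∧ σ'.a = σ.a ∧ σ'.t ≤ σ.t + 50 * (n + 1)) σ := by
  have hlt := hF.lt
  simp only [Cmd.scan, Cmd.wp_seq, Cmd.wp_set]
  refine ⟨by simp; omega, by simp; omega, ?_⟩
  refine Cmd.wp_forVar n (fun i σ' => σ'.v 1 = n ∧ σ'.v 7 = pos i ∧ σ'.a = σ.a ∧
    σ'.t ≤ σ.t + 20 + 30 * i) hn ?_ ?_ ?_ ?_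
  · exact ⟨by simp [hF.n_eq], by simp [hF.pos_zero], rfl, by simp⟩
  · exact fun i σ' h => h.1
  · rintro i hi σ' ⟨h1, h2, h3, h4⟩ hx
    have hb := hF.block ⟨i, hi⟩
    have hb1 := hb.1
    have hb2 := hb.2.1
    have := hF.pos_succ ⟨i, hi⟩
    simp only at hb1 hb2 this
    simp only [Cmd.wp_set]
    refine ⟨by simp [h2, hb2]; omega, by simp [hx], by simp [h1], ?_, h3, by simp; omega⟩
    simp [h2, hb2]
    omega
  · rintro σ' ⟨h1, h2, h3, h4⟩
    have hs := hF.block_source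
    have ht := hF.block_target
    have := hF.B_eq
    simp only [Cmd.wp_seq, Cmd.wp_set]
    refine ⟨by simp, ?_, ?_, by simp [h1], by simp [h2], ?_, ?_, h3, by simp; omega⟩
    · simp [h2, hs.2.1]; omega
    · simp [h2, hs.2.1, ht.2.1]; omega
    · simp [h2, hs.2.1]
    · simp [h2, hs.2.1, ht.2.1]; omega

theorem wp_index {A B : List (Fin n)} {p : ℕ} {pos : ℕ → ℕ} {σ : St}
    (hF : Format E n adj A B p pos) (hN : E.B ≤ E.N) (hB : E.B ≤ E.base) (hn : n + 1 ≤ E.N)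
    (hσ : σ.v 1 = n) :
    (Cmd.index p).wp E (fun σ' => (∀ v : Fin n, σ'.a 0 v = pos v) ∧
      (∀ y < 7, σ'.v y = σ.v y) ∧ (∀ j, j ≠ 0 → σ'.a j = σ.a j) ∧
      σ'.t ≤ σ.t + 50 * (n + 1)) σ := by
  have hlt := hF.lt
  simp only [Cmd.index, Cmd.wp_seq, Cmd.wp_set]
  refine ⟨by simp; omega, ?_⟩
  refine Cmd.wp_forVar n (fun i σ' => (∀ v : Fin n, (v : ℕ) < i → σ'.a 0 v = pos v) ∧
    σ'.v 7 = pos i ∧ (∀ y < 7, σ'.v y = σ.v y) ∧ (∀ j, j ≠ 0 → σ'.a j = σ.a j) ∧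
    σ'.t ≤ σ.t + 20 + 40 * i) hn ?_ ?_ ?_ ?_
  · refine ⟨by simp, by simp [hF.pos_zero], fun y hy => ?_, fun j _ => rfl, by simp⟩
    have h1 : y ≠ 7 := by omega
    have h2 : y ≠ 9 := by omega
    simp [h1, h2]
  · rintro i σ' ⟨-, -, h, -⟩
    rw [h 1 (by simp), hσ]
  · rintro i hi σ' ⟨h1, h2, h3, h4, h5⟩ hx
    have hb := hF.block ⟨i, hi⟩
    have hb1 := hb.1
    have hb2 := hb.2.1
    have := hF.pos_succ ⟨i, hi⟩
    simp only at hb1 hb2 this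
    simp only [Cmd.wp_seq, Cmd.wp_set, Cmd.wp_put]
    refine ⟨by simp, by simp, by simp, hB, by simp [h2, hb2]; omega, by simp [hx],
      fun v hv => ?_, ?_, fun y hy => ?_, fun j hj => ?_, by simp; omega⟩
    · by_cases hvi : (v : ℕ) = i
      · simp [hx, hvi, h2]
      · simp [hx, hvi, h1 v (by omega)]
    · simp [h2, hb2]; omega
    · have h6 : y ≠ 7 := by omega
      have h7 : y ≠ 9 := by omega
      simp [h6, h7, h3 y hy]
    · ext r
      simp [hj, h4 j hj]
  · rintro σ' ⟨h1, h2, h3, h4, h5⟩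
    exact ⟨fun v => h1 v v.2, h3, h4, by simp; omega⟩

end

/-! ### Linear time -/

open CographInstance

/-- The largest of the length and the words is an upper bound. -/
theorem le_magnitude (x : List ℕ) : x.length ≤ magnitude x ∧ ∀ y ∈ x, y ≤ magnitude x := by
  have key : ∀ (l : List ℕ) (b : ℕ), b ≤ l.foldr max b ∧ ∀ y ∈ l, y ≤ l.foldr max b := by
    intro l b
    induction l with
    | nil => simp
    | cons a l ih =>
      simp only [List.foldr_cons, List.mem_cons, forall_eq_or_imp]
      exact ⟨ih.1.trans (le_max_right _ _), le_max_left _ _,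
        fun y hy => (ih.2 y hy).trans (le_max_right _ _)⟩
  exact key x x.length

theorem getD_le_magnitude (x : List ℕ) (i : ℕ) : x.getD i 0 ≤ magnitude x := by
  by_cases hi : i < x.length
  · rw [List.getD_eq_getElem _ _ hi]
    exact (le_magnitude x).2 _ (List.getElem_mem hi)
  · rw [List.getD_eq_default _ _ (by omega)]
    exact Nat.zero_le _

theorem isBlock_append {E : Env} {n : ℕ} {x a b : List ℕ} {l : List (Fin n)}
    (hinp : E.inp = fun i => x.getD i 0) (hB : E.B = x.length) (hx : x = a ++ (block l ++ b)) :
    IsBlock E a.length l := by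
  subst hx
  refine ⟨by simp [hB, block], by simp [hinp, block], fun j hj => ?_⟩
  rw [hinp]
  simp only
  rw [List.getD_append_right _ _ _ _ (by omega), List.getD_append _ _ _ _ (by simp [block]; omega)]
  have : a.length + 1 + j - a.length = j + 1 := by omega
  rw [this]
  simp [block, hj]

/-- The address of the adjacency list of `i` when the graph starts at the address `p`. -/
def address (I : CographInstance) (p i : ℕ) : ℕ :=
  p + 1 + (((List.finRange I.n).take i).flatMap fun v => block (I.adj v)).length

theorem format {E : Env} (I : CographInstance) (pre : List ℕ)
    (hinp : E.inp = fun i => (pre ++ I.input).getD i 0) (hB : E.B = (pre ++ I.input).length) :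
    Format E I.n I.adj I.source I.target pre.length (address I pre.length) := by
  have hfull : (List.finRange I.n).take I.n = List.finRange I.n :=
    List.take_of_length_le (by simp)
  have hstep : ∀ v : Fin I.n, (List.finRange I.n).drop v =
    v :: (List.finRange I.n).drop (v + 1) := by
    intro v
    rw [List.drop_eq_getElem_cons (by simp)]
    simp
  refine ⟨by simp [hB, input], by simp [hinp, input], by simp [address], fun v => ?_, fun v => ?_,
    ?_, ?_, ?_⟩
  · have : (List.finRange I.n).take (v + 1) = (List.finRange I.n).take v ++ [v] := by
      rw [List.take_succ_eq_append_getElem (by simp)]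
      simp
    simp only [address, this, List.flatMap_append, List.length_append, List.flatMap_singleton]
    simp [block]
    omega
  · have := isBlock_append (a := pre ++ I.n ::
      ((List.finRange I.n).take v).flatMap fun v => block (I.adj v))
      (b := ((List.finRange I.n).drop (v + 1)).flatMap (fun v => block (I.adj v)) ++
        (block I.source ++ block I.target)) (l := I.adj v) hinp hB (by
        conv_lhs => rw [input, ← List.take_append_drop v (List.finRange I.n), hstep]
        simp)
    convert this using 1
    simp [address]
    omega
  · have := isBlock_append (a := pre ++ I.n ::
      (List.finRange I.n).flatMap fun v => block (I.adj v))
      (b := block I.target) (l := I.source) hinp hB (by simp [input])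
    convert this using 1
    simp [address, hfull]
    omega
  · have := isBlock_append (a := pre ++ I.n ::
      (List.finRange I.n).flatMap (fun v => block (I.adj v)) ++ block I.source)
      (b := []) (l := I.target) hinp hB (by simp [input])
    convert this using 1
    simp [address, hfull, block]
    omega
  · simp [address, hfull, block, hB, input]
    omega

/-- The handshake lemma, which makes bounds by weight linear in vertices plus edges. -/
theorem weight_univ (I : CographInstance) :
    weight I.adj Finset.univ = I.n + 2 * I.graph.edgeSet.ncard := by
  classical
  have h : ∀ v, (I.adj v).length = I.graph.degree v := fun v => by
    rw [← List.toFinset_card_of_nodup (I.adj_nodup v), ← SimpleGraph.card_neighborFinset_eq_degree]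
    congr 1
    ext w
    simp [I.mem_adj]
  rw [Set.ncard_eq_toFinset_card', ← SimpleGraph.edgeFinset,
    ← SimpleGraph.sum_degrees_eq_twice_card_edges]
  simp [weight, Finset.sum_add_distrib, h, add_comm]

/-- Decide whether the condition `g` holds and the second clique is reachable from the first with
the threshold `e`, when the graph starts at the address `p` of the input. The arrays are placed
behind the input, once its end is known. -/
def solver (p : ℕ) (e : Exp) (g : Cond) : Program :=
  .seq (Cmd.scan p).compile (.seq (.instr (.move 1 14))
    (Cmd.index p ;; 2 ::= e ;; Cmd.decideTAR ;; Cmd.ite g Cmd.skip (0 ::= 0)).compile)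

theorem exec_solver (I : CographInstance) (pre : List ℕ) {e : Exp} {g : Cond} {k W : ℕ} {P : Prop}
    (hW : 1024 * (magnitude (pre ++ I.input) + 2) ≤ W) (hk : k ≤ magnitude (pre ++ I.input))
    (he : ∀ (E : Env) (σ : St), E.inp = (fun i => (pre ++ I.input).getD i 0) →
      E.B = (pre ++ I.input).length → 10 ≤ E.N → IsBlock E (σ.v 3) I.source →
        e.Ok E σ ∧ e.val E σ = k)
    (hg : ∀ (E : Env) (σ : St), 10 ≤ E.N → IsBlock E (σ.v 3) I.source →
      IsBlock E (σ.v 4) I.target → g.Ok E σ ∧ (g.Holds E σ ↔ P))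
    (hec : e.cost ≤ 10) (hgc : g.cost ≤ 10) :
    ∃ t s, Exec W (solver pre.length e g) (start (pre ++ I.input)) t s ∧
      t ≤ 20000 * (I.size + 1) ∧
      (P ∧ TARReachable I.graph k I.source.toFinset I.target.toFinset → s.reg 0 = 1) ∧
      (¬ (P ∧ TARReachable I.graph k I.source.toFinset I.target.toFinset) → s.reg 0 = 0) := by
  set x := pre ++ I.input with hx
  set m := magnitude x with hm
  have hlen : x.length ≤ m := (le_magnitude x).1
  have hget : ∀ i, x.getD i 0 ≤ m := getD_le_magnitude x
  have hn : I.n ≤ m := (le_magnitude x).2 _ (by simp [hx, input])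
  -- During the scan the base is `0` and the arrays are just a view of the whole memory; afterwards
  -- they start behind the input. The bound `4 * m + 18` leaves room for `2 * n + k + 10`, and `32`
  -- times it fits below `W`.
  let E₀ : Env := ⟨W, 0, x.length, 4 * m + 18, fun i => x.getD i 0,
    fun i _ => (hget i).trans (by omega), by omega⟩
  let E₁ : Env := ⟨W, x.length, x.length, 4 * m + 18, fun i => x.getD i 0,
    fun i _ => (hget i).trans (by omega), by omega⟩
  have F₀ : Format E₀ I.n I.adj I.source I.target pre.length (address I pre.length) :=
    format I pre rfl rfl
  have F₁ : Format E₁ I.n I.adj I.source I.target pre.length (address I pre.length) :=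
    format I pre rfl rfl
  have R₀ : Rep E₀ ⟨fun _ => 0, fun j i => x.getD (32 * i + j) 0, 0⟩ (start x) := by
    refine ⟨fun _ => rfl, rfl, fun _ _ => rfl, fun j _ i => ?_, ⟨fun _ => ?_, fun i => ?_⟩,
      fun _ => Nat.zero_le _, fun j _ i => (hget _).trans ?_⟩
    · simp [E₀, start]
    · simp only [start, E₀]; omega
    · have := hget i
      simp only [start, E₀]; omega
    · simp only [E₀]; omega
  obtain ⟨t₁, s₁, σ₁, x₁, r₁, ht₁, n₁, p₁, q₁, b₁, a₁, c₁⟩ := Cmd.exec_compile (Cmd.scan pre.length)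
    (wp_scan F₀ (by simp only [E₀]; omega) (by simp only [E₀]; omega)) R₀
  -- With base `0` the interleaved arrays cover every cell, so unchanged arrays mean unchanged
  -- memory.
  have hmem : s₁.mem = fun i => x.getD i 0 := by
    ext i
    have h := r₁.arr (i % 32) (Nat.mod_lt _ (by simp)) (i / 32)
    rw [a₁] at h
    simp only [E₀, zero_add, Nat.div_add_mod] at h
    exact h
  have hr14 : s₁.reg 14 = x.length := by rw [r₁.reg 7, b₁]
  -- Register `14` holds variable `7`, the end of the input, which becomes the base.
  have x₂ : Exec W (.instr (.move 1 14)) s₁ 1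
      { s₁ with reg := Function.update s₁.reg 1 x.length } :=
    exec_reg r₁.fits (by simp [Instr.eval, hr14]) (by simp only [E₀]; omega)
  -- Behind the input the memory is still zero, so all arrays start out as zero.
  have R₁ : Rep E₁ ⟨σ₁.v, fun _ _ => 0, 0⟩
      { s₁ with reg := Function.update s₁.reg 1 x.length } := by
    refine ⟨fun y => ?_, by simp [E₁], fun i _ => by simp [hmem, E₁], fun j _ i => ?_,
      r₁.fits.update (by simp only [E₀]; omega), r₁.v_le, fun _ _ _ => Nat.zero_le _⟩
    · have : 2 * y ≠ 1 := by omega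
      simp [this, r₁.reg]
    · simp only [hmem, E₁]
      exact List.getD_eq_default _ _ (by omega)
  have L : Layout E₁ I.n I.graph I.adj (fun v => address I pre.length v) k :=
    ⟨I.adj_nodup, I.mem_adj, F₁.block, le_rfl, by simp only [E₁]; omega, by simp only [E₁]; omega⟩
  have hsize : weight I.adj Finset.univ + I.n ≤ 2 * I.size := by
    rw [weight_univ, size]; omega
  have hns : I.n ≤ I.size := by rw [size]; omega
  have hprog : (Cmd.index pre.length ;; 2 ::= e ;; Cmd.decideTAR ;;
      Cmd.ite g Cmd.skip (0 ::= 0)).wp E₁ (fun σ =>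
        (P ∧ TARReachable I.graph k I.source.toFinset I.target.toFinset → σ.v 0 = 1) ∧
        (¬ (P ∧ TARReachable I.graph k I.source.toFinset I.target.toFinset) → σ.v 0 = 0) ∧
        σ.t ≤ 100 + 50 * (I.n + 1) + 6000 * (weight I.adj Finset.univ + I.n + 1))
      ⟨σ₁.v, fun _ _ => 0, 0⟩ := by
    rw [Cmd.wp_seq]
    refine Cmd.wp_mono (wp_index F₁ (by simp only [E₁]; omega) le_rfl (by simp only [E₁]; omega)
      n₁) ?_
    rintro σ₂ ⟨o₂, v₂, a₂, c₂⟩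
    have h3 : IsBlock E₁ (σ₂.v 3) I.source := by
      rw [v₂ 3 (by simp)]; exact p₁ ▸ F₁.block_source
    have h4 : IsBlock E₁ (σ₂.v 4) I.target := by
      rw [v₂ 4 (by simp)]; exact q₁ ▸ F₁.block_target
    obtain ⟨he₁, he₂⟩ := he E₁ σ₂ rfl rfl (by simp only [E₁]; omega) h3
    rw [Cmd.wp_seq, Cmd.wp_set]
    refine ⟨he₁, ?_⟩
    rw [Cmd.wp_seq]
    refine Cmd.wp_mono (wp_decideTAR L (P4Free.of_isCograph I.isCograph) (A := I.source)
      (B := I.target) ⟨?_, ?_, ?_⟩ I.source_nodup I.source_isClique I.target_nodup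
      I.target_isClique ?_ ?_ ?_) ?_
    · simp [v₂, n₁]
    · simp [he₂]
    · exact fun v => o₂ v
    · simpa using h3
    · simpa using h4
    · intro j hj i
      rw [St.set_a, a₂ j (by omega)]
    · rintro σ₃ ⟨h1, h0, e3, e4, c₃⟩
      simp only [St.set_v, St.set_t] at e3 e4 c₃
      simp only [Cmd.wp_ite, Cmd.wp_skip, Cmd.wp_set]
      obtain ⟨hg₁, hg₂⟩ := hg E₁ σ₃ (by simp only [E₁]; omega) (by simpa [e3] using h3)
        (by simpa [e4] using h4)
      refine ⟨hg₁, fun hb => ⟨fun h => ?_, fun h => ?_, ?_⟩, fun hb => ⟨?_, fun h => ?_,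
        fun h => ?_, ?_⟩⟩
      · exact h1 h.2
      · exact h0 fun h' => h ⟨hg₂.1 hb, h'⟩
      · simp only [St.tick_t] at *; omega
      · simp
      · exact absurd (hg₂.2 h.1) hb
      · simp
      · simp only [St.tick_t, St.set_t, Exp.cost_ofNat] at *; omega
  obtain ⟨t₂, s₂, σ₂, x₃, r₂, ht₂, y₂, n₂, c₂⟩ := Cmd.exec_compile _ hprog R₁
  refine ⟨t₁ + (1 + t₂), s₂, x₁.seq (x₂.seq x₃), ?_, fun h => ?_, fun h => ?_⟩
  · simp only at ht₁ c₁ ht₂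
    omega
  · exact (r₂.reg 0).trans (y₂ h)
  · exact (r₂.reg 0).trans (n₂ h)

/-- Since `1024` is `2 ^ 10`, ten factors `m + 2` absorb the constant. -/
theorem mul_le_pow_word (m : ℕ) {c : ℕ} (hc : 11 ≤ c) : 1024 * (m + 2) ≤ (m + 2) ^ c :=
  calc 1024 * (m + 2) = 2 ^ 10 * (m + 2) := by norm_num
    _ ≤ (m + 2) ^ 10 * (m + 2) := Nat.mul_le_mul_right _ (Nat.pow_le_pow_left (by omega) _)
    _ = (m + 2) ^ 11 := (pow_succ _ _).symm
    _ ≤ (m + 2) ^ c := Nat.pow_le_pow_right (by omega) hc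

theorem length_source_le (I : CographInstance) : I.source.length ≤ magnitude I.input := by
  refine (le_magnitude _).2 _ ?_
  simp [input, block]

/-- Serves sliding and jumping alike: the threshold is computed from the length of the first clique,
and the guard compares the two lengths. -/
theorem solvable_of_threshold {R : CographInstance → Prop} {e : Exp} {f : ℕ → ℕ}
    (hf : ∀ c, f c ≤ c) (hec : e.cost ≤ 10)
    (he : ∀ (E : Env) (σ : St) (I : CographInstance), 10 ≤ E.N → IsBlock E (σ.v 3) I.source →
      e.Ok E σ ∧ e.val E σ = f I.source.length)
    (hR : ∀ I, R I ↔ I.source.toFinset.card = I.target.toFinset.card ∧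
      TARReachable I.graph (f I.source.toFinset.card) I.source.toFinset I.target.toFinset) :
    SolvableInLinearTime CographInstance.input CographInstance.size R := by
  -- One constant serves as exponent of the word bound and as factor of the running time; kept
  -- opaque, the huge power is never evaluated.
  obtain ⟨c, hc⟩ : ∃ c, c = 20000 := ⟨_, rfl⟩
  refine ⟨solver 0 e (.eq (.inp (.var 3)) (.inp (.var 4))), c, fun I => ?_⟩
  simp only [hR I, List.toFinset_card_of_nodup I.source_nodup,
    List.toFinset_card_of_nodup I.target_nodup]
  obtain ⟨t, s, h₁, h₂, h₃⟩ := exec_solver (W := (magnitude I.input + 2) ^ c) I []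
    (g := .eq (.inp (.var 3)) (.inp (.var 4))) (P := I.source.length = I.target.length)
    (mul_le_pow_word _ (by omega)) ((hf _).trans (length_source_le I))
    (fun E σ _ _ h h' => he E σ I h h')
    (fun E σ _ h h' => ⟨by have := h.1; have := h'.1; simp; omega, by simp [h.2.1, h'.2.1]⟩)
    hec (by simp)
  exact ⟨t, s, h₁, hc ▸ h₂, h₃⟩

theorem solvable_tar :
    SolvableInLinearTime (fun a : CographInstance × ℕ => a.2 :: a.1.input) (fun a => a.1.size)
      (fun a => TARReachable a.1.graph a.2 a.1.source.toFinset a.1.target.toFinset) := by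
  obtain ⟨c, hc⟩ : ∃ c, c = 20000 := ⟨_, rfl⟩
  -- The threshold occupies cell `0`, so the graph starts at the address `1`; the guard is trivially
  -- true, as the two cliques may differ in size.
  refine ⟨solver 1 (.inp 0) (.eq 0 0), c, fun ⟨I, k⟩ => ?_⟩
  obtain ⟨t, s, h₁, h₂, h₃⟩ := exec_solver (W := (magnitude (k :: I.input) + 2) ^ c) I [k]
    (e := .inp 0) (g := .eq 0 0) (P := True) (k := k)
    (mul_le_pow_word _ (by omega)) ((le_magnitude _).2 _ (by simp))
    (fun E σ h h' _ _ => by simp [h, h']) (fun E σ _ _ _ => by simp) (by simp) (by simp)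
  simp only [true_and] at h₃
  exact ⟨t, s, h₁, hc ▸ h₂, h₃⟩

end RAM

theorem proposition2 :
    -- token addition and removal; the threshold `k` is part of the input
    RAM.SolvableInLinearTime
      (fun a : CographInstance × ℕ => a.2 :: a.1.input)
      (fun a => a.1.size)
      (fun a => CliqueReconf.TARReachable a.1.graph a.2
        a.1.source.toFinset a.1.target.toFinset) ∧
    -- token sliding
    RAM.SolvableInLinearTime
      (fun I : CographInstance => I.input)
      (fun I => I.size)
      (fun I => CliqueReconf.TSReachable I.graph I.source.toFinset I.target.toFinset) ∧
    -- token jumping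
    RAM.SolvableInLinearTime
      (fun I : CographInstance => I.input)
      (fun I => I.size)
      (fun I => CliqueReconf.TJReachable I.graph I.source.toFinset I.target.toFinset) := by
  refine ⟨RAM.solvable_tar, ?_, ?_⟩
  · refine RAM.solvable_of_threshold (e := .inp (.var 3)) (f := fun c => c) (fun _ => le_rfl)
      (by simp) (fun E σ I _ h => ?_) fun I => CliqueReconf.tsReachable_iff
    have := h.1
    exact ⟨by simp; omega, by simp [h.2.1]⟩
  · refine RAM.solvable_of_threshold (e := .inp (.var 3) - 1) (f := fun c => c - 1)
      (fun _ => Nat.sub_le _ _) (by simp) (fun E σ I hN h => ?_)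
      fun I => CliqueReconf.tjReachable_iff I.target_isClique
    have := h.1
    exact ⟨by simp; omega, by simp [h.2.1]⟩
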